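/- **Setting.** Let $\mathbb F$ be a field. A $\mathbb Z/2\mathbb Z$-graded Fredholm complex $D=(X,d)$ consists of vector spaces $X_\pm$ over $\mathbb F$ and linear maps $d_+:X_+\to X_-$, $d_-:X_-\to X_+$ with $d_-d_+=0=d_+d_-$ whose homology groups $H_+(D)=\ker d_+/\operatorname{Im} d_-$ and $H_-(D)=\ker d_- /\operatorname{Im} d_+$ are finite dimensional. Put $\operatorname{Ind}(D)=\dim H_+(D)-\dim H_-(D)$ and $|D|=\det H_+(D)\otimes(\det H_-(D))^*$, where $\det=\Lambda^{\mathrm{top}}$; for a non-zero vector $v$ of a line, $v^*$ is the dual vector with $v^*(v)=1$. An isomorphism of finite dimensional spaces and the map it induces on determinants are denoted by the same letter. **Perturbation isomorphism.** A pseudo-inverse of a linear map $A$ is a linear map $A^\dagger$ with $AA^\dagger A=A$ and $A^\dagger AA^\dagger=A^\dagger$. Let $A,B:V\to W$ be Fredholm operators (finite dimensional kernel and cokernel) of index $0$ such that $A-B$ has finite rank. Choose pseudo-inverses $A^\dagger,B^\dagger$, put $P_A=1-A^\dagger A$ and $Q_B=1-BB^\dagger$, and choose linear maps $\mathcal L:\ker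 A\to W$ and $\mathcal M:\ker B^\dagger\to V$ that induce isomorphisms $\ker A\to\operatorname{Coker}A$ and $\ker B^\dagger\to\operatorname{Coker}B^\dagger$. With the identifications $\ker B^\dagger\cong\operatorname{Coker}B$ and $\ker B\cong\operatorname{Coker}B^\dagger$, the perturbation isomorphism $$P(B,A):\det(\ker A)\otimes\det(\operatorname{Coker}A)^*\to\det(\ker B)\otimes\det(\operatorname{Coker}B)^*$$ is given by $s\otimes(\mathcal Ls)^*\mapsto\det(\Sigma)^{-1}\cdot \mathcal Mt\otimes t^*$ for non-zero $s\in\det(\ker A)$, $t\in\det(\operatorname{Coker} B)$, where $\Sigma=(B^\dagger+\mathcal MQ_B)(A+\mathcal LP_A)$ is an invertible operator on $V$, $1-\Sigma$ has finite rank, and $\det(\Sigma)$ is the determinant of the restriction of $\Sigma$ to any finite dimensional subspace containing $\operatorname{Im}(1-\Sigma)$. If $D=(X,d)$ and $E=(X,\delta)$ are $\mathbb Z/2\mathbb Z$-graded Fredholm complexes of index $0$ such that $d_\pm-\delta_\pm$ have finite rank, choose complexes $D^\dagger=(d_+^\dagger,d_-^\dagger)$ and $E^\dagger=(\delta_+^\dagger,\delta_-^\dagger)$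 formed by pseudo-inverses of the differentials such that $d_\pm^\dagger-\delta_\pm^\dagger$ have finite rank. The perturbation isomorphism $P(E,D):|D|\to|E|$ is the perturbation isomorphism from $d_++d_-^\dagger$ to $\delta_++\delta_-^\dagger$, transported by the canonical isomorphisms $\ker(d_++d_-^\dagger)\cong H_+(D)$, $\operatorname{Coker}(d_++d_-^\dagger)\cong H_-(D)$ and the same ones for $E$. **Proposition.** Let $D=(X,d)$ be a $\mathbb Z/2\mathbb Z$-graded Fredholm complex and let $n_+,n_-\ge 0$ be integers with $\operatorname{Ind}(D)=n_--n_+$. Let $\widetilde D=D\oplus(\mathbb F^{n_+}\oplus\mathbb F^{n_-},0)$, with spaces $X_\pm\oplus\mathbb F^{n_\pm}$. Let $F_-:\mathbb F^{n_-}\to X_+$, $F_+:\mathbb F^{n_+}\to X_-$ and $N_+:\mathbb F^{n_+}\to\mathbb F^{n_-}$ be linear maps with $$d_+F_-=0,\quad d_-F_+=0,\quad F_-N_+=0,\quad F_+(\ker N_+)=\operatorname{Im}F_+,$$ and let $\widehat D$ be the complex on the same spaces as $\widetilde D$ with differentials $$\widehat d_+=\begin{pmatrix}d_+&F_+\\0&N_+\end{pmatrix},\qquad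 \widehat d_-=\begin{pmatrix}d_-&F_-\\0&0\end{pmatrix}.$$ Put $W_+=\{\lambda\in\ker N_+: F_+\lambda\in\operatorname{Im}d_+\}$ and $W_-=\{\lambda\in\mathbb F^{n_-}:F_-\lambda\in\operatorname{Im}d_-\}$. Let $L:H_+(\widetilde D)\to H_-(\widetilde D)$ and $M:H_-(\widehat D)\to H_+(\widehat D)$ be isomorphisms. Suppose that there are subspaces $V_+\subseteq\ker N_+$, $Z_+\subseteq\ker F_+$, $V_-\subseteq\mathbb F^{n_-}$, $Q_+\subseteq\ker d_+$, $Q_-\subseteq\ker d_-$ such that: 1. $\ker N_+=V_+\oplus W_+$, $\ \mathbb F^{n_+}=V_+\oplus W_+\oplus Z_+$ and $\mathbb F^{n_-}=V_-\oplus W_-$ (internal direct sums). 2. The quotient maps $Q_+\to\ker d_+/(\operatorname{Im}d_-+\operatorname{Im}F_-)$ and $Q_-\to\ker d_- /(\operatorname{Im}d_++\operatorname{Im}F_+)$ are isomorphisms. 3. $L[F_-v_-,\,v_++z_+]=[F_+v_+,\,v_-+N_+z_+]$ for all $v_\pm\in V_\pm$ and $z_+\in Z_+$. 4. $\phi_+\circ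 M=L^{-1}\circ\phi_-$, where $\phi_\pm:H_\pm(\widehat D)\to H_\pm(\widetilde D)$ are induced by $(\xi,\lambda)\mapsto(E_+\xi,\lambda)$ and $(\eta,\mu)\mapsto(E_-\eta,(1-\Omega_-)\mu)$ for some idempotents $E_\pm$ of $X_\pm$ and $\Omega_-$ of $\mathbb F^{n_-}$ with $\operatorname{Im}E_\pm=Q_\pm$, $\operatorname{Im}\Omega_-=\operatorname{Im}N_+$, $E_+|_{\operatorname{Im}d_-+\operatorname{Im}F_-}=0$ and $E_-|_{\operatorname{Im}d_++\operatorname{Im}F_+}=0$. Then the perturbation isomorphism $P(\widehat D,\widetilde D):|\widetilde D|\to|\widehat D|$ exists and, whatever choices are made in its construction, is given by $$P(\widehat D,\widetilde D):\ s_+\otimes(Ls_+)^*\mapsto Ms_-\otimes s_-^*$$ for all non-zero vectors $s_+\in\det H_+(\widetilde D)$ and $s_-\in\det H_-(\widehat D)$. -/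

import Mathlib

open scoped TensorProduct

/-! ## Determinant lines -/

/-- The determinant `det V = Λ^top V` of a finite dimensional vector space, as the top degree part
of the exterior algebra of `V`. -/
noncomputable abbrev DetLine (F : Type*) [Field F] (V : Type*) [AddCommGroup V] [Module F V] :
    Submodule F (ExteriorAlgebra F V) :=
  ⋀[F]^(Module.finrank F V) V

section Det

variable {F : Type*} [Field F] {V W : Type*} [AddCommGroup V] [Module F V]
  [AddCommGroup W] [Module F W]

theorem map_mem_detLine (e : V ≃ₗ[F] W) (x : ExteriorAlgebra F V) (hx : x ∈ DetLine F V) :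
    (ExteriorAlgebra.map (e : V →ₗ[F] W)).toLinearMap x ∈ DetLine F W := by
  have h : (DetLine F V).map (ExteriorAlgebra.map (e : V →ₗ[F] W)).toLinearMap ≤ DetLine F W := by
    unfold DetLine
    rw [← e.finrank_eq]
    rw [Submodule.map_pow]
    refine pow_le_pow_left₀ bot_le ?_ _
    rintro _ ⟨_, ⟨v, rfl⟩, rfl⟩
    exact ⟨e v, by simp⟩
  exact h ⟨x, hx, rfl⟩

/-- The map `det e : det V → det W` of determinant lines induced by an isomorphism `e : V ≃ W`. -/
noncomputable def detMap (e : V ≃ₗ[F] W) : DetLine F V →ₗ[F] DetLine F W :=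
  (ExteriorAlgebra.map (e : V →ₗ[F] W)).toLinearMap.restrict (map_mem_detLine e)

/-- `φ` is the dual vector `v^*` of the non-zero vector `v` of the line `Λ`: the unique functional
on `Λ` whose value at `v` is `1`. -/
def IsDualVector {Λ : Type*} [AddCommGroup Λ] [Module F Λ] (φ : Module.Dual F Λ) (v : Λ) : Prop :=
  φ v = 1

theorem apply_mem_of_range_one_sub_le {T : V →ₗ[F] V} {E : Submodule F V}
    (hE : LinearMap.range (LinearMap.id - T) ≤ E) (x : V) (hx : x ∈ E) : T x ∈ E := by
  have h : x - T x ∈ E := hE ⟨x, rfl⟩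
  simpa using E.sub_mem hx h

/-- The determinant of an endomorphism `T` such that `1 - T` has finite rank: the determinant of
the restriction of `T` to the finite dimensional invariant subspace `Im (1 - T)`. Any larger finite
dimensional invariant subspace gives the same value, see `detClassDet_eq`. -/
noncomputable def detClassDet (T : V →ₗ[F] V) : F :=
  LinearMap.det (T.restrict (apply_mem_of_range_one_sub_le (T := T) le_rfl))

/-- The determinant does not depend on the finite dimensional subspace used to compute it. -/
theorem detClassDet_eq (T : V →ₗ[F] V) (E : Submodule F V) [FiniteDimensional F E]
    (hE : LinearMap.range (LinearMap.id - T) ≤ E) :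
    detClassDet T = LinearMap.det (T.restrict (apply_mem_of_range_one_sub_le hE)) := by
  set R := LinearMap.range (LinearMap.id - T) with hR
  set TE : E →ₗ[F] E := T.restrict (apply_mem_of_range_one_sub_le hE) with hTE
  let R' : Submodule F E := R.submoduleOf E
  have he : R' ≤ R'.comap TE := by
    intro x hx
    exact apply_mem_of_range_one_sub_le (T := T) (E := R) le_rfl x.1 hx
  rw [LinearMap.det_eq_det_mul_det R' TE he]
  have h2 : R'.mapQ R' TE he = LinearMap.id := by
    ext x
    simp only [LinearMap.comp_apply, Submodule.mkQ_apply, Submodule.mapQ_apply, LinearMap.id_apply]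
    rw [Submodule.Quotient.eq]
    change (TE x : V) - (x : V) ∈ R
    rw [← neg_sub]
    exact R.neg_mem ⟨x.1, rfl⟩
  rw [h2, LinearMap.det_id, mul_one]
  let e : R' ≃ₗ[F] R := Submodule.submoduleOfEquivOfLe hE
  unfold detClassDet
  rw [← LinearMap.det_conj _ e]
  congr 1

end Det

/-! ## Pseudo-inverses and perturbation isomorphisms of Fredholm operators -/

section Operators

variable {F : Type*} [Field F] {V W : Type*} [AddCommGroup V] [Module F V]
  [AddCommGroup W] [Module F W]

/-- `A'` is a pseudo-inverse of `A`: then `A A'` is an idempotent with image `Im A` and kernel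
`Ker A'`, and `1 - A' A` is an idempotent with image `Ker A` and kernel `Im A'`. -/
structure IsPseudoInverse (A : V →ₗ[F] W) (A' : W →ₗ[F] V) : Prop where
  left : A ∘ₗ A' ∘ₗ A = A
  right : A' ∘ₗ A ∘ₗ A' = A'

theorem IsPseudoInverse.symm {A : V →ₗ[F] W} {A' : W →ₗ[F] V} (h : IsPseudoInverse A A') :
    IsPseudoInverse A' A :=
  ⟨h.right, h.left⟩

/-- The idempotent `1 - A' A`, as a map onto its image `Ker A`. -/
def IsPseudoInverse.kerProj {A : V →ₗ[F] W} {A' : W →ₗ[F] V} (h : IsPseudoInverse A A') :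
    V →ₗ[F] LinearMap.ker A :=
  (LinearMap.id - A' ∘ₗ A).codRestrict (LinearMap.ker A) fun x => by
    have := LinearMap.congr_fun h.left x
    simp only [LinearMap.comp_apply] at this
    simp [this]

abbrev Coker (A : V →ₗ[F] W) : Type _ := W ⧸ LinearMap.range A

def HasFiniteRank (A : V →ₗ[F] W) : Prop := FiniteDimensional F (LinearMap.range A)

def IsFredholmOp (A : V →ₗ[F] W) : Prop :=
  FiniteDimensional F (LinearMap.ker A) ∧ FiniteDimensional F (Coker A)

noncomputable def opIndex (A : V →ₗ[F] W) : ℤ :=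
  (Module.finrank F (LinearMap.ker A) : ℤ) - (Module.finrank F (Coker A) : ℤ)

/-- The determinant line `det (Ker A) ⊗ det (Coker A)^*` of an operator. -/
abbrev OpDet (A : V →ₗ[F] W) : Type _ :=
  DetLine F (LinearMap.ker A) ⊗[F] Module.Dual F (DetLine F (Coker A))

/-- The map `Ker A → Coker A'`; an isomorphism when `A'` is a pseudo-inverse of `A`. It identifies
`det (Ker A)` with `det (Coker A')`. -/
abbrev kerToCoker (A : V →ₗ[F] W) (A' : W →ₗ[F] V) : LinearMap.ker A →ₗ[F] Coker A' :=
  (LinearMap.range A').mkQ ∘ₗ (LinearMap.ker A).subtype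

/-- `P` is the perturbation isomorphism from `A` to `B`, of index `≤ 0`, computed with the
pseudo-inverses `A'`, `B'` and the perturbation triple `(L, M, N)`, where `N` is already extended to
`Ker B'` by zero on a complement of `Ker M`. That is,
`P (s ⊗ (L s ∧ N t₁)^*) = det(Σ)⁻¹ • (M t₀ ⊗ (t₀ ∧ t₁)^*)` with
`Σ = (A + L P_A) (B' + M Q_B) + N Q_B`. -/
structure IsPertIsoNonpos {A B : V →ₗ[F] W} {A' B' : W →ₗ[F] V}
    (hA : IsPseudoInverse A A') (hB : IsPseudoInverse B B')
    (L : LinearMap.ker A →ₗ[F] W) (M : LinearMap.ker B' →ₗ[F] V) (N : LinearMap.ker B' →ₗ[F] W)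
    (P : OpDet A ≃ₗ[F] OpDet B) : Prop where
  index_nonpos : opIndex A ≤ 0
  injective_L : Function.Injective ((LinearMap.range A).mkQ ∘ₗ L)
  surjective_M : Function.Surjective ((LinearMap.range B').mkQ ∘ₗ M)
  bijective_N : Function.Bijective
    ((LinearMap.range A ⊔ LinearMap.range L).mkQ ∘ₗ N ∘ₗ (LinearMap.ker M).subtype)
  extension_N : ∃ K : Submodule F (LinearMap.ker B'), IsCompl (LinearMap.ker M) K ∧
    K ≤ LinearMap.ker N
  formula : ∀ (s : DetLine F (LinearMap.ker A)) (t₁ : DetLine F (LinearMap.ker M))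
    (t₀ : DetLine F (LinearMap.ker N))
    (a : DetLine F (Coker A)) (u : DetLine F (LinearMap.ker B)) (b : DetLine F (Coker B))
    (φ : Module.Dual F (DetLine F (Coker A))) (ψ : Module.Dual F (DetLine F (Coker B))),
    -- `a = L s ∧ N t₁` in `det (Coker A)`
    (a : ExteriorAlgebra F (Coker A)) =
      ExteriorAlgebra.map ((LinearMap.range A).mkQ ∘ₗ L) s *
        ExteriorAlgebra.map ((LinearMap.range A).mkQ ∘ₗ N ∘ₗ (LinearMap.ker M).subtype) t₁ →
    -- `u = M t₀` in `det (Ker B) = det (Coker B')`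
    ExteriorAlgebra.map (kerToCoker B B') u =
      ExteriorAlgebra.map ((LinearMap.range B').mkQ ∘ₗ M ∘ₗ (LinearMap.ker N).subtype) t₀ →
    -- `b = t₀ ∧ t₁` in `det (Coker B) = det (Ker B')`
    (b : ExteriorAlgebra F (Coker B)) =
      ExteriorAlgebra.map (kerToCoker B' B)
        (ExteriorAlgebra.map (LinearMap.ker N).subtype t₀ *
          ExteriorAlgebra.map (LinearMap.ker M).subtype t₁) →
    IsDualVector φ a → IsDualVector ψ b →
    P (s ⊗ₜ[F] φ) =
      (detClassDet ((A + L ∘ₗ hA.kerProj) ∘ₗ (B' + M ∘ₗ hB.symm.kerProj) +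
        N ∘ₗ hB.symm.kerProj))⁻¹ • (u ⊗ₜ[F] ψ)

/-- `P` is the perturbation isomorphism from `A` to `B`, of index `≥ 0`, computed with the
pseudo-inverses `A'`, `B'` and the perturbation triple `(L, M, N)`, where `N` is already extended to
`Ker A` by zero on a complement of `Ker L`. That is,
`P ((s₀ ∧ s₁) ⊗ (L s₁)^*) = det(Σ)⁻¹ • ((N s₀ ∧ M t) ⊗ t^*)` with
`Σ = (B' + M Q_B) (A + L P_A) + N P_A`. -/
structure IsPertIsoNonneg {A B : V →ₗ[F] W} {A' B' : W →ₗ[F] V}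
    (hA : IsPseudoInverse A A') (hB : IsPseudoInverse B B')
    (L : LinearMap.ker A →ₗ[F] W) (M : LinearMap.ker B' →ₗ[F] V) (N : LinearMap.ker A →ₗ[F] V)
    (P : OpDet A ≃ₗ[F] OpDet B) : Prop where
  index_nonneg : 0 ≤ opIndex A
  surjective_L : Function.Surjective ((LinearMap.range A).mkQ ∘ₗ L)
  injective_M : Function.Injective ((LinearMap.range B').mkQ ∘ₗ M)
  bijective_N : Function.Bijective
    ((LinearMap.range M ⊔ LinearMap.range B').mkQ ∘ₗ N ∘ₗ (LinearMap.ker L).subtype)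
  extension_N : ∃ K : Submodule F (LinearMap.ker A), IsCompl (LinearMap.ker L) K ∧
    K ≤ LinearMap.ker N
  formula : ∀ (s₀ : DetLine F (LinearMap.ker L)) (s₁ : DetLine F (LinearMap.ker N))
    (t : DetLine F (LinearMap.ker B'))
    (s : DetLine F (LinearMap.ker A)) (a : DetLine F (Coker A))
    (u : DetLine F (LinearMap.ker B)) (b : DetLine F (Coker B))
    (φ : Module.Dual F (DetLine F (Coker A))) (ψ : Module.Dual F (DetLine F (Coker B))),
    -- `s = s₀ ∧ s₁` in `det (Ker A)`
    (s : ExteriorAlgebra F (LinearMap.ker A)) =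
      ExteriorAlgebra.map (LinearMap.ker L).subtype s₀ *
        ExteriorAlgebra.map (LinearMap.ker N).subtype s₁ →
    -- `a = L s₁` in `det (Coker A)`
    (a : ExteriorAlgebra F (Coker A)) =
      ExteriorAlgebra.map ((LinearMap.range A).mkQ ∘ₗ L ∘ₗ (LinearMap.ker N).subtype) s₁ →
    -- `u = N s₀ ∧ M t` in `det (Ker B) = det (Coker B')`
    ExteriorAlgebra.map (kerToCoker B B') u =
      ExteriorAlgebra.map ((LinearMap.range B').mkQ ∘ₗ N ∘ₗ (LinearMap.ker L).subtype) s₀ *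
        ExteriorAlgebra.map ((LinearMap.range B').mkQ ∘ₗ M) t →
    -- `b = t` in `det (Coker B) = det (Ker B')`
    (b : ExteriorAlgebra F (Coker B)) = ExteriorAlgebra.map (kerToCoker B' B) t →
    IsDualVector φ a → IsDualVector ψ b →
    P (s ⊗ₜ[F] φ) =
      (detClassDet ((B' + M ∘ₗ hB.symm.kerProj) ∘ₗ (A + L ∘ₗ hA.kerProj) +
        N ∘ₗ hA.kerProj))⁻¹ • (u ⊗ₜ[F] ψ)

/-- `P : det (Ker A) ⊗ det (Coker A)^* → det (Ker B) ⊗ det (Coker B)^*` is the perturbation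
isomorphism of the finite rank perturbation `A → B` of Fredholm operators, computed with some
choice of pseudo-inverses and of a perturbation triple. -/
def IsOpPertIso (A B : V →ₗ[F] W) (P : OpDet A ≃ₗ[F] OpDet B) : Prop :=
  IsFredholmOp A ∧ IsFredholmOp B ∧ HasFiniteRank (A - B) ∧
  ∃ (A' B' : W →ₗ[F] V) (hA : IsPseudoInverse A A') (hB : IsPseudoInverse B B'),
    (∃ L M N, IsPertIsoNonpos hA hB L M N P) ∨ (∃ L M N, IsPertIsoNonneg hA hB L M N P)

end Operators

/-! ## `ℤ/2ℤ`-graded complexes -/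

section Homology

variable {F : Type*} [Field F]

/-- The homology `Ker f / Im g` at the middle term of `Z → X → Y`. -/
abbrev HomologyAt {X Y Z : Type*} [AddCommGroup X] [Module F X] [AddCommGroup Y] [Module F Y]
    [AddCommGroup Z] [Module F Z] (f : X →ₗ[F] Y) (g : Z →ₗ[F] X) : Type _ :=
  LinearMap.ker f ⧸ (LinearMap.range g).submoduleOf (LinearMap.ker f)

/-- The class in homology of a cycle. -/
def homologyMk {X Y Z : Type*} [AddCommGroup X] [Module F X] [AddCommGroup Y] [Module F Y]
    [AddCommGroup Z] [Module F Z] (f : X →ₗ[F] Y) (g : Z →ₗ[F] X) (x : X) (hx : f x = 0) :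
    HomologyAt f g :=
  Submodule.Quotient.mk ⟨x, hx⟩

/-- The map `[x] ↦ [φ x]` induced on homology by a linear map that preserves cycles and
boundaries. -/
def homologyMap {X Y Z X₁ Y₁ Z₁ : Type*} [AddCommGroup X] [Module F X] [AddCommGroup Y] [Module F Y]
    [AddCommGroup Z] [Module F Z] [AddCommGroup X₁] [Module F X₁] [AddCommGroup Y₁] [Module F Y₁]
    [AddCommGroup Z₁] [Module F Z₁]
    (f : X →ₗ[F] Y) (g : Z →ₗ[F] X) (f₁ : X₁ →ₗ[F] Y₁) (g₁ : Z₁ →ₗ[F] X₁) (φ : X →ₗ[F] X₁)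
    (hcyc : ∀ x, f x = 0 → f₁ (φ x) = 0) (hbd : ∀ z, φ (g z) ∈ LinearMap.range g₁) :
    HomologyAt f g →ₗ[F] HomologyAt f₁ g₁ :=
  Submodule.mapQ _ _ (φ.restrict (p := LinearMap.ker f) (q := LinearMap.ker f₁) hcyc) (by
    rintro ⟨_, hx⟩ ⟨z, rfl⟩
    exact hbd z)

/-- A `ℤ/2ℤ`-graded complex `X₊ → X₋ → X₊`. -/
structure Z2Complex (F : Type*) [Field F] (Xp Xm : Type*) [AddCommGroup Xp] [Module F Xp]
    [AddCommGroup Xm] [Module F Xm] where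
  dp : Xp →ₗ[F] Xm
  dm : Xm →ₗ[F] Xp
  dm_dp : dm ∘ₗ dp = 0
  dp_dm : dp ∘ₗ dm = 0

end Homology

namespace Z2Complex

variable {F : Type*} [Field F] {Xp Xm : Type*} [AddCommGroup Xp] [Module F Xp]
    [AddCommGroup Xm] [Module F Xm]

/-- `H₊(D) = Ker d₊ / Im d₋`. -/
abbrev HPlus (D : Z2Complex F Xp Xm) : Type _ := HomologyAt D.dp D.dm

/-- `H₋(D) = Ker d₋ / Im d₊`. -/
abbrev HMinus (D : Z2Complex F Xp Xm) : Type _ := HomologyAt D.dm D.dp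

def IsFredholm (D : Z2Complex F Xp Xm) : Prop :=
  FiniteDimensional F D.HPlus ∧ FiniteDimensional F D.HMinus

noncomputable def index (D : Z2Complex F Xp Xm) : ℤ :=
  (Module.finrank F D.HPlus : ℤ) - (Module.finrank F D.HMinus : ℤ)

/-- The determinant `|D| = det H₊(D) ⊗ det H₋(D)^*`. -/
abbrev Determinant (D : Z2Complex F Xp Xm) : Type _ :=
  DetLine F D.HPlus ⊗[F] Module.Dual F (DetLine F D.HMinus)

/-- `D' : X₋ → X₊ → X₋` is a pseudo-inverse of the Fredholm complex `D : X₊ → X₋ → X₊`; here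
`D'.dp : X₋ → X₊` is the pseudo-inverse of `d₊` and `D'.dm : X₊ → X₋` the one of `d₋`. -/
structure IsPinv (D : Z2Complex F Xp Xm) (D' : Z2Complex F Xm Xp) : Prop where
  plus : IsPseudoInverse D.dp D'.dp
  minus : IsPseudoInverse D.dm D'.dm
  fredholm : D'.IsFredholm

/-- The operator `σ₊ = d₊ + d₋^† : X₊ → X₋`. -/
abbrev sigmaPlus (D : Z2Complex F Xp Xm) (D' : Z2Complex F Xm Xp) : Xp →ₗ[F] Xm := D.dp + D'.dm

theorem ker_sigmaPlus_iff {D : Z2Complex F Xp Xm} {D' : Z2Complex F Xm Xp} (h : D.IsPinv D')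
    (x : Xp) : D.sigmaPlus D' x = 0 ↔ D.dp x = 0 ∧ D'.dm x = 0 := by
  constructor
  · intro hx
    have hx' : D.dp x + D'.dm x = 0 := hx
    have h0 : D.dm (D.dp x) = 0 := LinearMap.congr_fun D.dm_dp x
    have h1 : D.dm (D'.dm x) = 0 := by
      have := congrArg D.dm hx'
      simpa [h0] using this
    have h2 : D'.dm (D.dm (D'.dm x)) = D'.dm x := LinearMap.congr_fun h.minus.right x
    have h3 : D'.dm x = 0 := by rw [← h2, h1, map_zero]
    exact ⟨by simpa [h3] using hx', h3⟩
  · rintro ⟨h1, h2⟩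
    simp [h1, h2]

/-- The canonical isomorphism `Ker σ₊ ≅ H₊(D)`, `x ↦ [x]`. -/
noncomputable def kerSigmaEquiv {D : Z2Complex F Xp Xm} {D' : Z2Complex F Xm Xp}
    (h : D.IsPinv D') : LinearMap.ker (D.sigmaPlus D') ≃ₗ[F] D.HPlus :=
  LinearEquiv.ofBijective
    (((LinearMap.range D.dm).submoduleOf (LinearMap.ker D.dp)).mkQ ∘ₗ
      Submodule.inclusion (fun x hx => ((ker_sigmaPlus_iff h x).1 hx).1)) (by
    constructor
    · rw [← LinearMap.ker_eq_bot, LinearMap.ker_eq_bot']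
      rintro ⟨x, hx⟩ h0
      obtain ⟨y, hy⟩ := (Submodule.Quotient.mk_eq_zero _).1 h0
      have hy' : D.dm y = x := hy
      have h2 : D.dm (D'.dm (D.dm y)) = D.dm y := LinearMap.congr_fun h.minus.left y
      have h3 := ((ker_sigmaPlus_iff h x).1 hx).2
      ext
      rw [hy', h3, map_zero] at h2
      exact h2.symm
    · intro q
      obtain ⟨⟨x, hx⟩, rfl⟩ := Submodule.Quotient.mk_surjective _ q
      have hx' : D.dp x = 0 := hx
      have h1 : D.dp (D.dm (D'.dm x)) = 0 := LinearMap.congr_fun D.dp_dm _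
      have h2 : D'.dm (D.dm (D'.dm x)) = D'.dm x := LinearMap.congr_fun h.minus.right x
      refine ⟨⟨x - D.dm (D'.dm x), (ker_sigmaPlus_iff h _).2 ⟨?_, ?_⟩⟩, ?_⟩
      · simp [h1, hx']
      · simp [h2]
      · refine (Submodule.Quotient.eq _).2 ?_
        refine ⟨-D'.dm x, ?_⟩
        change D.dm (-D'.dm x) = (x - D.dm (D'.dm x)) - x
        rw [map_neg]
        abel)

/-- The canonical isomorphism `H₋(D) ≅ Coker σ₊`, `[y] ↦ [y]`. -/
noncomputable def cokerSigmaEquiv {D : Z2Complex F Xp Xm} {D' : Z2Complex F Xm Xp}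
    (h : D.IsPinv D') : D.HMinus ≃ₗ[F] Coker (D.sigmaPlus D') :=
  LinearEquiv.ofBijective
    (Submodule.mapQ _ (LinearMap.range (D.sigmaPlus D')) (LinearMap.ker D.dm).subtype (by
      rintro ⟨_, hx⟩ ⟨z, rfl⟩
      refine ⟨D'.dp (D.dp z), ?_⟩
      have h1 : D.dp (D'.dp (D.dp z)) = D.dp z := LinearMap.congr_fun h.plus.left z
      have h2 : D'.dm (D'.dp (D.dp z)) = 0 := LinearMap.congr_fun D'.dm_dp _
      simp [h1, h2])) (by
    constructor
    · rw [← LinearMap.ker_eq_bot, LinearMap.ker_eq_bot']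
      intro q
      obtain ⟨⟨y, hy⟩, rfl⟩ := Submodule.Quotient.mk_surjective _ q
      intro h0
      obtain ⟨x, hx⟩ := (Submodule.Quotient.mk_eq_zero _).1 h0
      have hx' : D.dp x + D'.dm x = y := hx
      have hy' : D.dm y = 0 := hy
      have h1 : D.dm (D.dp x) = 0 := LinearMap.congr_fun D.dm_dp x
      have h2 : D.dm (D'.dm x) = 0 := by
        rw [← hx'] at hy'
        simpa [h1] using hy'
      have h3 : D'.dm (D.dm (D'.dm x)) = D'.dm x := LinearMap.congr_fun h.minus.right x
      have h4 : D'.dm x = 0 := by rw [← h3, h2, map_zero]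
      refine (Submodule.Quotient.mk_eq_zero _).2 ⟨x, ?_⟩
      simpa [h4] using hx'
    · intro q
      obtain ⟨y, rfl⟩ := Submodule.Quotient.mk_surjective _ q
      have h1 : D.dm (D'.dm (D.dm y)) = D.dm y := LinearMap.congr_fun h.minus.left y
      have h2 : D.dp (D.dm y) = 0 := LinearMap.congr_fun D.dp_dm y
      refine ⟨Submodule.Quotient.mk ⟨y - D'.dm (D.dm y), ?_⟩, ?_⟩
      · simp [h1]
      · refine (Submodule.Quotient.eq _).2 ⟨-D.dm y, ?_⟩
        simp [h2])

/-- The canonical map `det (Ker σ₊) ⊗ det (Coker σ₊)^* → |D|` of determinant lines. -/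
noncomputable def opDetToDeterminant {D : Z2Complex F Xp Xm} {D' : Z2Complex F Xm Xp}
    (h : D.IsPinv D') : OpDet (D.sigmaPlus D') →ₗ[F] D.Determinant :=
  TensorProduct.map (detMap (kerSigmaEquiv h)) (detMap (cokerSigmaEquiv h)).dualMap

/-- `P : |D| → |E|` is the perturbation isomorphism `P(E, D)` of the finite rank perturbation
`D → E` of Fredholm complexes, computed with some choice of pseudo-inverses `D'` and `E'` (finite
rank perturbations of each other) and of the data defining the perturbation isomorphism of the
operators `σ₊ = d₊ + d₋^† → τ₊ = δ₊ + δ₋^†`. -/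
def IsPertIso (D E : Z2Complex F Xp Xm) (P : D.Determinant ≃ₗ[F] E.Determinant) : Prop :=
  D.IsFredholm ∧ E.IsFredholm ∧ HasFiniteRank (D.dp - E.dp) ∧ HasFiniteRank (D.dm - E.dm) ∧
  ∃ (D' E' : Z2Complex F Xm Xp) (hD : D.IsPinv D') (hE : E.IsPinv E')
    (P₀ : OpDet (D.sigmaPlus D') ≃ₗ[F] OpDet (E.sigmaPlus E')),
    HasFiniteRank (D'.dp - E'.dp) ∧ HasFiniteRank (D'.dm - E'.dm) ∧
    IsOpPertIso (D.sigmaPlus D') (E.sigmaPlus E') P₀ ∧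
    ∀ z, P (opDetToDeterminant hD z) = opDetToDeterminant hE (P₀ z)

/-- The direct sum `D ⊕ C` with the complex `C = (F^{n₊} ⊕ F^{n₋}, 0)`. -/
def pad (D : Z2Complex F Xp Xm) (np nm : ℕ) :
    Z2Complex F (Xp × (Fin np → F)) (Xm × (Fin nm → F)) where
  dp := D.dp.prodMap 0
  dm := D.dm.prodMap 0
  dm_dp := by
    rw [LinearMap.prodMap_comp, D.dm_dp]
    simp
  dp_dm := by
    rw [LinearMap.prodMap_comp, D.dp_dm]
    simp

/-- Linear maps `F₋ : F^{n₋} → X₊`, `F₊ : F^{n₊} → X₋`, `N₊ : F^{n₊} → F^{n₋}` with `d₊ F₋ = 0`,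
`d₋ F₊ = 0`, `F₋ N₊ = 0` and `F₊ (Ker N₊) = Im F₊`. -/
structure PertMaps (D : Z2Complex F Xp Xm) (np nm : ℕ) where
  Fm : (Fin nm → F) →ₗ[F] Xp
  Fp : (Fin np → F) →ₗ[F] Xm
  Np : (Fin np → F) →ₗ[F] (Fin nm → F)
  dp_Fm : D.dp ∘ₗ Fm = 0
  dm_Fp : D.dm ∘ₗ Fp = 0
  Fm_Np : Fm ∘ₗ Np = 0
  map_ker_Np : (LinearMap.ker Np).map Fp = LinearMap.range Fp

namespace PertMaps

variable {D : Z2Complex F Xp Xm} {np nm : ℕ}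

/-- The perturbed complex, with differentials
`(ξ, λ) ↦ (d₊ ξ + F₊ λ, N₊ λ)` and `(η, μ) ↦ (d₋ η + F₋ μ, 0)`. -/
def hat (S : D.PertMaps np nm) : Z2Complex F (Xp × (Fin np → F)) (Xm × (Fin nm → F)) where
  dp := (D.dp.coprod S.Fp).prod (S.Np ∘ₗ LinearMap.snd F Xp (Fin np → F))
  dm := (D.dm.coprod S.Fm).prod 0
  dm_dp := by
    refine LinearMap.ext fun x => ?_
    have h1 : D.dm (D.dp x.1) = 0 := LinearMap.congr_fun D.dm_dp x.1
    have h2 : D.dm (S.Fp x.2) = 0 := LinearMap.congr_fun S.dm_Fp x.2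
    have h3 : S.Fm (S.Np x.2) = 0 := LinearMap.congr_fun S.Fm_Np x.2
    simp [h1, h2, h3]
  dp_dm := by
    refine LinearMap.ext fun x => ?_
    have h1 : D.dp (D.dm x.1) = 0 := LinearMap.congr_fun D.dp_dm x.1
    have h2 : D.dp (S.Fm x.2) = 0 := LinearMap.congr_fun S.dp_Fm x.2
    simp [h1, h2]

/-- `W₊ = {λ ∈ Ker N₊ | F₊ λ ∈ Im d₊}`. -/
def Wp (S : D.PertMaps np nm) : Submodule F (Fin np → F) :=
  LinearMap.ker S.Np ⊓ (LinearMap.range D.dp).comap S.Fp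

/-- `W₋ = {λ ∈ F^{n₋} | F₋ λ ∈ Im d₋}`. -/
def Wm (S : D.PertMaps np nm) : Submodule F (Fin nm → F) :=
  (LinearMap.range D.dm).comap S.Fm

/-- The class `[F₋ v₋, λ]` in `H₊(D ⊕ C)`. -/
def classPlus (S : D.PertMaps np nm) (v : Fin nm → F) (l : Fin np → F) : (D.pad np nm).HPlus :=
  homologyMk (D.pad np nm).dp (D.pad np nm).dm (S.Fm v, l) (by
    have h1 : D.dp (S.Fm v) = 0 := LinearMap.congr_fun S.dp_Fm v
    simp [pad, h1])

/-- The class `[F₊ v₊, μ]` in `H₋(D ⊕ C)`. -/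
def classMinus (S : D.PertMaps np nm) (v : Fin np → F) (m : Fin nm → F) : (D.pad np nm).HMinus :=
  homologyMk (D.pad np nm).dm (D.pad np nm).dp (S.Fp v, m) (by
    have h1 : D.dm (S.Fp v) = 0 := LinearMap.congr_fun S.dm_Fp v
    simp [pad, h1])

/-- Subspaces `Q₊ ⊆ Ker d₊`, `Q₋ ⊆ Ker d₋` that map isomorphically to
`Ker d₊ / (Im d₋ + Im F₋)` and `Ker d₋ / (Im d₊ + Im F₊)`, and idempotents `E₊`, `E₋`, `Ω₋` with
images `Q₊`, `Q₋`, `Im N₊` such that `E₊` and `E₋` vanish on `Im d₋ + Im F₋` and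
`Im d₊ + Im F₊`. -/
structure IsProjData (S : D.PertMaps np nm) (Qp : Submodule F Xp) (Qm : Submodule F Xm)
    (Ep : Xp →ₗ[F] Xp) (Em : Xm →ₗ[F] Xm) (Om : (Fin nm → F) →ₗ[F] (Fin nm → F)) : Prop where
  Qp_le : Qp ≤ LinearMap.ker D.dp
  Qm_le : Qm ≤ LinearMap.ker D.dm
  Qp_bij : Function.Bijective
    (((LinearMap.range D.dm ⊔ LinearMap.range S.Fm).submoduleOf (LinearMap.ker D.dp)).mkQ ∘ₗ
      Submodule.inclusion Qp_le)
  Qm_bij : Function.Bijective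
    (((LinearMap.range D.dp ⊔ LinearMap.range S.Fp).submoduleOf (LinearMap.ker D.dm)).mkQ ∘ₗ
      Submodule.inclusion Qm_le)
  Ep_idem : Ep ∘ₗ Ep = Ep
  Em_idem : Em ∘ₗ Em = Em
  Om_idem : Om ∘ₗ Om = Om
  Ep_zero : LinearMap.range D.dm ⊔ LinearMap.range S.Fm ≤ LinearMap.ker Ep
  Em_zero : LinearMap.range D.dp ⊔ LinearMap.range S.Fp ≤ LinearMap.ker Em
  range_Ep : LinearMap.range Ep = Qp
  range_Em : LinearMap.range Em = Qm
  range_Om : LinearMap.range Om = LinearMap.range S.Np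

variable {S : D.PertMaps np nm} {Qp : Submodule F Xp} {Qm : Submodule F Xm}
    {Ep : Xp →ₗ[F] Xp} {Em : Xm →ₗ[F] Xm} {Om : (Fin nm → F) →ₗ[F] (Fin nm → F)}

/-- The map `φ₊` from the homology of the perturbed complex to the homology of `D ⊕ C` induced by
`(ξ, λ) ↦ (E₊ ξ, λ)`. -/
def phiPlus (h : S.IsProjData Qp Qm Ep Em Om) : S.hat.HPlus →ₗ[F] (D.pad np nm).HPlus :=
  homologyMap S.hat.dp S.hat.dm (D.pad np nm).dp (D.pad np nm).dm (Ep.prodMap LinearMap.id)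
    (by
      intro x _
      have h1 : D.dp (Ep x.1) = 0 := h.Qp_le (h.range_Ep ▸ ⟨x.1, rfl⟩)
      simp [pad, h1])
    (by
      intro z
      have h1 : Ep (D.dm z.1 + S.Fm z.2) = 0 :=
        h.Ep_zero (Submodule.add_mem_sup ⟨z.1, rfl⟩ ⟨z.2, rfl⟩)
      refine ⟨0, ?_⟩
      rw [map_zero]
      refine (Prod.ext h1 ?_).symm
      rfl)

/-- The map `φ₋` from the homology of the perturbed complex to the homology of `D ⊕ C` induced by
`(η, μ) ↦ (E₋ η, (1 - Ω₋) μ)`. -/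
def phiMinus (h : S.IsProjData Qp Qm Ep Em Om) : S.hat.HMinus →ₗ[F] (D.pad np nm).HMinus :=
  homologyMap S.hat.dm S.hat.dp (D.pad np nm).dm (D.pad np nm).dp
    (Em.prodMap (LinearMap.id - Om))
    (by
      intro x _
      have h1 : D.dm (Em x.1) = 0 := h.Qm_le (h.range_Em ▸ ⟨x.1, rfl⟩)
      simp [pad, h1])
    (by
      intro z
      have h1 : Em (D.dp z.1 + S.Fp z.2) = 0 :=
        h.Em_zero (Submodule.add_mem_sup ⟨z.1, rfl⟩ ⟨z.2, rfl⟩)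
      obtain ⟨y, hy⟩ : S.Np z.2 ∈ LinearMap.range Om := h.range_Om ▸ ⟨z.2, rfl⟩
      have h2 : Om (S.Np z.2) = S.Np z.2 := by
        rw [← hy]
        exact LinearMap.congr_fun h.Om_idem y
      refine ⟨0, ?_⟩
      rw [map_zero]
      refine (Prod.ext h1 ?_).symm
      change S.Np z.2 - Om (S.Np z.2) = 0
      rw [h2, sub_self])

end PertMaps

end Z2Complex

/-! An index zero operator `A` has invertible extensions: isomorphisms `S` with `S = A + S p`, where
`p` is a projection onto `Ker A`. In index zero both forms of the operator perturbation isomorphism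
become `s ⊗ (S s)^* ↦ det(R⁻¹ S)⁻¹ • (u ⊗ (R u)^*)`, with `S` extending `A` and `R` extending `B`
(`IsOpPertIso.exists_isDeterminantComparison`). Replacing `S` or `R` by another extension rescales
the determinant and the dual vectors by compensating factors, so this formula is independent of the
extensions (`IsDeterminantComparison.change`).

For a complex and an isomorphism `l : H₊ → H₋`, call `S : X₊ → X₋` adapted if `d₋ S d₋ = d₋`, `d₊
S⁻¹ d₊ = d₊`, and `S` induces `l` on those cycles that it sends to cycles. Any pseudo-inverse
complex yields an adapted `S` which is an invertible extension of `d₊ + d₋^†`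
(`IsPinv.exists_isAdapted`). Two isomorphisms `S`, `T` adapted to the same complex and the same `l`
satisfy `(1 + n') T = S (1 + n)` with `n`, `n'` of cube zero. Unipotent operators whose difference
has finite rank have relative determinant one, so `det(R⁻¹ S)` is the same for all adapted pairs
whose members differ by finite rank (`IsAdapted.detClassDet_eq`). Hence a single adapted pair
computes the perturbation isomorphism, whatever choices define it (`IsPertIso.apply_tmul`).

It remains to exhibit a pair with determinant one (`exists_adapted_pair`). Conditions 1 and 2 split
the padded complex with harmonic spaces `(F₋ V₋ + Q₊) ⊕ F^{n₊}` and `(F₊ V₊ + Q₋) ⊕ F^{n₋}`; the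
resulting adapted `T` is explicit where condition 3 describes `L`. Composing `T` with a shear on
each side, which solve `d₊ x = F₊ w` and `d₋ y = F₋ w` for `w` in `W₊` and `W₋`, gives an
isomorphism `R` adapted to the perturbed complex; condition 4 says exactly that `R` induces `M⁻¹`.
Shears have determinant one, so the constant is one.

The same pair proves existence: `S⁻¹ d₊ S⁻¹` and `S d₋ S` form a pseudo-inverse complex, and
likewise for `R` (`exists_isPertIso`). -/

/-! ### Finite rank maps. -/

section FiniteRank

variable {F : Type*} [Field F] {U V W : Type*} [AddCommGroup U] [Module F U] [AddCommGroup V]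
  [Module F V] [AddCommGroup W] [Module F W]

theorem HasFiniteRank.comp_left {f : V →ₗ[F] W} (h : HasFiniteRank f) (g : W →ₗ[F] U) :
    HasFiniteRank (g ∘ₗ f) := by
  unfold HasFiniteRank at *
  rw [LinearMap.range_comp]
  infer_instance

theorem HasFiniteRank.comp_right {f : V →ₗ[F] W} (h : HasFiniteRank f) (g : U →ₗ[F] V) :
    HasFiniteRank (f ∘ₗ g) := by
  unfold HasFiniteRank at *
  exact Submodule.finiteDimensional_of_le (LinearMap.range_comp_le_range g f)

theorem HasFiniteRank.add {f g : V →ₗ[F] W} (hf : HasFiniteRank f) (hg : HasFiniteRank g) :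
    HasFiniteRank (f + g) := by
  unfold HasFiniteRank at *
  exact Submodule.finiteDimensional_of_le (LinearMap.range_add_le f g)

theorem HasFiniteRank.neg {f : V →ₗ[F] W} (hf : HasFiniteRank f) : HasFiniteRank (-f) := by
  unfold HasFiniteRank at *
  rwa [LinearMap.range_neg]

theorem HasFiniteRank.sub {f g : V →ₗ[F] W} (hf : HasFiniteRank f) (hg : HasFiniteRank g) :
    HasFiniteRank (f - g) := by
  rw [sub_eq_add_neg]
  exact hf.add hg.neg

theorem HasFiniteRank.of_domain [FiniteDimensional F V] (f : V →ₗ[F] W) : HasFiniteRank f := by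
  unfold HasFiniteRank
  infer_instance

theorem HasFiniteRank.comp_sub_comp {f f' : V →ₗ[F] W} {g g' : W →ₗ[F] U}
    (hf : HasFiniteRank (f - f')) (hg : HasFiniteRank (g - g')) :
    HasFiniteRank (g ∘ₗ f - g' ∘ₗ f') := by
  have h : g ∘ₗ f - g' ∘ₗ f' = g ∘ₗ (f - f') + (g - g') ∘ₗ f' := by
    rw [LinearMap.comp_sub, LinearMap.sub_comp]
    abel
  rw [h]
  exact (hf.comp_left g).add (hg.comp_right f')

end FiniteRank

/-! ### Determinants of finite rank perturbations of the identity. -/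

section DetClass

variable {F : Type*} [Field F] {V W : Type*} [AddCommGroup V] [Module F V]
  [AddCommGroup W] [Module F W]

/-- Both factors, and hence the product, preserve the sum of the images of `1 - X` and `1 - Y`;
there multiplicativity is the finite dimensional one. -/
theorem detClassDet_comp {X Y : V →ₗ[F] V} (hX : HasFiniteRank (LinearMap.id - X))
    (hY : HasFiniteRank (LinearMap.id - Y)) :
    detClassDet (X ∘ₗ Y) = detClassDet X * detClassDet Y := by
  unfold HasFiniteRank at hX hY
  set E := LinearMap.range (LinearMap.id - X) ⊔ LinearMap.range (LinearMap.id - Y) with hE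
  have h1 : LinearMap.range (LinearMap.id - X) ≤ E := le_sup_left
  have h2 : LinearMap.range (LinearMap.id - Y) ≤ E := le_sup_right
  have h3 : LinearMap.range (LinearMap.id - X ∘ₗ Y) ≤ E := by
    rintro _ ⟨v, rfl⟩
    have h : (LinearMap.id - X ∘ₗ Y : V →ₗ[F] V) v =
        (LinearMap.id - X : V →ₗ[F] V) (Y v) + (LinearMap.id - Y : V →ₗ[F] V) v := by
      simp
    rw [h]
    exact E.add_mem (h1 ⟨_, rfl⟩) (h2 ⟨_, rfl⟩)
  rw [detClassDet_eq X E h1, detClassDet_eq Y E h2, detClassDet_eq _ E h3, ← LinearMap.det_comp]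
  rfl

theorem detClassDet_conj (e : V ≃ₗ[F] W) (X : V →ₗ[F] V) :
    detClassDet ((e : V →ₗ[F] W) ∘ₗ X ∘ₗ (e.symm : W →ₗ[F] V)) = detClassDet X := by
  have h : (LinearMap.range (LinearMap.id - X)).map (e : V →ₗ[F] W) =
      LinearMap.range (LinearMap.id - (e : V →ₗ[F] W) ∘ₗ X ∘ₗ (e.symm : W →ₗ[F] V)) := by
    ext w
    constructor
    · rintro ⟨_, ⟨v, rfl⟩, rfl⟩
      exact ⟨e v, by simp⟩
    · rintro ⟨w, rfl⟩
      exact ⟨_, ⟨e.symm w, rfl⟩, by simp⟩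
  unfold detClassDet
  let e' := e.ofSubmodules _ _ h
  rw [← LinearMap.det_conj _ e']
  congr 1

theorem det_id_add_comp_comm [FiniteDimensional F V] [FiniteDimensional F W]
    (f : V →ₗ[F] W) (g : W →ₗ[F] V) :
    LinearMap.det (LinearMap.id + f ∘ₗ g) = LinearMap.det (LinearMap.id + g ∘ₗ f) := by
  classical
  let b := Module.finBasis F V
  let c := Module.finBasis F W
  rw [← LinearMap.det_toMatrix c, ← LinearMap.det_toMatrix b, map_add, map_add,
    LinearMap.toMatrix_comp c b c, LinearMap.toMatrix_comp b c b, LinearMap.toMatrix_id,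
    LinearMap.toMatrix_id, Matrix.det_one_add_mul_comm]

/-- The determinant of `1 + Y P` for `P : V → K`, `Y : K → V` with `K` finite dimensional. -/
theorem detClassDet_id_add_comp {K : Type*} [AddCommGroup K] [Module F K] [FiniteDimensional F K]
    (Y : K →ₗ[F] V) (P : V →ₗ[F] K) :
    detClassDet (LinearMap.id + Y ∘ₗ P) = LinearMap.det (LinearMap.id + P ∘ₗ Y) := by
  have h : LinearMap.range (LinearMap.id - (LinearMap.id + Y ∘ₗ P)) ≤ LinearMap.range Y := by
    rintro _ ⟨v, rfl⟩
    exact ⟨-P v, by simp⟩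
  rw [detClassDet_eq _ _ h]
  have h1 : LinearMap.restrict (LinearMap.id + Y ∘ₗ P) (apply_mem_of_range_one_sub_le h) =
      LinearMap.id + Y.rangeRestrict ∘ₗ (P ∘ₗ (LinearMap.range Y).subtype) := by
    ext x
    simp
  rw [h1, det_id_add_comp_comm]
  rfl

theorem hasFiniteRank_id_sub_id_add {X : V →ₗ[F] V} (h : HasFiniteRank X) :
    HasFiniteRank (LinearMap.id - (LinearMap.id + X)) := by
  have h1 : LinearMap.id - (LinearMap.id + X) = -X := by abel
  rw [h1]
  exact h.neg

/-- The characteristic polynomial of `-n` is a power of the variable; its value at `1` is the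
determinant. -/
theorem det_id_add_of_isNilpotent [FiniteDimensional F V] {n : V →ₗ[F] V} (hn : IsNilpotent n) :
    LinearMap.det (LinearMap.id + n) = 1 := by
  have h := LinearMap.eval_charpoly (-n) (1 : F)
  rw [hn.neg.charpoly_eq_X_pow_finrank] at h
  simpa [Module.End.one_eq_id] using h.symm

/-- If `n` and `m` are nilpotent and `m - n` has finite rank then
`(1 + n)⁻¹ (1 + m)` has determinant one. -/
theorem detClassDet_unipotent_quotient {n m : V →ₗ[F] V} (hn : IsNilpotent n) (hm : IsNilpotent m)
    (hnm : HasFiniteRank (m - n)) {e : V ≃ₗ[F] V} (he : ∀ x, e x = x + n x) :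
    detClassDet ((e.symm : V →ₗ[F] V) ∘ₗ (LinearMap.id + m)) = 1 := by
  obtain ⟨N, hN⟩ := hn
  obtain ⟨N', hN'⟩ := hm
  unfold HasFiniteRank at hnm
  set E : Submodule F V := ⨆ i : Fin N, (LinearMap.range (m - n)).map (n ^ (i : ℕ)) with hE
  have hEfin : FiniteDimensional F E := by
    rw [hE]
    infer_instance
  have hn' : ∀ x ∈ E, n x ∈ E := by
    intro x hx
    have : E.map n ≤ E := by
      rw [hE, Submodule.map_iSup]
      refine iSup_le fun i => ?_
      rintro _ ⟨_, ⟨y, hy, rfl⟩, rfl⟩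
      by_cases hi : (i : ℕ) + 1 < N
      · refine Submodule.mem_iSup_of_mem ⟨i + 1, hi⟩ ⟨y, hy, ?_⟩
        simp [pow_succ']
      · have h1 : (i : ℕ) + 1 = N := by omega
        have h2 : n ((n ^ (i : ℕ)) y) = (n ^ ((i : ℕ) + 1)) y := by simp [pow_succ']
        rw [h2, h1, hN]
        simp
    exact this ⟨x, hx, rfl⟩
  have hf : LinearMap.range (m - n) ≤ E := by
    by_cases h0 : 0 < N
    · refine le_trans ?_ (le_iSup _ (⟨0, h0⟩ : Fin N))
      simp [Module.End.one_eq_id]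
    · have h1 : N = 0 := by omega
      rintro x -
      rw [h1, pow_zero] at hN
      have h2 : x = 0 := by simpa using LinearMap.congr_fun hN x
      rw [h2]
      exact E.zero_mem
  have hm' : ∀ x ∈ E, m x ∈ E := by
    intro x hx
    have h : m x = n x + (m - n) x := by simp
    rw [h]
    exact E.add_mem (hn' x hx) (hf ⟨x, rfl⟩)
  have heE : ∀ x ∈ E, (e : V →ₗ[F] V) x ∈ E := fun x hx => by
    rw [LinearEquiv.coe_coe, he]
    exact E.add_mem hx (hn' x hx)
  -- An injective endomorphism of the finite dimensional `E` is onto, so `E` is also stable under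
  -- the inverse.
  have hsymm : ∀ x ∈ E, (e.symm : V →ₗ[F] V) x ∈ E := by
    have hinj : Function.Injective ((e : V →ₗ[F] V).restrict heE) := by
      intro x y hxy
      exact Subtype.ext (e.injective (congrArg Subtype.val hxy))
    intro x hx
    obtain ⟨y, hy⟩ := LinearMap.surjective_of_injective hinj ⟨x, hx⟩
    have hy' : e y = x := congrArg Subtype.val hy
    rw [← hy']
    simp
  have hr : LinearMap.range (LinearMap.id - (e.symm : V →ₗ[F] V) ∘ₗ (LinearMap.id + m)) ≤ E := by
    rintro _ ⟨x, rfl⟩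
    have h : (LinearMap.id - (e.symm : V →ₗ[F] V) ∘ₗ (LinearMap.id + m) : V →ₗ[F] V) x =
        (e.symm : V →ₗ[F] V) (-(m - n) x) := by
      apply e.injective
      simp only [LinearMap.sub_apply, LinearMap.id_apply, LinearMap.comp_apply,
        LinearMap.add_apply, LinearEquiv.coe_coe, map_sub, LinearEquiv.apply_symm_apply, he x]
      abel
    rw [h]
    exact hsymm _ (E.neg_mem (hf ⟨x, rfl⟩))
  have hnil : ∀ {k : V →ₗ[F] V} (hk : ∀ x ∈ E, k x ∈ E) {j : ℕ}, k ^ j = 0 →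
      IsNilpotent (k.restrict hk) := by
    intro k hk j hj
    refine ⟨j, ?_⟩
    rw [Module.End.pow_restrict]
    ext x
    simp [hj]
  rw [detClassDet_eq _ E hr]
  have h1 : ((e : V →ₗ[F] V).restrict heE) ∘ₗ
      (((e.symm : V →ₗ[F] V) ∘ₗ (LinearMap.id + m)).restrict (apply_mem_of_range_one_sub_le hr)) =
      LinearMap.id + m.restrict hm' := by
    ext x
    simp
  have h2 : (e : V →ₗ[F] V).restrict heE = LinearMap.id + n.restrict hn' := by
    ext x
    simp [he]
  have h3 := congrArg LinearMap.det h1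
  rw [LinearMap.det_comp, h2, det_id_add_of_isNilpotent (hnil hn' hN),
    det_id_add_of_isNilpotent (hnil hm' hN'), one_mul] at h3
  exact h3

theorem exists_equiv_of_isNilpotent {n : V →ₗ[F] V} (hn : IsNilpotent n) :
    ∃ e : V ≃ₗ[F] V, ∀ x, e x = x + n x := by
  have h : IsUnit (1 + n) := hn.isUnit_one_add
  obtain ⟨u, hu⟩ := h
  refine ⟨LinearMap.GeneralLinearGroup.generalLinearEquiv F V u, fun x => ?_⟩
  change (u : V →ₗ[F] V) x = _
  rw [hu]
  simp

end DetClass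

/-! ### Determinant lines and dual vectors. -/

section Lines

variable {F : Type*} [Field F] {V W : Type*} [AddCommGroup V] [Module F V]
  [AddCommGroup W] [Module F W]

theorem exteriorAlgebra_map_map {U : Type*} [AddCommGroup U] [Module F U] (f : V →ₗ[F] W)
    (g : W →ₗ[F] U) (x : ExteriorAlgebra F V) :
    ExteriorAlgebra.map g (ExteriorAlgebra.map f x) = ExteriorAlgebra.map (g ∘ₗ f) x := by
  rw [← ExteriorAlgebra.map_comp_map]
  rfl

theorem exteriorAlgebra_map_mem_detLine (f : V →ₗ[F] W)
    (h : Module.finrank F V = Module.finrank F W) {x : ExteriorAlgebra F V}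
    (hx : x ∈ DetLine F V) : ExteriorAlgebra.map f x ∈ DetLine F W := by
  have h : (DetLine F V).map (ExteriorAlgebra.map f).toLinearMap ≤ DetLine F W := by
    unfold DetLine
    rw [h, Submodule.map_pow]
    refine pow_le_pow_left₀ bot_le ?_ _
    rintro _ ⟨_, ⟨v, rfl⟩, rfl⟩
    exact ⟨f v, by simp⟩
  exact h ⟨x, hx, rfl⟩

theorem coe_detMap (e : V ≃ₗ[F] W) (x : DetLine F V) :
    (detMap e x : ExteriorAlgebra F W) = ExteriorAlgebra.map (e : V →ₗ[F] W) x := rfl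

theorem finrank_detLine [FiniteDimensional F V] : Module.finrank F (DetLine F V) = 1 := by
  rw [exteriorPower.finrank_eq, Nat.choose_self]

theorem exteriorAlgebra_map_eq_det_smul [FiniteDimensional F V] (c : V →ₗ[F] V)
    {x : ExteriorAlgebra F V} (hx : x ∈ DetLine F V) :
    ExteriorAlgebra.map c x = LinearMap.det c • x := by
  classical
  let b := Module.finBasis F V
  -- An alternating map in `dim V` variables is determined by its value on one basis, hence is a
  -- multiple of `b.det`.
  have key : ∀ f : V [⋀^Fin (Module.finrank F V)]→ₗ[F] ExteriorAlgebra F V, ∀ v,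
      f v = b.det v • f b := by
    intro f v
    have h : f = (LinearMap.toSpanSingleton F _ (f b)).compAlternatingMap b.det := by
      refine Module.Basis.ext_alternating b fun i hi => ?_
      let σ : Equiv.Perm _ := Equiv.ofBijective i (Finite.injective_iff_bijective.1 hi)
      change f (b ∘ σ) = (LinearMap.toSpanSingleton F _ (f b)) (b.det (b ∘ σ))
      simp [AlternatingMap.map_perm, Module.Basis.det_self]
    conv_lhs => rw [h]
    simp
  have h1 : ∀ v : Fin (Module.finrank F V) → V,
      ExteriorAlgebra.map c (ExteriorAlgebra.ιMulti F _ v) =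
        LinearMap.det c • ExteriorAlgebra.ιMulti F _ v := by
    intro v
    rw [ExteriorAlgebra.map_apply_ιMulti, key _ (c ∘ v), key _ v, Module.Basis.det_comp, mul_smul]
  unfold DetLine at hx
  rw [← ExteriorAlgebra.ιMulti_span_fixedDegree] at hx
  induction hx using Submodule.span_induction with
  | mem x hx =>
    obtain ⟨v, rfl⟩ := hx
    exact h1 v
  | zero => simp
  | add x y _ _ hx hy => rw [map_add, hx, hy, smul_add]
  | smul a x _ hx => rw [map_smul, hx, smul_comm]

theorem detMap_detMap {U : Type*} [AddCommGroup U] [Module F U] (e : V ≃ₗ[F] W) (f : W ≃ₗ[F] U)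
    (x : DetLine F V) : detMap f (detMap e x) = detMap (e.trans f) x :=
  Subtype.ext (exteriorAlgebra_map_map _ _ _)

theorem detMap_refl (x : DetLine F V) : detMap (LinearEquiv.refl F V) x = x := by
  apply Subtype.ext
  rw [coe_detMap, LinearEquiv.refl_toLinearMap, ExteriorAlgebra.map_id]
  rfl

/-- The isomorphism of determinant lines induced by an isomorphism. -/
noncomputable def detEquiv (e : V ≃ₗ[F] W) : DetLine F V ≃ₗ[F] DetLine F W :=
  LinearEquiv.ofLinearMap (detMap e) (detMap e.symm)
    (LinearMap.ext fun x => by simp [detMap_detMap, detMap_refl])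
    (LinearMap.ext fun x => by simp [detMap_detMap, detMap_refl])

theorem exists_eq_smul_of_finrank_eq_one {Λ : Type*} [AddCommGroup Λ] [Module F Λ]
    (h : Module.finrank F Λ = 1) {x : Λ} (hx : x ≠ 0) (y : Λ) : ∃ c : F, y = c • x := by
  obtain ⟨c, hc⟩ := (finrank_eq_one_iff_of_nonzero' x hx).1 h y
  exact ⟨c, hc.symm⟩

/-- The vector `s ⊗ (f s)^*` does not depend on the choice of `s` on a line. -/
theorem tmul_dualVector_eq {Λ Λ' : Type*} [AddCommGroup Λ] [Module F Λ] [AddCommGroup Λ']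
    [Module F Λ'] (hΛ : Module.finrank F Λ = 1) (hΛ' : Module.finrank F Λ' = 1)
    (f : Λ →ₗ[F] Λ') {s t : Λ} {φ ψ : Module.Dual F Λ'} (hs : φ (f s) = 1) (ht : ψ (f t) = 1) :
    s ⊗ₜ[F] φ = t ⊗ₜ[F] ψ := by
  have hs0 : s ≠ 0 := by
    rintro rfl
    simp at hs
  obtain ⟨c, rfl⟩ := exists_eq_smul_of_finrank_eq_one hΛ hs0 t
  have h0 : f s ≠ 0 := by
    intro h
    simp [h] at hs
  have h : φ = c • ψ := by
    ext y
    obtain ⟨d, rfl⟩ := exists_eq_smul_of_finrank_eq_one hΛ' h0 y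
    rw [map_smul, map_smul] at ht
    rw [map_smul, map_smul, LinearMap.smul_apply, hs, ht]
  rw [h, TensorProduct.tmul_smul, TensorProduct.smul_tmul']

theorem exists_equiv_apply_eq {Λ Λ' : Type*} [AddCommGroup Λ] [Module F Λ] [AddCommGroup Λ']
    [Module F Λ'] (hΛ : Module.finrank F Λ = 1) (hΛ' : Module.finrank F Λ' = 1)
    {x : Λ} {y : Λ'} (hx : x ≠ 0) (hy : y ≠ 0) : ∃ e : Λ ≃ₗ[F] Λ', e x = y := by
  have : FiniteDimensional F Λ := Module.finite_of_finrank_eq_succ hΛ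
  have : FiniteDimensional F Λ' := Module.finite_of_finrank_eq_succ hΛ'
  let e := LinearEquiv.ofFinrankEq Λ Λ' (hΛ.trans hΛ'.symm)
  obtain ⟨c, hc⟩ := exists_eq_smul_of_finrank_eq_one hΛ' (e.map_ne_zero_iff.2 hx) y
  have hc0 : c ≠ 0 := by
    rintro rfl
    simp at hc
    exact hy hc
  exact ⟨e.trans (LinearEquiv.smulOfNeZero F Λ' c hc0), by simp [hc]⟩

theorem exists_dual_apply_eq_one {Λ : Type*} [AddCommGroup Λ] [Module F Λ] {x : Λ} (hx : x ≠ 0) :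
    ∃ φ : Module.Dual F Λ, φ x = 1 := by
  obtain ⟨f, hf⟩ : ∃ f : Module.Dual F Λ, f x ≠ 0 := by
    by_contra! h
    exact hx ((Module.forall_dual_apply_eq_zero_iff F x).1 h)
  exact ⟨(f x)⁻¹ • f, by simp [hf]⟩

theorem tmul_ne_zero_of_dual {Λ Λ' : Type*} [AddCommGroup Λ] [Module F Λ] [AddCommGroup Λ']
    [Module F Λ'] {x : Λ} {y : Λ'} (hx : x ≠ 0) (hy : y ≠ 0) : x ⊗ₜ[F] y ≠ 0 := by
  obtain ⟨f, hf⟩ := exists_dual_apply_eq_one (F := F) hx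
  obtain ⟨g, hg⟩ := exists_dual_apply_eq_one (F := F) hy
  intro h
  have := congrArg (fun z => TensorProduct.lid F F (TensorProduct.map f g z)) h
  simp [hf, hg] at this

end Lines

/-! ### Invertible extensions of operators, and independence of their choice. -/

section Extensions

variable {F : Type*} [Field F] {V W : Type*} [AddCommGroup V] [Module F V]
  [AddCommGroup W] [Module F W]

/-- `S = A + S p` is an invertible extension of the restriction of `A` to the kernel of a
projection `p` onto `Ker A`. -/
structure IsInvertibleExtension (A : V →ₗ[F] W) (S : V ≃ₗ[F] W)
    (p : V →ₗ[F] LinearMap.ker A) : Prop where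
  proj : ∀ k : LinearMap.ker A, p k = k
  apply : ∀ x, S x = A x + S (p x)

/-- The map `Ker A → Coker A` induced by `S`. -/
abbrev kerToCokerOf (A : V →ₗ[F] W) (S : V ≃ₗ[F] W) : LinearMap.ker A →ₗ[F] Coker A :=
  (LinearMap.range A).mkQ ∘ₗ (S : V →ₗ[F] W) ∘ₗ (LinearMap.ker A).subtype

theorem exists_isInvertibleExtension {A : V →ₗ[F] W} {p : V →ₗ[F] LinearMap.ker A}
    (hp : ∀ k : LinearMap.ker A, p k = k) (l : LinearMap.ker A →ₗ[F] W)
    (hl : Function.Bijective ((LinearMap.range A).mkQ ∘ₗ l)) :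
    ∃ S : V ≃ₗ[F] W, IsInvertibleExtension A S p ∧ ∀ x, S x = A x + l (p x) := by
  have hb : Function.Bijective (A + l ∘ₗ p) := by
    constructor
    · rw [← LinearMap.ker_eq_bot, LinearMap.ker_eq_bot']
      intro x hx
      have hx' : A x + l (p x) = 0 := hx
      have h1 : ((LinearMap.range A).mkQ ∘ₗ l) (p x) = 0 := by
        rw [LinearMap.comp_apply, Submodule.mkQ_apply, Submodule.Quotient.mk_eq_zero]
        exact ⟨-x, by rw [map_neg, neg_eq_of_add_eq_zero_right hx']⟩
      have h2 : p x = 0 := (injective_iff_map_eq_zero _).1 hl.1 _ h1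
      have h3 : A x = 0 := by simpa [h2] using hx'
      have h4 := hp ⟨x, h3⟩
      change p x = _ at h4
      rw [h2] at h4
      exact (congrArg Subtype.val h4).symm
    · intro y
      obtain ⟨k, hk⟩ := hl.2 ((LinearMap.range A).mkQ y)
      obtain ⟨x, hx⟩ := (Submodule.Quotient.eq _).1 hk
      refine ⟨k - (x - p x), ?_⟩
      have h1 : A (k : V) = 0 := k.2
      have h2 : A (p x : V) = 0 := (p x).2
      simp only [LinearMap.add_apply, LinearMap.comp_apply, map_sub, hp, h1, h2, hx]
      abel_nf
  let S := LinearEquiv.ofBijective _ hb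
  have hS : ∀ x, S x = A x + l (p x) := fun x => rfl
  refine ⟨S, ⟨hp, fun x => ?_⟩, hS⟩
  have h2 : A (p x : V) = 0 := (p x).2
  rw [hS, hS, hp, h2, zero_add]

theorem IsInvertibleExtension.hasFiniteRank_sub {A : V →ₗ[F] W} {S : V ≃ₗ[F] W}
    {p : V →ₗ[F] LinearMap.ker A} [FiniteDimensional F (LinearMap.ker A)]
    (h : IsInvertibleExtension A S p) : HasFiniteRank ((S : V →ₗ[F] W) - A) := by
  have h1 : (S : V →ₗ[F] W) - A = ((S : V →ₗ[F] W) ∘ₗ (LinearMap.ker A).subtype) ∘ₗ p := by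
    ext x
    simp only [LinearMap.sub_apply, LinearEquiv.coe_coe, LinearMap.comp_apply,
      Submodule.subtype_apply]
    rw [h.apply x]
    abel
  rw [h1]
  exact (HasFiniteRank.of_domain _).comp_right p

theorem IsInvertibleExtension.sub_hasFiniteRank {A B : V →ₗ[F] W} {S R : V ≃ₗ[F] W}
    {p : V →ₗ[F] LinearMap.ker A} {q : V →ₗ[F] LinearMap.ker B}
    [FiniteDimensional F (LinearMap.ker A)] [FiniteDimensional F (LinearMap.ker B)]
    (hAB : HasFiniteRank (A - B))
    (h : IsInvertibleExtension A S p) (h' : IsInvertibleExtension B R q) :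
    HasFiniteRank ((S : V →ₗ[F] W) - (R : V →ₗ[F] W)) := by
  have h1 : (S : V →ₗ[F] W) - (R : V →ₗ[F] W) =
      (((S : V →ₗ[F] W) - A) + (A - B)) - ((R : V →ₗ[F] W) - B) := by abel
  rw [h1]
  exact (h.hasFiniteRank_sub.add hAB).sub h'.hasFiniteRank_sub

theorem hasFiniteRank_id_sub_symm_comp {S R : V ≃ₗ[F] W}
    (h : HasFiniteRank ((S : V →ₗ[F] W) - (R : V →ₗ[F] W))) :
    HasFiniteRank (LinearMap.id - (R.symm : W →ₗ[F] V) ∘ₗ (S : V →ₗ[F] W)) := by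
  have h1 : LinearMap.id - (R.symm : W →ₗ[F] V) ∘ₗ (S : V →ₗ[F] W) =
      -((R.symm : W →ₗ[F] V) ∘ₗ ((S : V →ₗ[F] W) - (R : V →ₗ[F] W))) := by
    ext x
    simp
  rw [h1]
  exact (h.comp_left _).neg

/-- Measures the effect of changing the extension: with `i` the inclusion of `Ker A`, the operator
`c = q T⁻¹ S i` relates the two maps to the cokernel. One has `T⁻¹ S = U (1 + Y p)`, where `U` only
changes the projection and has determinant one because `p - q` vanishes on `Ker A`. The second
factor has determinant `det (1 + p Y) = det c`. -/
theorem IsInvertibleExtension.exists_det_eq {A : V →ₗ[F] W} {S T : V ≃ₗ[F] W}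
    {p q : V →ₗ[F] LinearMap.ker A} [FiniteDimensional F (LinearMap.ker A)]
    (hS : IsInvertibleExtension A S p) (hT : IsInvertibleExtension A T q) :
    ∃ c : LinearMap.ker A →ₗ[F] LinearMap.ker A, kerToCokerOf A T ∘ₗ c = kerToCokerOf A S ∧
      detClassDet ((T.symm : W →ₗ[F] V) ∘ₗ (S : V →ₗ[F] W)) = LinearMap.det c := by
  set i := (LinearMap.ker A).subtype with hi
  have hp : p ∘ₗ i = LinearMap.id := LinearMap.ext hS.proj
  have hq : q ∘ₗ i = LinearMap.id := LinearMap.ext hT.proj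
  have hpi : ∀ x, p (i x) = x := hS.proj
  have hqi : ∀ x, q (i x) = x := hT.proj
  let c : LinearMap.ker A →ₗ[F] LinearMap.ker A :=
    q ∘ₗ (T.symm : W →ₗ[F] V) ∘ₗ (S : V →ₗ[F] W) ∘ₗ i
  refine ⟨c, ?_, ?_⟩
  · ext k
    simp only [LinearMap.comp_apply, Submodule.mkQ_apply, LinearEquiv.coe_coe]
    rw [Submodule.Quotient.eq]
    have h1 := hT.apply (T.symm (S (i k)))
    rw [LinearEquiv.apply_symm_apply] at h1
    refine ⟨-(T.symm (S (i k))), ?_⟩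
    rw [map_neg]
    change -A _ = T (q (T.symm (S (i k)))) - S (i k)
    generalize T.symm (S (i k)) = y at h1 ⊢
    rw [h1]
    abel
  · let U : V →ₗ[F] V := LinearMap.id + i ∘ₗ (p - q)
    -- This is `U⁻¹ T⁻¹ (S - T) i`, since `i (p - q)` has square zero.
    let Y : LinearMap.ker A →ₗ[F] V := (LinearMap.id - i ∘ₗ (p - q)) ∘ₗ (T.symm : W →ₗ[F] V) ∘ₗ
      ((S : V →ₗ[F] W) - (T : V →ₗ[F] W)) ∘ₗ i
    have h1 : (T.symm : W →ₗ[F] V) ∘ₗ (S : V →ₗ[F] W) = U ∘ₗ (LinearMap.id + Y ∘ₗ p) := by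
      ext x
      apply T.injective
      simp only [U, Y, LinearMap.comp_apply, LinearMap.add_apply, LinearMap.sub_apply,
        LinearMap.id_apply, LinearEquiv.coe_coe, LinearEquiv.apply_symm_apply, map_add, map_sub,
        hpi, hqi]
      have e1 : S x = A x + S (i (p x)) := hS.apply x
      have e2 : T x = A x + T (i (q x)) := hT.apply x
      rw [e1, e2]
      abel
    have hU : detClassDet U = 1 := by
      have h2 : (LinearMap.id + (p - q) ∘ₗ i : LinearMap.ker A →ₗ[F] LinearMap.ker A) =
          LinearMap.id := by
        rw [LinearMap.sub_comp, hp, hq, sub_self, add_zero]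
      rw [detClassDet_id_add_comp, h2, LinearMap.det_id]
    have hY : LinearMap.id + p ∘ₗ Y = c := by
      ext x
      simp only [Y, c, LinearMap.comp_apply, LinearMap.add_apply, LinearMap.sub_apply,
        LinearMap.id_apply, LinearEquiv.coe_coe, LinearEquiv.symm_apply_apply, map_sub,
        hpi, hqi]
      simp
    rw [h1, detClassDet_comp
      (hasFiniteRank_id_sub_id_add ((HasFiniteRank.of_domain i).comp_right _))
      (hasFiniteRank_id_sub_id_add ((HasFiniteRank.of_domain Y).comp_right _)), hU,
      detClassDet_id_add_comp, hY, one_mul]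

theorem detClassDet_id : detClassDet (LinearMap.id : V →ₗ[F] V) = 1 := by
  have h := detClassDet_id_add_comp (0 : (Fin 0 → F) →ₗ[F] V) (0 : V →ₗ[F] (Fin 0 → F))
  simpa using h

/-- The cocycle rule from `R⁻¹ S = (R⁻¹ T) (T⁻¹ S)`. -/
theorem detClassDet_symm_comp_mul {S R : V ≃ₗ[F] W} (T : V ≃ₗ[F] W)
    (hST : HasFiniteRank ((S : V →ₗ[F] W) - (T : V →ₗ[F] W)))
    (hTR : HasFiniteRank ((T : V →ₗ[F] W) - (R : V →ₗ[F] W))) :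
    detClassDet ((R.symm : W →ₗ[F] V) ∘ₗ (S : V →ₗ[F] W)) =
      detClassDet ((R.symm : W →ₗ[F] V) ∘ₗ (T : V →ₗ[F] W)) *
        detClassDet ((T.symm : W →ₗ[F] V) ∘ₗ (S : V →ₗ[F] W)) := by
  rw [← detClassDet_comp (hasFiniteRank_id_sub_symm_comp hTR)
    (hasFiniteRank_id_sub_symm_comp hST)]
  congr 1
  ext x
  simp

theorem hasFiniteRank_sub_comm {f g : V →ₗ[F] W} (h : HasFiniteRank (f - g)) :
    HasFiniteRank (g - f) := by
  rw [← neg_sub]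
  exact h.neg

/-- `P` is `s ⊗ (S s)^* ↦ det(R⁻¹ S)⁻¹ • (u ⊗ (R u)^*)`. -/
def IsDeterminantComparison {A B : V →ₗ[F] W} (S R : V ≃ₗ[F] W) (P : OpDet A ≃ₗ[F] OpDet B) :
    Prop :=
  ∀ (s : DetLine F (LinearMap.ker A)) (a : DetLine F (Coker A)) (u : DetLine F (LinearMap.ker B))
    (b : DetLine F (Coker B)) (φ : Module.Dual F (DetLine F (Coker A)))
    (ψ : Module.Dual F (DetLine F (Coker B))),
    (a : ExteriorAlgebra F (Coker A)) = ExteriorAlgebra.map (kerToCokerOf A S) s →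
    (b : ExteriorAlgebra F (Coker B)) = ExteriorAlgebra.map (kerToCokerOf B R) u →
    IsDualVector φ a → IsDualVector ψ b →
    P (s ⊗ₜ[F] φ) = (detClassDet ((R.symm : W →ₗ[F] V) ∘ₗ (S : V →ₗ[F] W)))⁻¹ • (u ⊗ₜ[F] ψ)

/-- The comparison does not depend on the choice of the invertible extensions. -/
theorem IsDeterminantComparison.change {A B : V →ₗ[F] W} {S R S' R' : V ≃ₗ[F] W}
    {p p' : V →ₗ[F] LinearMap.ker A} {q q' : V →ₗ[F] LinearMap.ker B}
    {P : OpDet A ≃ₗ[F] OpDet B}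
    [FiniteDimensional F (LinearMap.ker A)] [FiniteDimensional F (LinearMap.ker B)]
    (hP : IsDeterminantComparison S R P) (hAB : HasFiniteRank (A - B))
    (hS : IsInvertibleExtension A S p) (hS' : IsInvertibleExtension A S' p')
    (hR : IsInvertibleExtension B R q) (hR' : IsInvertibleExtension B R' q') :
    IsDeterminantComparison S' R' P := by
  intro s a u b φ ψ ha hb hφ hψ
  have hAA : HasFiniteRank (A - A) := by
    rw [sub_self]
    exact HasFiniteRank.comp_right (HasFiniteRank.of_domain (0 : (Fin 0 → F) →ₗ[F] W)) 0
  have hBB : HasFiniteRank (B - B) := by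
    rw [sub_self] at hAA ⊢
    exact hAA
  obtain ⟨c, hc, hdc⟩ := hS.exists_det_eq hS'
  obtain ⟨d, hd, hdd⟩ := hR.exists_det_eq hR'
  have fSS := hS.sub_hasFiniteRank hAA hS'
  have fRR := hR.sub_hasFiniteRank hBB hR'
  have fSR := hS'.sub_hasFiniteRank hAB hR'
  have fS'R := hS'.sub_hasFiniteRank hAB hR
  -- `det c` is a factor of `det (S⁻¹ S) = 1`.
  have hc0 : LinearMap.det c ≠ 0 := by
    have h := detClassDet_symm_comp_mul (S := S) (R := S) S' fSS (hasFiniteRank_sub_comm fSS)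
    have h1 : (S.symm : W →ₗ[F] V) ∘ₗ (S : V →ₗ[F] W) = LinearMap.id := by
      ext; simp
    rw [h1, detClassDet_id, hdc] at h
    exact right_ne_zero_of_mul (h ▸ one_ne_zero)
  have hd1 : detClassDet ((R.symm : W →ₗ[F] V) ∘ₗ (R' : V →ₗ[F] W)) * LinearMap.det d = 1 := by
    have h := detClassDet_symm_comp_mul (S := R) (R := R) R' fRR (hasFiniteRank_sub_comm fRR)
    have h1 : (R.symm : W →ₗ[F] V) ∘ₗ (R : V →ₗ[F] W) = LinearMap.id := by
      ext; simp
    rw [h1, detClassDet_id, hdd] at h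
    exact h.symm
  have hd0 : LinearMap.det d ≠ 0 := right_ne_zero_of_mul (hd1 ▸ one_ne_zero)
  -- The old extension sends `s` to `det c` times what the new one does, so the dual vector is
  -- divided by `det c`; similarly for `u` and `d`.
  have key := hP s (LinearMap.det c • a) u (LinearMap.det d • b)
    ((LinearMap.det c)⁻¹ • φ) ((LinearMap.det d)⁻¹ • ψ)
    (by
      rw [← hc, ← exteriorAlgebra_map_map, exteriorAlgebra_map_eq_det_smul c s.2, map_smul,
        Submodule.coe_smul, ha])
    (by
      rw [← hd, ← exteriorAlgebra_map_map, exteriorAlgebra_map_eq_det_smul d u.2, map_smul,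
        Submodule.coe_smul, hb])
    (by
      have h : φ a = 1 := hφ
      simp [IsDualVector, h, hc0])
    (by
      have h : ψ b = 1 := hψ
      simp [IsDualVector, h, hd0])
  have hdet : detClassDet ((R.symm : W →ₗ[F] V) ∘ₗ (S : V →ₗ[F] W)) * LinearMap.det d =
      detClassDet ((R'.symm : W →ₗ[F] V) ∘ₗ (S' : V →ₗ[F] W)) * LinearMap.det c := by
    rw [detClassDet_symm_comp_mul S' fSS fS'R,
      detClassDet_symm_comp_mul R' fSR (hasFiniteRank_sub_comm fRR), hdc]
    linear_combination (detClassDet ((R'.symm : W →ₗ[F] V) ∘ₗ (S' : V →ₗ[F] W)) *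
      LinearMap.det c) * hd1
  rw [TensorProduct.tmul_smul, TensorProduct.tmul_smul, map_smul, smul_smul, ← mul_inv, hdet,
    mul_inv, mul_comm, mul_smul] at key
  exact smul_right_injective _ (inv_ne_zero hc0) key

end Extensions

/-! ### The operator perturbation isomorphism in index zero. -/

section Reduction

variable {F : Type*} [Field F] {V W : Type*} [AddCommGroup V] [Module F V]
  [AddCommGroup W] [Module F W]

theorem IsPseudoInverse.kerToCoker_bijective {A : V →ₗ[F] W} {A' : W →ₗ[F] V}
    (h : IsPseudoInverse A A') : Function.Bijective (kerToCoker A A') := by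
  constructor
  · rw [← LinearMap.ker_eq_bot, LinearMap.ker_eq_bot']
    rintro ⟨x, hx⟩ h0
    obtain ⟨y, hy⟩ := (Submodule.Quotient.mk_eq_zero _).1 h0
    have hy' : A' y = x := hy
    have h1 : A' (A (A' y)) = A' y := LinearMap.congr_fun h.right y
    have hx' : A x = 0 := hx
    rw [hy', hx', map_zero] at h1
    exact Subtype.ext h1.symm
  · intro z
    obtain ⟨x, rfl⟩ := Submodule.mkQ_surjective _ z
    refine ⟨h.kerProj x, (Submodule.Quotient.eq _).2 ⟨-A x, ?_⟩⟩
    simp [IsPseudoInverse.kerProj]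

theorem IsPseudoInverse.kerProj_apply_coe {A : V →ₗ[F] W} {A' : W →ₗ[F] V}
    (h : IsPseudoInverse A A') (x : V) : (h.kerProj x : V) = x - A' (A x) := rfl

theorem IsPseudoInverse.kerProj_ker {A : V →ₗ[F] W} {A' : W →ₗ[F] V}
    (h : IsPseudoInverse A A') (k : LinearMap.ker A) : h.kerProj k = k := by
  apply Subtype.ext
  have hk : A (k : V) = 0 := k.2
  rw [h.kerProj_apply_coe, hk, map_zero, sub_zero]

theorem IsPseudoInverse.kerProj_symm_apply {A : V →ₗ[F] W} {A' : W →ₗ[F] V}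
    (h : IsPseudoInverse A A') (x : V) : h.symm.kerProj (A x) = 0 := by
  apply Subtype.ext
  have h1 : A (A' (A x)) = A x := LinearMap.congr_fun h.left x
  rw [h.symm.kerProj_apply_coe, h1, sub_self]
  rfl

/-- In index zero one kernel in the perturbation triple is zero; its determinant line is the
scalars, and `1` serves as the trivial wedge factor. -/
theorem one_mem_detLine_of_eq_bot {p : Submodule F V} (h : p = ⊥) :
    (1 : ExteriorAlgebra F p) ∈ DetLine F p := by
  subst h
  unfold DetLine
  rw [finrank_bot]
  change (1 : ExteriorAlgebra F _) ∈ LinearMap.range (ExteriorAlgebra.ι F) ^ 0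
  rw [pow_zero]
  exact Submodule.one_le.1 le_rfl

theorem exists_map_subtype_eq_of_eq_top {p : Submodule F V} (h : p = ⊤)
    {s : ExteriorAlgebra F V} (hs : s ∈ DetLine F V) :
    ∃ t : DetLine F p, ExteriorAlgebra.map p.subtype (t : ExteriorAlgebra F p) = s := by
  subst h
  let e : V ≃ₗ[F] (⊤ : Submodule F V) := Submodule.topEquiv.symm
  refine ⟨detMap e ⟨s, hs⟩, ?_⟩
  have h : (⊤ : Submodule F V).subtype ∘ₗ (e : V →ₗ[F] (⊤ : Submodule F V)) = LinearMap.id := rfl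
  rw [coe_detMap, exteriorAlgebra_map_map, h, ExteriorAlgebra.map_id]
  rfl

/-- On `Im B` the operator `T` is just `B'`, so `T (B x) = B' B x` and `x - T (B x)` is the
projection of `x` to `Ker B`. Thus an extension of `B'` inverts to an extension of `B`. -/
theorem isInvertibleExtension_of_symm {B : V →ₗ[F] W} {B' : W →ₗ[F] V}
    (hB : IsPseudoInverse B B') {M : LinearMap.ker B' →ₗ[F] V} {T : W ≃ₗ[F] V}
    (hT : ∀ y, T y = B' y + M (hB.symm.kerProj y)) :
    IsInvertibleExtension B T.symm hB.kerProj := by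
  refine ⟨hB.kerProj_ker, fun x => ?_⟩
  apply T.injective
  have h := hT (B x)
  rw [hB.kerProj_symm_apply, map_zero, add_zero] at h
  rw [map_add, LinearEquiv.apply_symm_apply, LinearEquiv.apply_symm_apply, h,
    hB.kerProj_apply_coe]
  abel

/-- The element of `det (Ker B')` corresponding to the image of `u` in `det (Coker B)`. -/
theorem exists_kerToCoker_eq {B : V →ₗ[F] W} {B' : W →ₗ[F] V}
    (hB : IsPseudoInverse B B') {M : LinearMap.ker B' →ₗ[F] V} {T : W ≃ₗ[F] V}
    (hT : ∀ y, T y = B' y + M (hB.symm.kerProj y))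
    (h : Module.finrank F (LinearMap.ker B) = Module.finrank F (LinearMap.ker B'))
    (u : DetLine F (LinearMap.ker B)) :
    ∃ t : DetLine F (LinearMap.ker B'),
      ExteriorAlgebra.map (kerToCoker B' B) (t : ExteriorAlgebra F (LinearMap.ker B')) =
        ExteriorAlgebra.map (kerToCokerOf B T.symm) (u : ExteriorAlgebra F (LinearMap.ker B)) ∧
      ExteriorAlgebra.map ((LinearMap.range B').mkQ ∘ₗ M)
        (t : ExteriorAlgebra F (LinearMap.ker B')) =
        ExteriorAlgebra.map (kerToCoker B B') (u : ExteriorAlgebra F (LinearMap.ker B)) := by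
  -- Modulo `Im B` this is `T⁻¹`, while `M θ k` is congruent to `k` modulo `Im B'` because `T T⁻¹ k
  -- = k`. One vector `t` therefore meets both requirements.
  let θ : LinearMap.ker B →ₗ[F] LinearMap.ker B' :=
    hB.symm.kerProj ∘ₗ (T.symm : V →ₗ[F] W) ∘ₗ (LinearMap.ker B).subtype
  refine ⟨⟨_, exteriorAlgebra_map_mem_detLine θ h u.2⟩, ?_, ?_⟩
  · rw [exteriorAlgebra_map_map]
    congr 2
    ext k
    refine (Submodule.Quotient.eq _).2 ⟨-B' (T.symm k), ?_⟩
    change _ = (T.symm k - B (B' (T.symm k))) - T.symm k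
    rw [map_neg]
    abel
  · rw [exteriorAlgebra_map_map]
    congr 2
    ext k
    refine (Submodule.Quotient.eq _).2 ⟨-(T.symm k), ?_⟩
    have h1 := hT (T.symm k)
    rw [LinearEquiv.apply_symm_apply] at h1
    change _ = M (hB.symm.kerProj (T.symm k)) - k
    generalize T.symm (k : V) = y at h1 ⊢
    rw [h1, map_neg]
    abel

theorem bijective_of_index_zero {A : V →ₗ[F] W} {A' : W →ₗ[F] V} (hA : IsPseudoInverse A A')
    (h : Module.finrank F (LinearMap.ker A) = Module.finrank F (Coker A)) :
    Module.finrank F (LinearMap.ker A') = Module.finrank F (LinearMap.ker A) ∧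
    Module.finrank F (LinearMap.ker A') = Module.finrank F (Coker A') := by
  have h1 := (LinearEquiv.ofBijective _ hA.kerToCoker_bijective).finrank_eq
  have h2 := (LinearEquiv.ofBijective _ hA.symm.kerToCoker_bijective).finrank_eq
  omega

/-- Equality of dimensions turns injectivity or surjectivity of `L` and `M` modulo images into
bijectivity. The relevant kernel then vanishes, which forces `N = 0` and makes the triple formula a
comparison of invertible extensions. -/
theorem IsOpPertIso.exists_isDeterminantComparison {A B : V →ₗ[F] W} {P : OpDet A ≃ₗ[F] OpDet B}
    (hP : IsOpPertIso A B P)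
    (iA : Module.finrank F (LinearMap.ker A) = Module.finrank F (Coker A))
    (iB : Module.finrank F (LinearMap.ker B) = Module.finrank F (Coker B)) :
    ∃ (S R : V ≃ₗ[F] W) (p : V →ₗ[F] LinearMap.ker A) (q : V →ₗ[F] LinearMap.ker B),
      IsInvertibleExtension A S p ∧ IsInvertibleExtension B R q ∧
      IsDeterminantComparison S R P := by
  obtain ⟨⟨fA, fA'⟩, ⟨fB, fB'⟩, hAB, A', B', hA, hB, H⟩ := hP
  obtain ⟨iB1, iB2⟩ := bijective_of_index_zero hB iB
  have fkB' : FiniteDimensional F (LinearMap.ker B') :=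
    LinearEquiv.finiteDimensional (LinearEquiv.ofBijective _ hB.symm.kerToCoker_bijective).symm
  have fcB' : FiniteDimensional F (Coker B') :=
    LinearEquiv.finiteDimensional (LinearEquiv.ofBijective _ hB.kerToCoker_bijective)
  have key : ∀ (L : LinearMap.ker A →ₗ[F] W) (M : LinearMap.ker B' →ₗ[F] V),
      Function.Bijective ((LinearMap.range A).mkQ ∘ₗ L) →
      Function.Bijective ((LinearMap.range B').mkQ ∘ₗ M) →
      ∃ (S : V ≃ₗ[F] W) (T : W ≃ₗ[F] V),
        (∀ x, S x = A x + L (hA.kerProj x)) ∧ (∀ y, T y = B' y + M (hB.symm.kerProj y)) ∧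
        IsInvertibleExtension A S hA.kerProj ∧ IsInvertibleExtension B T.symm hB.kerProj ∧
        kerToCokerOf A S = (LinearMap.range A).mkQ ∘ₗ L := by
    intro L M hL hM
    obtain ⟨S, hS, hS'⟩ := exists_isInvertibleExtension hA.kerProj_ker L hL
    obtain ⟨T, -, hT'⟩ := exists_isInvertibleExtension hB.symm.kerProj_ker M hM
    refine ⟨S, T, hS', hT', hS, isInvertibleExtension_of_symm hB hT', ?_⟩
    ext k
    have hk : A (k : V) = 0 := k.2
    simp [hS', hk, hA.kerProj_ker]
  rcases H with ⟨L, M, N, h⟩ | ⟨L, M, N, h⟩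
  · have hL : Function.Bijective ((LinearMap.range A).mkQ ∘ₗ L) :=
      ⟨h.injective_L, (LinearMap.injective_iff_surjective_of_finrank_eq_finrank iA).1
        h.injective_L⟩
    have hM : Function.Bijective ((LinearMap.range B').mkQ ∘ₗ M) :=
      ⟨(LinearMap.injective_iff_surjective_of_finrank_eq_finrank iB2).2 h.surjective_M,
        h.surjective_M⟩
    obtain ⟨S, T, hS, hT, eS, eR, hSL⟩ := key L M hL hM
    have hkM : LinearMap.ker M = ⊥ := by
      rw [LinearMap.ker_eq_bot]
      exact Function.Injective.of_comp hM.1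
    -- A complement of the zero subspace `Ker M` is everything, and `N` vanishes on it.
    have hN : LinearMap.ker N = ⊤ := by
      obtain ⟨K, hK, hKN⟩ := h.extension_N
      rw [hkM] at hK
      rw [eq_top_iff, ← eq_top_of_bot_isCompl hK]
      exact hKN
    have hN0 : N = 0 := LinearMap.ker_eq_top.1 hN
    refine ⟨S, T.symm, _, _, eS, eR, ?_⟩
    intro s a u b φ ψ ha hb hφ hψ
    obtain ⟨t, ht1, ht2⟩ := exists_kerToCoker_eq hB hT iB1.symm u
    obtain ⟨t₀, ht₀⟩ := exists_map_subtype_eq_of_eq_top hN t.2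
    -- In this form `Σ = S T` acts on `W`; conjugation by `S` turns `T S` into it, so the two have
    -- the same determinant.
    have hdet : detClassDet ((A + L ∘ₗ hA.kerProj) ∘ₗ (B' + M ∘ₗ hB.symm.kerProj) +
        N ∘ₗ hB.symm.kerProj) =
        detClassDet ((T.symm.symm : W →ₗ[F] V) ∘ₗ (S : V →ₗ[F] W)) := by
      have e1 : A + L ∘ₗ hA.kerProj = S := LinearMap.ext fun x => (hS x).symm
      have e2 : B' + M ∘ₗ hB.symm.kerProj = T := LinearMap.ext fun x => (hT x).symm
      rw [← detClassDet_conj S, hN0, LinearMap.zero_comp, add_zero, e1, e2]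
      congr 1
      ext y
      simp
    rw [← hdet]
    refine h.formula s ⟨1, one_mem_detLine_of_eq_bot hkM⟩ t₀ a u b φ ψ ?_ ?_ ?_ hφ hψ
    · rw [map_one, mul_one, ha, hSL]
    · rw [← ht2, ← ht₀, exteriorAlgebra_map_map]
      rfl
    · rw [map_one, mul_one, ht₀, hb]
      exact ht1.symm
  · have hL : Function.Bijective ((LinearMap.range A).mkQ ∘ₗ L) :=
      ⟨(LinearMap.injective_iff_surjective_of_finrank_eq_finrank iA).2 h.surjective_L,
        h.surjective_L⟩
    have hM : Function.Bijective ((LinearMap.range B').mkQ ∘ₗ M) :=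
      ⟨h.injective_M, (LinearMap.injective_iff_surjective_of_finrank_eq_finrank iB2).1
        h.injective_M⟩
    obtain ⟨S, T, hS, hT, eS, eR, hSL⟩ := key L M hL hM
    have hkL : LinearMap.ker L = ⊥ := by
      rw [LinearMap.ker_eq_bot]
      exact Function.Injective.of_comp hL.1
    have hN : LinearMap.ker N = ⊤ := by
      obtain ⟨K, hK, hKN⟩ := h.extension_N
      rw [hkL] at hK
      rw [eq_top_iff, ← eq_top_of_bot_isCompl hK]
      exact hKN
    have hN0 : N = 0 := LinearMap.ker_eq_top.1 hN
    refine ⟨S, T.symm, _, _, eS, eR, ?_⟩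
    intro s a u b φ ψ ha hb hφ hψ
    obtain ⟨t, ht1, ht2⟩ := exists_kerToCoker_eq hB hT iB1.symm u
    obtain ⟨s₁, hs₁⟩ := exists_map_subtype_eq_of_eq_top hN s.2
    have hdet : detClassDet ((B' + M ∘ₗ hB.symm.kerProj) ∘ₗ (A + L ∘ₗ hA.kerProj) +
        N ∘ₗ hA.kerProj) =
        detClassDet ((T.symm.symm : W →ₗ[F] V) ∘ₗ (S : V →ₗ[F] W)) := by
      rw [hN0, LinearMap.zero_comp, add_zero]
      congr 1
      ext y
      simp [hS, hT]
    rw [← hdet]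
    refine h.formula ⟨1, one_mem_detLine_of_eq_bot hkL⟩ s₁ t s a u b φ ψ ?_ ?_ ?_ ?_ hφ hψ
    · rw [map_one, one_mul, hs₁]
    · rw [ha, hSL, ← hs₁, exteriorAlgebra_map_map]
      rfl
    · rw [map_one, one_mul, ht2]
    · rw [hb]
      exact ht1.symm

end Reduction

/-! ### Splittings of complexes and adapted isomorphisms. -/

section Adapted

variable {F : Type*} [Field F] {X Y : Type*} [AddCommGroup X] [Module F X]
  [AddCommGroup Y] [Module F Y]

theorem homologyMk_eq_iff {f : X →ₗ[F] Y} {g : Y →ₗ[F] X} {x y : X} (hx : f x = 0) (hy : f y = 0) :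
    homologyMk f g x hx = homologyMk f g y hy ↔ ∃ z, g z = x - y :=
  Submodule.Quotient.eq _

theorem homologyMk_surjective (f : X →ₗ[F] Y) (g : Y →ₗ[F] X) (q : HomologyAt f g) :
    ∃ x, ∃ hx : f x = 0, homologyMk f g x hx = q := by
  obtain ⟨⟨x, hx⟩, rfl⟩ := Submodule.Quotient.mk_surjective _ q
  exact ⟨x, hx, rfl⟩

/-- `X = H ⊕ Im g ⊕ C` with `Ker f = H ⊕ Im g`. -/
structure IsHodgeSplitting (f : X →ₗ[F] Y) (g : Y →ₗ[F] X) (H C : Submodule F X) : Prop where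
  harmonic : ∀ x ∈ H, f x = 0
  disjoint : ∀ y, g y ∈ H → g y = 0
  span : ∀ x, f x = 0 → ∃ h ∈ H, ∃ y, x = h + g y
  disjoint_ker : ∀ c ∈ C, f c = 0 → c = 0
  span_ker : ∀ x, ∃ c ∈ C, f x = f c

namespace IsHodgeSplitting

variable {f : X →ₗ[F] Y} {g : Y →ₗ[F] X} {H C : Submodule F X} {H' C' : Submodule F Y}

theorem isCompl_range (h : IsHodgeSplitting f g H C) (hfg : ∀ y, f (g y) = 0) :
    IsCompl (LinearMap.range g) (H ⊔ C) := by
  constructor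
  · rw [Submodule.disjoint_def]
    rintro _ ⟨y, rfl⟩ hy
    obtain ⟨a, ha, c, hc, hac⟩ := Submodule.mem_sup.1 hy
    have h1 : f c = 0 := by
      have h2 := hfg y
      rwa [← hac, map_add, h.harmonic a ha, zero_add] at h2
    rw [h.disjoint_ker c hc h1, add_zero] at hac
    exact h.disjoint y (hac ▸ ha)
  · rw [codisjoint_iff, eq_top_iff]
    rintro x -
    obtain ⟨c, hc, hxc⟩ := h.span_ker x
    obtain ⟨a, ha, y, hy⟩ := h.span (x - c) (by rw [map_sub, hxc, sub_self])
    have hx : x = g y + (a + c) := by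
      rw [eq_add_of_sub_eq hy]
      abel
    rw [hx]
    exact Submodule.add_mem_sup ⟨y, rfl⟩ (Submodule.add_mem_sup ha hc)

theorem isCompl_ker (h : IsHodgeSplitting f g H C) : IsCompl (LinearMap.ker f) C := by
  constructor
  · rw [Submodule.disjoint_def]
    exact fun x hx hc => h.disjoint_ker x hc hx
  · rw [codisjoint_iff, eq_top_iff]
    rintro x -
    obtain ⟨c, hc, hxc⟩ := h.span_ker x
    have hx : x = (x - c) + c := by abel
    rw [hx]
    exact Submodule.add_mem_sup (by simp [hxc]) hc

end IsHodgeSplitting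

theorem exists_partialInverse (f : X →ₗ[F] Y) {C : Submodule F X} {K : Submodule F Y}
    (hC : IsCompl (LinearMap.ker f) C) (hK : IsCompl (LinearMap.range f) K) :
    ∃ f' : Y →ₗ[F] X, (∀ c ∈ C, f' (f c) = c) ∧ (∀ k ∈ K, f' k = 0) ∧ ∀ y, f' y ∈ C := by
  have hb : Function.Bijective (f.rangeRestrict ∘ₗ C.subtype) := by
    constructor
    · rw [← LinearMap.ker_eq_bot, LinearMap.ker_eq_bot']
      rintro ⟨c, hc⟩ h0
      exact Subtype.ext (Submodule.disjoint_def.1 hC.disjoint c (congrArg Subtype.val h0) hc)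
    · rintro ⟨_, x, rfl⟩
      have hx : x ∈ LinearMap.ker f ⊔ C := by
        rw [hC.sup_eq_top]
        trivial
      obtain ⟨a, ha, c, hc, rfl⟩ := Submodule.mem_sup.1 hx
      refine ⟨⟨c, hc⟩, Subtype.ext ?_⟩
      have ha' : f a = 0 := ha
      simp [ha']
  let e := LinearEquiv.ofBijective _ hb
  refine ⟨C.subtype ∘ₗ (e.symm : _ →ₗ[F] C) ∘ₗ
    Submodule.projectionOnto (LinearMap.range f) K hK, ?_, ?_, ?_⟩
  · intro c hc
    have h1 : e ⟨c, hc⟩ = ⟨f c, c, rfl⟩ := rfl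
    have h2 := Submodule.projectionOnto_apply_left hK ⟨f c, c, rfl⟩
    rw [LinearMap.comp_apply, LinearMap.comp_apply, h2, ← h1]
    simp
  · intro k hk
    have h2 := Submodule.projectionOnto_apply_right hK ⟨k, hk⟩
    rw [LinearMap.comp_apply, LinearMap.comp_apply, h2]
    simp
  · exact fun y => Subtype.coe_prop _

/-- An isomorphism `S : X → Y` which is a partial inverse of `g` on `Im g`, whose inverse is a
partial inverse of `f` on `Im f`, and which induces `l` on harmonic representatives. -/
structure IsAdapted (f : X →ₗ[F] Y) (g : Y →ₗ[F] X) (l : HomologyAt f g ≃ₗ[F] HomologyAt g f)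
    (S : X ≃ₗ[F] Y) : Prop where
  apply_right : ∀ y, g (S (g y)) = g y
  symm_left : ∀ x, f (S.symm (f x)) = f x
  homology : ∀ (x : X) (hx : f x = 0) (hSx : g (S x) = 0),
    homologyMk g f (S x) hSx = l (homologyMk f g x hx)

/-- `H'` maps isomorphically to homology, so `l` transports to a map `H → H'`. The three pieces of
`X` receive separate prescriptions: `f` on `C`, the inverse of `g` on `Im g`, and this transported
map on `H`. -/
theorem IsHodgeSplitting.exists_linearMap {f : X →ₗ[F] Y} {g : Y →ₗ[F] X} {H C : Submodule F X}
    {H' C' : Submodule F Y} (hX : IsHodgeSplitting f g H C) (hY : IsHodgeSplitting g f H' C')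
    (hfg : ∀ y, f (g y) = 0) (l : HomologyAt f g →ₗ[F] HomologyAt g f) :
    ∃ S : X →ₗ[F] Y, (∀ c ∈ C, S c = f c) ∧ (∀ c ∈ C', S (g c) = c) ∧
      ∀ (x : X) (hx : x ∈ H), S x ∈ H' ∧ ∀ (hSx : g (S x) = 0),
        homologyMk g f (S x) hSx = l (homologyMk f g x (hX.harmonic x hx)) := by
  obtain ⟨g', hg1, hg2, -⟩ := exists_partialInverse g hY.isCompl_ker (hX.isCompl_range hfg)
  let β : H' →ₗ[F] HomologyAt g f :=
    ((LinearMap.range f).submoduleOf (LinearMap.ker g)).mkQ ∘ₗ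
      Submodule.inclusion (fun y hy => hY.harmonic y hy)
  have hβ : Function.Bijective β := by
    constructor
    · rw [← LinearMap.ker_eq_bot, LinearMap.ker_eq_bot']
      rintro ⟨y, hy⟩ h0
      obtain ⟨x, hx⟩ := (Submodule.Quotient.mk_eq_zero _).1 h0
      have hx' : f x = y := hx
      exact Subtype.ext (hx' ▸ hY.disjoint x (hx' ▸ hy))
    · intro q
      obtain ⟨y, hy, rfl⟩ := homologyMk_surjective g f q
      obtain ⟨a, ha, x, rfl⟩ := hY.span y hy
      refine ⟨⟨a, ha⟩, (homologyMk_eq_iff (hY.harmonic a ha) hy).2 ⟨-x, ?_⟩⟩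
      rw [map_neg]
      abel
  let e := LinearEquiv.ofBijective β hβ
  let π : X →ₗ[F] LinearMap.ker f := Submodule.projectionOnto (LinearMap.ker f) C hX.isCompl_ker
  have hπ1 : ∀ x (hx : f x = 0), π x = ⟨x, hx⟩ := fun x hx =>
    Submodule.projectionOnto_apply_left hX.isCompl_ker ⟨x, hx⟩
  have hπ2 : ∀ c ∈ C, π c = 0 := fun c hc =>
    Submodule.projectionOnto_apply_right hX.isCompl_ker ⟨c, hc⟩
  let k : X →ₗ[F] H' := (e.symm : _ →ₗ[F] H') ∘ₗ l ∘ₗ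
    ((LinearMap.range g).submoduleOf (LinearMap.ker f)).mkQ ∘ₗ π
  refine ⟨f + g' + H'.subtype ∘ₗ k, ?_, ?_, ?_⟩
  · intro c hc
    simp [k, hπ2 c hc, hg2 c (Submodule.mem_sup_right hc)]
  · intro c hc
    have h1 : ((LinearMap.range g).submoduleOf (LinearMap.ker f)).mkQ (π (g c)) = 0 := by
      rw [hπ1 _ (hfg c), Submodule.mkQ_apply, Submodule.Quotient.mk_eq_zero]
      exact ⟨c, rfl⟩
    have h2 : k (g c) = 0 := by
      simp only [k, LinearMap.comp_apply, h1, map_zero]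
    simp [h2, hg1 c hc, hfg]
  · intro x hx
    have h1 : (f + g' + H'.subtype ∘ₗ k) x = k x := by
      simp [hX.harmonic x hx, hg2 x (Submodule.mem_sup_left hx)]
    rw [h1]
    refine ⟨(k x).2, fun hSx => ?_⟩
    have h2 : k x = e.symm (l (homologyMk f g x (hX.harmonic x hx))) := by
      simp only [k, LinearMap.comp_apply, hπ1 x (hX.harmonic x hx)]
      rfl
    have h3 : e (k x) = l (homologyMk f g x (hX.harmonic x hx)) := by
      rw [h2, LinearEquiv.apply_symm_apply]
    exact h3

/-- Checked on each summand of `X = H ⊕ g C' ⊕ C`. On `H`, both `a` and `T (S a)` are harmonic and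
represent the same class, hence agree. -/
theorem IsHodgeSplitting.comp_eq_id {f : X →ₗ[F] Y} {g : Y →ₗ[F] X} {H C : Submodule F X}
    {H' C' : Submodule F Y} (hX : IsHodgeSplitting f g H C) (hY : IsHodgeSplitting g f H' C')
    (l : HomologyAt f g ≃ₗ[F] HomologyAt g f) {S : X →ₗ[F] Y} {T : Y →ₗ[F] X}
    (hS1 : ∀ c ∈ C, S c = f c) (hS2 : ∀ c ∈ C', S (g c) = c)
    (hS3 : ∀ (x : X) (hx : x ∈ H), S x ∈ H' ∧ ∀ (hSx : g (S x) = 0),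
        homologyMk g f (S x) hSx = l (homologyMk f g x (hX.harmonic x hx)))
    (hT1 : ∀ c ∈ C', T c = g c) (hT2 : ∀ c ∈ C, T (f c) = c)
    (hT3 : ∀ (y : Y) (hy : y ∈ H'), T y ∈ H ∧ ∀ (hTy : f (T y) = 0),
        homologyMk f g (T y) hTy = l.symm (homologyMk g f y (hY.harmonic y hy))) :
    T ∘ₗ S = LinearMap.id := by
  ext x
  obtain ⟨c, hc, hxc⟩ := hX.span_ker x
  obtain ⟨a, ha, y, hy⟩ := hX.span (x - c) (by rw [map_sub, hxc, sub_self])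
  obtain ⟨c', hc', hyc⟩ := hY.span_ker y
  have hx : x = a + g c' + c := by rw [← hyc, ← hy]; abel
  have h1 : T (S a) = a := by
    obtain ⟨m1, m2⟩ := hS3 a ha
    obtain ⟨m3, m4⟩ := hT3 (S a) m1
    have h2 := m4 (hX.harmonic _ m3)
    rw [m2 (hY.harmonic _ m1), LinearEquiv.symm_apply_apply, homologyMk_eq_iff] at h2
    obtain ⟨z, hz⟩ := h2
    have h3 := hX.disjoint z (hz ▸ H.sub_mem m3 ha)
    rw [h3] at hz
    exact (sub_eq_zero.1 hz.symm)
  rw [hx]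
  simp [h1, hS1 c hc, hS2 c' hc', hT1 c' hc', hT2 c hc]

/-- A pair of splittings determines an adapted isomorphism. -/
theorem IsHodgeSplitting.exists_isAdapted {f : X →ₗ[F] Y} {g : Y →ₗ[F] X} {H C : Submodule F X}
    {H' C' : Submodule F Y} (hX : IsHodgeSplitting f g H C) (hY : IsHodgeSplitting g f H' C')
    (hfg : ∀ y, f (g y) = 0) (hgf : ∀ x, g (f x) = 0)
    (l : HomologyAt f g ≃ₗ[F] HomologyAt g f) :
    ∃ S : X ≃ₗ[F] Y, IsAdapted f g l S ∧ (∀ c ∈ C, S c = f c) ∧ (∀ c ∈ C', S (g c) = c) ∧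
      ∀ x ∈ H, S x ∈ H' := by
  obtain ⟨S, hS1, hS2, hS3⟩ := hX.exists_linearMap hY hfg (l : _ →ₗ[F] _)
  obtain ⟨T, hT1, hT2, hT3⟩ := hY.exists_linearMap hX hgf (l.symm : _ →ₗ[F] _)
  have h1 := hX.comp_eq_id hY l hS1 hS2 hS3 hT1 hT2 hT3
  have h2 := hY.comp_eq_id hX l.symm hT1 hT2 hT3 hS1 hS2 hS3
  refine ⟨LinearEquiv.ofLinearMap S T h2 h1, ⟨?_, ?_, ?_⟩, hS1, hS2, fun x hx => (hS3 x hx).1⟩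
  · intro y
    obtain ⟨c', hc', hyc⟩ := hY.span_ker y
    change g (S (g y)) = g y
    rw [hyc, hS2 c' hc']
  · intro x
    obtain ⟨c, hc, hxc⟩ := hX.span_ker x
    change f (T (f x)) = f x
    rw [hxc, hT2 c hc]
  · intro x hx hSx
    change g (S x) = 0 at hSx
    change homologyMk g f (S x) hSx = _
    obtain ⟨a, ha, y, hy⟩ := hX.span x hx
    obtain ⟨c', hc', hyc⟩ := hY.span_ker y
    -- A component `g c'` of the cycle `x` would be sent to `c'`, which is not a cycle unless it is
    -- zero; so `x` is already harmonic.
    have h3 : c' = 0 := by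
      refine hY.disjoint_ker c' hc' ?_
      rw [hy, hyc, map_add, map_add, hS2 c' hc', hY.harmonic _ (hS3 a ha).1, zero_add] at hSx
      exact hSx
    have h4 : x = a := by rw [hy, hyc, h3, map_zero, add_zero]
    subst h4
    exact (hS3 x ha).2 hSx

namespace IsAdapted

variable {f : X →ₗ[F] Y} {g : Y →ₗ[F] X} {l : HomologyAt f g ≃ₗ[F] HomologyAt g f}
  {S T : X ≃ₗ[F] Y}

theorem symm (hS : IsAdapted f g l S) : IsAdapted g f l.symm S.symm := by
  refine ⟨hS.symm_left, hS.apply_right, fun y hy hSy => ?_⟩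
  rw [LinearEquiv.eq_symm_apply]
  have h := hS.homology (S.symm y) hSy (by rw [LinearEquiv.apply_symm_apply, hy])
  rw [← h]
  congr 1
  exact S.apply_symm_apply y

/-- The nilpotent difference of the splittings of two adapted isomorphisms. -/
def shift (f : X →ₗ[F] Y) (g : Y →ₗ[F] X) (S T : X ≃ₗ[F] Y) : X →ₗ[F] X :=
  g ∘ₗ ((T : X →ₗ[F] Y) - (S : X →ₗ[F] Y)) +
    ((S.symm : Y →ₗ[F] X) - (T.symm : Y →ₗ[F] X)) ∘ₗ f +
    g ∘ₗ (S : X →ₗ[F] Y) ∘ₗ (T.symm : Y →ₗ[F] X) ∘ₗ f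

theorem shift_apply (x : X) : shift f g S T x =
    g (T x) - g (S x) + (S.symm (f x) - T.symm (f x)) + g (S (T.symm (f x))) := by
  simp [shift]

/-- The shift maps `X` into `Ker f`, maps `Ker f` into `Im g`, and kills `Im g`; its cube is
therefore zero. -/
theorem isNilpotent_shift (hfg : ∀ y, f (g y) = 0) (hS : IsAdapted f g l S)
    (hT : IsAdapted f g l T) : IsNilpotent (shift f g S T) := by
  refine ⟨3, ?_⟩
  have h1 : ∀ x, f (shift f g S T x) = 0 := by
    intro x
    simp [shift_apply, hfg, hS.symm_left, hT.symm_left]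
  have h2 : ∀ x, f x = 0 → shift f g S T x = g (T x - S x) := by
    intro x hx
    simp [shift_apply, hx]
  have h3 : ∀ y, shift f g S T (g y) = 0 := by
    intro y
    rw [h2 _ (hfg y), map_sub, hS.apply_right, hT.apply_right, sub_self]
  ext x
  simp only [pow_succ, pow_zero, one_mul, Module.End.mul_apply, LinearMap.zero_apply]
  rw [h2 (shift f g S T x) (h1 x), h3]

/-- The unipotents `1 + shift` on the two sides intertwine `T` and `S`. The space `X` is spanned by
`Im g`, by `T⁻¹ (Im f)` and by cycles with `T`-image a cycle. On the first two the identity is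
formal; only the third uses that both isomorphisms induce the same `l`. -/
theorem symm_comp_id_add_shift (hfg : ∀ y, f (g y) = 0) (hgf : ∀ x, g (f x) = 0)
    (hS : IsAdapted f g l S) (hT : IsAdapted f g l T) (x : X) :
    T x + shift g f S.symm T.symm (T x) = S (x + shift f g S T x) := by
  have main : ∀ x, f x = 0 → g (T x) = 0 →
      T x + shift g f S.symm T.symm (T x) = S (x + shift f g S T x) := by
    intro x hx hTx
    have hx' : f (x - g (S x)) = 0 := by rw [map_sub, hx, hfg, sub_zero]
    have e1 : T x + shift g f S.symm T.symm (T x) = T x - f (S.symm (T x)) := by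
      simp [shift_apply, hx, hTx]
      abel
    have e2 : x + shift f g S T x = x - g (S x) := by
      simp [shift_apply, hx, hTx]
      abel
    rw [e1, e2]
    have hg1 : g (S (x - g (S x))) = 0 := by
      rw [map_sub, map_sub, hS.apply_right, sub_self]
    have c1 := hS.homology _ hx' hg1
    have c2 := hT.homology x hx hTx
    have c3 : homologyMk f g (x - g (S x)) hx' = homologyMk f g x hx :=
      (homologyMk_eq_iff _ _).2 ⟨-S x, by rw [map_neg]; abel⟩
    rw [c3, ← c2, homologyMk_eq_iff] at c1
    obtain ⟨z, hz⟩ := c1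
    -- The two sides represent the same class, so they differ by some `f w`. Since `f S⁻¹ f w = f
    -- w`, it suffices that `S⁻¹` of the difference is a cycle.
    have hw : ∃ w, f w = T x - f (S.symm (T x)) - S (x - g (S x)) :=
      ⟨-z - S.symm (T x), by rw [map_sub, map_neg, hz]; abel⟩
    obtain ⟨w, hw⟩ := hw
    have h3 : f (S.symm (f w)) = 0 := by
      rw [hw, map_sub, map_sub, map_sub, map_sub, hS.symm_left, LinearEquiv.symm_apply_apply, hx',
        sub_self, sub_zero]
    rw [hS.symm_left, hw] at h3
    exact sub_eq_zero.1 h3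
  have hr : ∀ y, T (g y) + shift g f S.symm T.symm (T (g y)) = S (g y + shift f g S T (g y)) := by
    intro y
    simp [shift_apply, hfg, hS.apply_right, hT.apply_right]
  have hl : ∀ z, T (T.symm (f z)) + shift g f S.symm T.symm (T (T.symm (f z))) =
      S (T.symm (f z) + shift f g S T (T.symm (f z))) := by
    intro z
    simp [shift_apply, hgf, hS.symm_left, hT.symm_left]
  -- Subtracting `g T x` and `T⁻¹ f x` leaves a cycle whose image under `T` is a cycle.
  have hx : x = (x - g (T x) - T.symm (f x)) + g (T x) + T.symm (f x) := by abel
  have m := main (x - g (T x) - T.symm (f x))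
    (by rw [map_sub, map_sub, hfg, hT.symm_left, sub_zero, sub_self])
    (by rw [map_sub, map_sub, LinearEquiv.apply_symm_apply, map_sub, map_sub, hT.apply_right,
      hgf, sub_self, sub_zero])
  have m' := congrArg₂ (· + ·) (congrArg₂ (· + ·) m (hr (T x))) (hl x)
  simp only [← map_add] at m'
  have t1 : ∀ a b c : X, T a + shift g f S.symm T.symm (T a) +
      (T b + shift g f S.symm T.symm (T b)) + (T c + shift g f S.symm T.symm (T c)) =
      T (a + b + c) + shift g f S.symm T.symm (T (a + b + c)) := by
    intro a b c
    simp only [map_add]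
    abel
  have t2 : ∀ a b c : X, a + shift f g S T a + (b + shift f g S T b) + (c + shift f g S T c) =
      (a + b + c) + shift f g S T (a + b + c) := by
    intro a b c
    simp only [map_add]
    abel
  rw [t1, t2, ← hx] at m'
  exact m'

end IsAdapted

end Adapted

/-! ### Independence of the relative determinant from the adapted pair. -/

section AdaptedDeterminant

variable {F : Type*} [Field F] {X Y : Type*} [AddCommGroup X] [Module F X]
  [AddCommGroup Y] [Module F Y]

theorem hasFiniteRank_symm_sub_symm {S R : X ≃ₗ[F] Y}
    (h : HasFiniteRank ((S : X →ₗ[F] Y) - (R : X →ₗ[F] Y))) :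
    HasFiniteRank ((S.symm : Y →ₗ[F] X) - (R.symm : Y →ₗ[F] X)) := by
  have h1 : (S.symm : Y →ₗ[F] X) - (R.symm : Y →ₗ[F] X) =
      -((R.symm : Y →ₗ[F] X) ∘ₗ ((S : X →ₗ[F] Y) - (R : X →ₗ[F] Y)) ∘ₗ
        (S.symm : Y →ₗ[F] X)) := by
    ext x
    simp
  rw [h1]
  exact ((h.comp_right _).comp_left _).neg

theorem detClassDet_unipotent_comp_symm {n m : X →ₗ[F] X} (hn : IsNilpotent n)
    (hm : IsNilpotent m) (hnm : HasFiniteRank (m - n)) {e e' : X ≃ₗ[F] X}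
    (he : ∀ x, e x = x + n x) (he' : ∀ x, e' x = x + m x) :
    detClassDet ((e' : X →ₗ[F] X) ∘ₗ (e.symm : X →ₗ[F] X)) = 1 ∧
      HasFiniteRank (LinearMap.id - (e' : X →ₗ[F] X) ∘ₗ (e.symm : X →ₗ[F] X)) := by
  constructor
  · have h1 : (e' : X →ₗ[F] X) ∘ₗ (e.symm : X →ₗ[F] X) = (e : X →ₗ[F] X) ∘ₗ
        ((e.symm : X →ₗ[F] X) ∘ₗ (LinearMap.id + m)) ∘ₗ (e.symm : X →ₗ[F] X) := by
      ext x
      simp [he']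
    rw [h1, detClassDet_conj, detClassDet_unipotent_quotient hn hm hnm he]
  · have h1 : LinearMap.id - (e' : X →ₗ[F] X) ∘ₗ (e.symm : X →ₗ[F] X) =
        -((m - n) ∘ₗ (e.symm : X →ₗ[F] X)) := by
      ext x
      have h2 := he (e.symm x)
      rw [LinearEquiv.apply_symm_apply] at h2
      simp only [LinearMap.sub_apply, LinearMap.id_apply, LinearMap.comp_apply,
        LinearEquiv.coe_coe, LinearMap.neg_apply, he']
      generalize e.symm x = y at h2 ⊢
      rw [h2]
      abel
    rw [h1]
    exact (hnm.comp_right _).neg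

theorem IsAdapted.hasFiniteRank_shift_sub {f f₁ : X →ₗ[F] Y} {g g₁ : Y →ₗ[F] X}
    {S T S₁ T₁ : X ≃ₗ[F] Y} (hf : HasFiniteRank (f₁ - f)) (hg : HasFiniteRank (g₁ - g))
    (hS : HasFiniteRank ((S₁ : X →ₗ[F] Y) - (S : X →ₗ[F] Y)))
    (hT : HasFiniteRank ((T₁ : X →ₗ[F] Y) - (T : X →ₗ[F] Y))) :
    HasFiniteRank (shift f₁ g₁ S₁ T₁ - shift f g S T) := by
  have hS' := hasFiniteRank_symm_sub_symm hS
  have hT' := hasFiniteRank_symm_sub_symm hT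
  have d1 : HasFiniteRank (((T₁ : X →ₗ[F] Y) - (S₁ : X →ₗ[F] Y)) -
      ((T : X →ₗ[F] Y) - (S : X →ₗ[F] Y))) := by
    rw [sub_sub_sub_comm]
    exact hT.sub hS
  have d2 : HasFiniteRank (((S₁.symm : Y →ₗ[F] X) - (T₁.symm : Y →ₗ[F] X)) -
      ((S.symm : Y →ₗ[F] X) - (T.symm : Y →ₗ[F] X))) := by
    rw [sub_sub_sub_comm]
    exact hS'.sub hT'
  have e1 := HasFiniteRank.comp_sub_comp d1 hg
  have e2 := HasFiniteRank.comp_sub_comp hf d2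
  have e3 := HasFiniteRank.comp_sub_comp
    (HasFiniteRank.comp_sub_comp (HasFiniteRank.comp_sub_comp hf hT') hS) hg
  unfold shift
  rw [add_sub_add_comm, add_sub_add_comm]
  exact (e1.add e2).add e3

/-- The determinant of `R⁻¹ S` is the same for all pairs of adapted isomorphisms of finite rank
difference. -/
theorem IsAdapted.detClassDet_eq {f f₁ : X →ₗ[F] Y} {g g₁ : Y →ₗ[F] X}
    (hfg : ∀ y, f (g y) = 0) (hgf : ∀ x, g (f x) = 0)
    (hfg₁ : ∀ y, f₁ (g₁ y) = 0) (hgf₁ : ∀ x, g₁ (f₁ x) = 0)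
    (hf : HasFiniteRank (f₁ - f)) (hg : HasFiniteRank (g₁ - g))
    {l : HomologyAt f g ≃ₗ[F] HomologyAt g f} {l₁ : HomologyAt f₁ g₁ ≃ₗ[F] HomologyAt g₁ f₁}
    {S T S₁ T₁ : X ≃ₗ[F] Y} (hS : IsAdapted f g l S) (hT : IsAdapted f g l T)
    (hS₁ : IsAdapted f₁ g₁ l₁ S₁) (hT₁ : IsAdapted f₁ g₁ l₁ T₁)
    (fS : HasFiniteRank ((S₁ : X →ₗ[F] Y) - (S : X →ₗ[F] Y)))
    (fT : HasFiniteRank ((T₁ : X →ₗ[F] Y) - (T : X →ₗ[F] Y))) :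
    detClassDet ((T₁.symm : Y →ₗ[F] X) ∘ₗ (T : X →ₗ[F] Y)) =
      detClassDet ((S₁.symm : Y →ₗ[F] X) ∘ₗ (S : X →ₗ[F] Y)) := by
  have nb := hS.isNilpotent_shift hfg hT
  have nb₁ := hS₁.isNilpotent_shift hfg₁ hT₁
  have na := hS.symm.isNilpotent_shift hgf hT.symm
  have na₁ := hS₁.symm.isNilpotent_shift hgf₁ hT₁.symm
  obtain ⟨b, hb⟩ := exists_equiv_of_isNilpotent nb
  obtain ⟨b₁, hb₁⟩ := exists_equiv_of_isNilpotent nb₁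
  obtain ⟨a, ha⟩ := exists_equiv_of_isNilpotent na
  obtain ⟨a₁, ha₁⟩ := exists_equiv_of_isNilpotent na₁
  have c : ∀ x, a (T x) = S (b x) := fun x => by
    rw [ha, hb, hS.symm_comp_id_add_shift hfg hgf hT]
  have c₁ : ∀ x, a₁ (T₁ x) = S₁ (b₁ x) := fun x => by
    rw [ha₁, hb₁, hS₁.symm_comp_id_add_shift hfg₁ hgf₁ hT₁]
  have fb := IsAdapted.hasFiniteRank_shift_sub hf hg fS fT
  have fa := IsAdapted.hasFiniteRank_shift_sub hg hf (hasFiniteRank_symm_sub_symm fS)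
    (hasFiniteRank_symm_sub_symm fT)
  obtain ⟨da, ra⟩ := detClassDet_unipotent_comp_symm na na₁ fa ha ha₁
  obtain ⟨db, rb⟩ := detClassDet_unipotent_comp_symm nb₁ nb (hasFiniteRank_sub_comm fb) hb₁ hb
  set α : Y →ₗ[F] Y := (a₁ : Y →ₗ[F] Y) ∘ₗ (a.symm : Y →ₗ[F] Y) with hα
  set β : X →ₗ[F] X := (b : X →ₗ[F] X) ∘ₗ (b₁.symm : X →ₗ[F] X) with hβ
  set γ : X →ₗ[F] X := (S₁.symm : Y →ₗ[F] X) ∘ₗ (S : X →ₗ[F] Y) with hγ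
  have rγ : HasFiniteRank (LinearMap.id - γ) :=
    hasFiniteRank_id_sub_symm_comp (hasFiniteRank_sub_comm fS)
  have dα := detClassDet_conj S₁.symm α
  have rα : HasFiniteRank (LinearMap.id - (S₁.symm : Y →ₗ[F] X) ∘ₗ α ∘ₗ
      (S₁.symm.symm : X →ₗ[F] Y)) := by
    have h : LinearMap.id - (S₁.symm : Y →ₗ[F] X) ∘ₗ α ∘ₗ (S₁.symm.symm : X →ₗ[F] Y) =
        (S₁.symm : Y →ₗ[F] X) ∘ₗ (LinearMap.id - α) ∘ₗ (S₁.symm.symm : X →ₗ[F] Y) := by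
      ext x
      simp
    rw [h]
    exact (ra.comp_right _).comp_left _
  have rγβ : HasFiniteRank (LinearMap.id - γ ∘ₗ β) := by
    have h := HasFiniteRank.comp_sub_comp rb rγ
    rwa [LinearMap.id_comp] at h
  -- From `T = a⁻¹ S b` and `T₁ = a₁⁻¹ S₁ b₁`. Conjugating by `b₁` groups the unipotents into the
  -- quotients `α = a₁ a⁻¹` and `β = b b₁⁻¹`, which differ from the identity by finite rank even if
  -- the factors do not.
  have key : (T₁.symm : Y →ₗ[F] X) ∘ₗ (T : X →ₗ[F] Y) =
      (b₁.symm : X →ₗ[F] X) ∘ₗ (((S₁.symm : Y →ₗ[F] X) ∘ₗ α ∘ₗ (S₁.symm.symm : X →ₗ[F] Y)) ∘ₗ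
        (γ ∘ₗ β)) ∘ₗ (b₁.symm.symm : X →ₗ[F] X) := by
    ext x
    have h := c₁ (T₁.symm (T x))
    rw [LinearEquiv.apply_symm_apply] at h
    simp only [hα, hβ, hγ, LinearMap.comp_apply, LinearEquiv.coe_coe, LinearEquiv.symm_symm,
      LinearEquiv.apply_symm_apply, LinearEquiv.symm_apply_apply, ← c, h]
  rw [key, detClassDet_conj, detClassDet_comp rα rγβ, dα, detClassDet_comp rγ rb, da, db]
  ring

end AdaptedDeterminant

/-! ### Splittings compatible with given subspaces. -/

section Splittings

variable {F : Type*} [Field F] {X Y : Type*} [AddCommGroup X] [Module F X]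
  [AddCommGroup Y] [Module F Y]

/-- Keeps the complement of the cycles inside a prescribed `K`. It will be applied with `K` the
kernel of `E₊` or `E₋`, so that correction terms taken from the complement are killed by these
projections. -/
theorem exists_complement_ker_le (f : X →ₗ[F] Y) (K : Submodule F X)
    (hK : ∀ x, ∃ k ∈ K, f x = f k) :
    ∃ C ≤ K, (∀ c ∈ C, f c = 0 → c = 0) ∧ ∀ x, ∃ c ∈ C, f x = f c := by
  -- By the modular law, `D ⊓ K` complements `Ker f ⊓ K` inside `K`.
  obtain ⟨D, hD⟩ := exists_isCompl (LinearMap.ker f ⊓ K)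
  refine ⟨D ⊓ K, inf_le_right, ?_, ?_⟩
  · intro c hc h0
    exact Submodule.disjoint_def.1 hD.disjoint c ⟨h0, hc.2⟩ hc.1
  · intro x
    obtain ⟨k, hk, hxk⟩ := hK x
    have h : k ∈ LinearMap.ker f ⊓ K ⊔ D := by
      rw [hD.sup_eq_top]
      trivial
    obtain ⟨a, ha, d, hd, rfl⟩ := Submodule.mem_sup.1 h
    refine ⟨d, ⟨hd, ?_⟩, ?_⟩
    · have h1 : d = (a + d) - a := by abel
      rw [h1]
      exact K.sub_mem hk ha.2
    · have h1 : f a = 0 := ha.1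
      rw [hxk, map_add, h1, zero_add]

/-- A splitting of `X ⊕ A → Y ⊕ B` whose harmonic part is `(Φ(V) + Q) ⊕ A`. -/
theorem isHodgeSplitting_prod {A B U : Type*} [AddCommGroup A] [Module F A] [AddCommGroup B]
    [Module F B] [AddCommGroup U] [Module F U] {f : X →ₗ[F] Y} {g : Y →ₗ[F] X} {Φ : U →ₗ[F] X}
    {V : Submodule F U} {Q C : Submodule F X} {E : X →ₗ[F] X}
    (hfΦ : ∀ u, f (Φ u) = 0) (hQ : ∀ q ∈ Q, f q = 0) (hE : ∀ x, E x ∈ Q) (hEQ : ∀ q ∈ Q, E q = q)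
    (hEg : ∀ y, E (g y) = 0) (hEΦ : ∀ u, E (Φ u) = 0)
    (hV : ∀ v ∈ V, ∀ y, Φ v = g y → v = 0) (hV' : ∀ u, ∃ v ∈ V, ∃ y, Φ u = Φ v + g y)
    (hspan : ∀ x, f x = 0 → ∃ y u, x = E x + g y + Φ u)
    (hC : ∀ c ∈ C, f c = 0 → c = 0) (hC' : ∀ x, ∃ c ∈ C, f x = f c) :
    IsHodgeSplitting (f.prodMap (0 : A →ₗ[F] B)) (g.prodMap (0 : B →ₗ[F] A))
      ((V.map Φ ⊔ Q).prod ⊤) (C.prod ⊥) := by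
  refine ⟨?_, ?_, ?_, ?_, ?_⟩
  · rintro ⟨x, a⟩ ⟨hx, -⟩
    obtain ⟨_, ⟨v, hv, rfl⟩, q, hq, h⟩ := Submodule.mem_sup.1 hx
    have h1 : f x = 0 := by
      change _ = x at h
      rw [← h, map_add, hfΦ, hQ q hq, add_zero]
    simp [h1]
  · rintro ⟨y, b⟩ ⟨hx, -⟩
    obtain ⟨_, ⟨v, hv, rfl⟩, q, hq, h⟩ := Submodule.mem_sup.1 hx
    change _ = g y at h
    have h1 : q = 0 := by
      have h2 := congrArg E h
      rwa [map_add, hEΦ, hEQ q hq, hEg, zero_add] at h2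
    rw [h1, add_zero] at h
    have h3 := hV v hv y h
    rw [h3, map_zero] at h
    simp [← h]
  · rintro ⟨x, a⟩ hx
    have hx' : f x = 0 := congrArg Prod.fst hx
    obtain ⟨y, u, h⟩ := hspan x hx'
    obtain ⟨v, hv, y', hy'⟩ := hV' u
    refine ⟨(Φ v + E x, a), ⟨Submodule.add_mem_sup ⟨v, hv, rfl⟩ (hE x), trivial⟩,
      (y + y', 0), ?_⟩
    refine Prod.ext ?_ (by simp)
    change x = Φ v + E x + g (y + y')
    rw [h, hy']
    simp only [map_add, hEg, hEΦ, hEQ _ (hE x)]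
    abel
  · rintro ⟨c, a⟩ ⟨hc, ha⟩ h0
    have ha' : a = 0 := ha
    exact Prod.ext (hC c hc (congrArg Prod.fst h0)) ha'
  · rintro ⟨x, a⟩
    obtain ⟨c, hc, h⟩ := hC' x
    exact ⟨(c, 0), ⟨hc, rfl⟩, by simp [h]⟩

end Splittings

/-! ### The adapted pair for the padded and the perturbed complex. -/

namespace Z2Complex.PertMaps

variable {F : Type*} [Field F] {Xp Xm : Type*} [AddCommGroup Xp] [Module F Xp]
    [AddCommGroup Xm] [Module F Xm] {D : Z2Complex F Xp Xm} {np nm : ℕ} {S : D.PertMaps np nm}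
    {Qp : Submodule F Xp} {Qm : Submodule F Xm}
    {Ep : Xp →ₗ[F] Xp} {Em : Xm →ₗ[F] Xm} {Om : (Fin nm → F) →ₗ[F] (Fin nm → F)}

theorem pad_dp_apply (x : Xp × (Fin np → F)) : (D.pad np nm).dp x = (D.dp x.1, 0) := rfl

theorem pad_dm_apply (x : Xm × (Fin nm → F)) : (D.pad np nm).dm x = (D.dm x.1, 0) := rfl

theorem hat_dp_apply (x : Xp × (Fin np → F)) : S.hat.dp x = (D.dp x.1 + S.Fp x.2, S.Np x.2) := rfl

theorem hat_dm_apply (x : Xm × (Fin nm → F)) : S.hat.dm x = (D.dm x.1 + S.Fm x.2, 0) := rfl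

theorem hasFiniteRank_pad_dp_sub : HasFiniteRank ((D.pad np nm).dp - S.hat.dp) := by
  have h : (D.pad np nm).dp - S.hat.dp =
      (-(S.Fp.prod S.Np)) ∘ₗ LinearMap.snd F Xp (Fin np → F) := by
    apply LinearMap.ext
    intro x
    refine Prod.ext ?_ ?_ <;> simp [pad_dp_apply, hat_dp_apply]
  rw [h]
  exact (HasFiniteRank.of_domain _).comp_right _

theorem hasFiniteRank_pad_dm_sub : HasFiniteRank ((D.pad np nm).dm - S.hat.dm) := by
  have h : (D.pad np nm).dm - S.hat.dm =
      (-(S.Fm.prod (0 : _ →ₗ[F] (Fin np → F)))) ∘ₗ LinearMap.snd F Xm (Fin nm → F) := by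
    apply LinearMap.ext
    intro x
    refine Prod.ext ?_ ?_ <;> simp [pad_dm_apply, hat_dm_apply]
  rw [h]
  exact (HasFiniteRank.of_domain _).comp_right _

namespace IsProjData

theorem Ep_apply_of_mem (h : S.IsProjData Qp Qm Ep Em Om) {q : Xp} (hq : q ∈ Qp) : Ep q = q := by
  rw [← h.range_Ep] at hq
  obtain ⟨x, rfl⟩ := hq
  exact LinearMap.congr_fun h.Ep_idem x

theorem Em_apply_of_mem (h : S.IsProjData Qp Qm Ep Em Om) {q : Xm} (hq : q ∈ Qm) : Em q = q := by
  rw [← h.range_Em] at hq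
  obtain ⟨x, rfl⟩ := hq
  exact LinearMap.congr_fun h.Em_idem x

theorem Ep_mem (h : S.IsProjData Qp Qm Ep Em Om) (x : Xp) : Ep x ∈ Qp := h.range_Ep ▸ ⟨x, rfl⟩

theorem Em_mem (h : S.IsProjData Qp Qm Ep Em Om) (x : Xm) : Em x ∈ Qm := h.range_Em ▸ ⟨x, rfl⟩

theorem Ep_dm (h : S.IsProjData Qp Qm Ep Em Om) (y : Xm) : Ep (D.dm y) = 0 :=
  h.Ep_zero (Submodule.mem_sup_left ⟨y, rfl⟩)

theorem Ep_Fm (h : S.IsProjData Qp Qm Ep Em Om) (u : Fin nm → F) : Ep (S.Fm u) = 0 :=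
  h.Ep_zero (Submodule.mem_sup_right ⟨u, rfl⟩)

theorem Em_dp (h : S.IsProjData Qp Qm Ep Em Om) (x : Xp) : Em (D.dp x) = 0 :=
  h.Em_zero (Submodule.mem_sup_left ⟨x, rfl⟩)

theorem Em_Fp (h : S.IsProjData Qp Qm Ep Em Om) (u : Fin np → F) : Em (S.Fp u) = 0 :=
  h.Em_zero (Submodule.mem_sup_right ⟨u, rfl⟩)

theorem cycle_plus (h : S.IsProjData Qp Qm Ep Em Om) (x : Xp) (hx : D.dp x = 0) :
    ∃ y u, x = Ep x + D.dm y + S.Fm u := by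
  obtain ⟨⟨q, hq⟩, hqx⟩ := h.Qp_bij.2 (Submodule.Quotient.mk ⟨x, hx⟩)
  have h1 : q - x ∈ LinearMap.range D.dm ⊔ LinearMap.range S.Fm := by
    have h1 := (Submodule.Quotient.eq _).1 hqx
    exact h1
  -- The representative `q` of `x` in `Q₊` must be `E₊ x`, because `E₊` kills the difference.
  have h2 : Ep (q - x) = 0 := h.Ep_zero h1
  rw [map_sub, h.Ep_apply_of_mem hq, sub_eq_zero] at h2
  obtain ⟨_, ⟨y, rfl⟩, _, ⟨u, rfl⟩, h3⟩ := Submodule.mem_sup.1 h1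
  refine ⟨-y, -u, ?_⟩
  rw [← h2, map_neg, map_neg, add_assoc, ← neg_add, h3]
  abel

theorem cycle_minus (h : S.IsProjData Qp Qm Ep Em Om) (x : Xm) (hx : D.dm x = 0) :
    ∃ y u, x = Em x + D.dp y + S.Fp u := by
  obtain ⟨⟨q, hq⟩, hqx⟩ := h.Qm_bij.2 (Submodule.Quotient.mk ⟨x, hx⟩)
  have h1 : q - x ∈ LinearMap.range D.dp ⊔ LinearMap.range S.Fp := by
    have h1 := (Submodule.Quotient.eq _).1 hqx
    exact h1
  have h2 : Em (q - x) = 0 := h.Em_zero h1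
  rw [map_sub, h.Em_apply_of_mem hq, sub_eq_zero] at h2
  obtain ⟨_, ⟨y, rfl⟩, _, ⟨u, rfl⟩, h3⟩ := Submodule.mem_sup.1 h1
  refine ⟨-y, -u, ?_⟩
  rw [← h2, map_neg, map_neg, add_assoc, ← neg_add, h3]
  abel

theorem Fm_Om (h : S.IsProjData Qp Qm Ep Em Om) (u : Fin nm → F) : S.Fm (Om u) = 0 := by
  obtain ⟨y, hy⟩ : Om u ∈ LinearMap.range S.Np := h.range_Om ▸ ⟨u, rfl⟩
  rw [← hy]
  exact LinearMap.congr_fun S.Fm_Np y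

end IsProjData

/-- The shear `(x, a) ↦ (x + g a, a)`. -/
def shear {X A : Type*} [AddCommGroup X] [Module F X] [AddCommGroup A] [Module F A]
    (g : A →ₗ[F] X) : (X × A) ≃ₗ[F] (X × A) :=
  LinearEquiv.ofLinearMap (LinearMap.id + LinearMap.inl F X A ∘ₗ g ∘ₗ LinearMap.snd F X A)
    (LinearMap.id - LinearMap.inl F X A ∘ₗ g ∘ₗ LinearMap.snd F X A)
    (by
      apply LinearMap.ext
      intro x
      refine Prod.ext ?_ ?_ <;> simp)
    (by
      apply LinearMap.ext
      intro x
      refine Prod.ext ?_ ?_ <;> simp)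

theorem shear_apply {X A : Type*} [AddCommGroup X] [Module F X] [AddCommGroup A] [Module F A]
    (g : A →ₗ[F] X) (x : X) (a : A) : shear g (x, a) = (x + g a, a) := by
  change (x, a) + (g a, (0 : A)) = _
  simp

theorem shear_symm_apply {X A : Type*} [AddCommGroup X] [Module F X] [AddCommGroup A] [Module F A]
    (g : A →ₗ[F] X) (x : X) (a : A) : (shear g).symm (x, a) = (x - g a, a) := by
  change (x, a) - (g a, (0 : A)) = _
  simp

theorem hasFiniteRank_id_sub_shear {X A : Type*} [AddCommGroup X] [Module F X] [AddCommGroup A]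
    [Module F A] [FiniteDimensional F A] (g : A →ₗ[F] X) :
    HasFiniteRank (LinearMap.id - (shear g : (X × A) →ₗ[F] (X × A))) :=
  hasFiniteRank_id_sub_id_add (((HasFiniteRank.of_domain g).comp_right _).comp_left _)

/-- The off-diagonal block composes to zero with the projection, so the determinant reduces to that
of the identity on `A`. -/
theorem detClassDet_shear {X A : Type*} [AddCommGroup X] [Module F X] [AddCommGroup A]
    [Module F A] [FiniteDimensional F A] (g : A →ₗ[F] X) :
    detClassDet (shear g : (X × A) →ₗ[F] (X × A)) = 1 := by
  have h := detClassDet_id_add_comp (LinearMap.inl F X A ∘ₗ g) (LinearMap.snd F X A)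
  have h1 : LinearMap.id + LinearMap.snd F X A ∘ₗ LinearMap.inl F X A ∘ₗ g = LinearMap.id := by
    ext x
    simp
  rw [h1, LinearMap.det_id] at h
  exact h

theorem shear_symm {X A : Type*} [AddCommGroup X] [Module F X] [AddCommGroup A] [Module F A]
    (g : A →ₗ[F] X) : (shear g).symm = shear (-g) := by
  ext ⟨x, a⟩ : 1
  rw [shear_symm_apply, shear_apply, LinearMap.neg_apply, sub_eq_add_neg]

/-- `R⁻¹ S` has determinant one when `R` is obtained from `S` by shears. -/
theorem detClassDet_shear_conj {X Y A B : Type*} [AddCommGroup X] [Module F X] [AddCommGroup A]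
    [Module F A] [FiniteDimensional F A] [AddCommGroup Y] [Module F Y] [AddCommGroup B]
    [Module F B] [FiniteDimensional F B] (g : A →ₗ[F] X) (h : B →ₗ[F] Y)
    (T : (X × A) ≃ₗ[F] (Y × B)) {R : (X × A) ≃ₗ[F] (Y × B)}
    (hR : R = ((shear g).trans T).trans (shear h)) :
    detClassDet ((R.symm : (Y × B) →ₗ[F] (X × A)) ∘ₗ (T : (X × A) →ₗ[F] (Y × B))) = 1 ∧
      HasFiniteRank ((T : (X × A) →ₗ[F] (Y × B)) - (R : (X × A) →ₗ[F] (Y × B))) := by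
  constructor
  · have h1 : (R.symm : (Y × B) →ₗ[F] (X × A)) ∘ₗ (T : (X × A) →ₗ[F] (Y × B)) =
        (shear (-g) : (X × A) →ₗ[F] (X × A)) ∘ₗ ((T.symm : (Y × B) →ₗ[F] (X × A)) ∘ₗ
          (shear (-h) : (Y × B) →ₗ[F] (Y × B)) ∘ₗ (T.symm.symm : (X × A) →ₗ[F] (Y × B))) := by
      rw [hR, ← shear_symm, ← shear_symm]
      rfl
    have h2 : HasFiniteRank (LinearMap.id - (T.symm : (Y × B) →ₗ[F] (X × A)) ∘ₗ
          (shear (-h) : (Y × B) →ₗ[F] (Y × B)) ∘ₗ (T.symm.symm : (X × A) →ₗ[F] (Y × B))) := by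
      have h3 : LinearMap.id - (T.symm : (Y × B) →ₗ[F] (X × A)) ∘ₗ
          (shear (-h) : (Y × B) →ₗ[F] (Y × B)) ∘ₗ (T.symm.symm : (X × A) →ₗ[F] (Y × B)) =
          (T.symm : (Y × B) →ₗ[F] (X × A)) ∘ₗ (LinearMap.id -
          (shear (-h) : (Y × B) →ₗ[F] (Y × B))) ∘ₗ (T.symm.symm : (X × A) →ₗ[F] (Y × B)) := by
        apply LinearMap.ext
        intro x
        simp
      rw [h3]
      exact ((hasFiniteRank_id_sub_shear _).comp_right _).comp_left _
    rw [h1, detClassDet_comp (hasFiniteRank_id_sub_shear _) h2, detClassDet_conj,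
      detClassDet_shear, detClassDet_shear, one_mul]
  · have h1 : (T : (X × A) →ₗ[F] (Y × B)) - (R : (X × A) →ₗ[F] (Y × B)) =
        (LinearMap.id - (shear h : (Y × B) →ₗ[F] (Y × B))) ∘ₗ (T : (X × A) →ₗ[F] (Y × B)) +
        ((shear h : (Y × B) →ₗ[F] (Y × B)) ∘ₗ (T : (X × A) →ₗ[F] (Y × B))) ∘ₗ
          (LinearMap.id - (shear g : (X × A) →ₗ[F] (X × A))) := by
      apply LinearMap.ext
      intro x
      simp [hR]
    rw [h1]
    exact ((hasFiniteRank_id_sub_shear h).comp_right _).add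
      ((hasFiniteRank_id_sub_shear g).comp_left _)

theorem phiMinus_homologyMk (h : S.IsProjData Qp Qm Ep Em Om) (x : Xm × (Fin nm → F))
    (hx : S.hat.dm x = 0) (hx' : (D.pad np nm).dm (Em x.1, x.2 - Om x.2) = 0) :
    phiMinus h (homologyMk S.hat.dm S.hat.dp x hx) =
      homologyMk (D.pad np nm).dm (D.pad np nm).dp (Em x.1, x.2 - Om x.2) hx' := rfl

/-- Lets the homology condition on `R` be tested after `φ₊`, where condition 4 applies, and gives
finite dimensionality of `H₊` of the perturbed complex. If the image is a boundary, the padding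
component is zero and `E₊ x`, a boundary fixed by `E₊`, is zero; `x` then lies in `Im d₋ + Im F₋`.
-/
theorem phiPlus_injective (h : S.IsProjData Qp Qm Ep Em Om) :
    Function.Injective (phiPlus h) := by
  rw [← LinearMap.ker_eq_bot, LinearMap.ker_eq_bot']
  intro q hq
  obtain ⟨⟨x, l⟩, hx, rfl⟩ := homologyMk_surjective _ _ q
  obtain ⟨⟨y, u⟩, hy⟩ := (Submodule.Quotient.mk_eq_zero _).1 hq
  have h1 : D.dm y = Ep x := congrArg Prod.fst hy
  have h2 : (0 : Fin np → F) = l := congrArg Prod.snd hy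
  subst h2
  have h3 : D.dp x = 0 := by
    have h4 : D.dp x + S.Fp 0 = 0 := congrArg Prod.fst hx
    simpa using h4
  have h4 : Ep x = 0 := by
    rw [← h.Ep_apply_of_mem (h.Ep_mem x), ← h1, h.Ep_dm]
  obtain ⟨y', u', h5⟩ := h.cycle_plus x h3
  refine (Submodule.Quotient.mk_eq_zero _).2 ⟨(y', u'), Prod.ext ?_ rfl⟩
  change D.dm y' + S.Fm u' = x
  rw [h5, h4, zero_add]

/-- Adapted isomorphisms of the padded and of the perturbed complex that differ by shears. -/
theorem exists_adapted_pair
    (L : (D.pad np nm).HPlus ≃ₗ[F] (D.pad np nm).HMinus)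
    (M : S.hat.HMinus ≃ₗ[F] S.hat.HPlus)
    (Vp Zp : Submodule F (Fin np → F)) (Vm : Submodule F (Fin nm → F))
    (hZp : Zp ≤ LinearMap.ker S.Fp)
    (hVW_disj : Disjoint Vp S.Wp) (hVW_span : Vp ⊔ S.Wp = LinearMap.ker S.Np)
    (hVWZ : IsCompl (Vp ⊔ S.Wp) Zp) (hVWm : IsCompl Vm S.Wm)
    (hproj : S.IsProjData Qp Qm Ep Em Om)
    (hL : ∀ vp ∈ Vp, ∀ zp ∈ Zp, ∀ vm ∈ Vm,
      L (S.classPlus vm (vp + zp)) = S.classMinus vp (vm + S.Np zp))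
    (hM : ∀ x : S.hat.HMinus, phiPlus hproj (M x) = L.symm (phiMinus hproj x)) :
    ∃ T R : (Xp × (Fin np → F)) ≃ₗ[F] (Xm × (Fin nm → F)),
      IsAdapted (D.pad np nm).dp (D.pad np nm).dm L T ∧
      IsAdapted S.hat.dp S.hat.dm M.symm R ∧
      detClassDet ((R.symm : _ →ₗ[F] (Xp × (Fin np → F))) ∘ₗ
        (T : _ →ₗ[F] (Xm × (Fin nm → F)))) = 1 ∧
      HasFiniteRank ((T : _ →ₗ[F] (Xm × (Fin nm → F))) -
        (R : (Xp × (Fin np → F)) →ₗ[F] (Xm × (Fin nm → F)))) := by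
  have dpdm : ∀ y, D.dp (D.dm y) = 0 := fun y => LinearMap.congr_fun D.dp_dm y
  have dmdp : ∀ x, D.dm (D.dp x) = 0 := fun x => LinearMap.congr_fun D.dm_dp x
  have dpFm : ∀ u, D.dp (S.Fm u) = 0 := fun u => LinearMap.congr_fun S.dp_Fm u
  have dmFp : ∀ u, D.dm (S.Fp u) = 0 := fun u => LinearMap.congr_fun S.dm_Fp u
  have FmNp : ∀ u, S.Fm (S.Np u) = 0 := fun u => LinearMap.congr_fun S.Fm_Np u
  have NpVp : ∀ v ∈ Vp, S.Np v = 0 := fun v hv => by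
    have h : v ∈ LinearMap.ker S.Np := hVW_span ▸ Submodule.mem_sup_left hv
    exact h
  -- complements of the cycles
  obtain ⟨Cp, hCpE, hCp, hCp'⟩ := exists_complement_ker_le D.dp (LinearMap.ker Ep) fun x =>
    ⟨x - Ep x, by
      rw [LinearMap.mem_ker, map_sub, hproj.Ep_apply_of_mem (hproj.Ep_mem x), sub_self],
      by rw [map_sub, show D.dp (Ep x) = 0 from hproj.Qp_le (hproj.Ep_mem x), sub_zero]⟩
  obtain ⟨Cm, hCmE, hCm, hCm'⟩ := exists_complement_ker_le D.dm (LinearMap.ker Em) fun x =>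
    ⟨x - Em x, by
      rw [LinearMap.mem_ker, map_sub, hproj.Em_apply_of_mem (hproj.Em_mem x), sub_self],
      by rw [map_sub, show D.dm (Em x) = 0 from hproj.Qm_le (hproj.Em_mem x), sub_zero]⟩
  -- the harmonic parts
  have hVm : ∀ v ∈ Vm, ∀ y, S.Fm v = D.dm y → v = 0 := fun v hv y hy =>
    Submodule.disjoint_def.1 hVWm.disjoint v hv ⟨y, hy.symm⟩
  have hVm' : ∀ u, ∃ v ∈ Vm, ∃ y, S.Fm u = S.Fm v + D.dm y := by
    intro u
    have hu : u ∈ Vm ⊔ S.Wm := by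
      rw [hVWm.sup_eq_top]
      trivial
    obtain ⟨v, hv, w, ⟨y, hy⟩, rfl⟩ := Submodule.mem_sup.1 hu
    exact ⟨v, hv, y, by rw [map_add, hy]⟩
  have hVp : ∀ v ∈ Vp, ∀ x, S.Fp v = D.dp x → v = 0 := fun v hv x hx =>
    Submodule.disjoint_def.1 hVW_disj v hv ⟨NpVp v hv, ⟨x, hx.symm⟩⟩
  have hVp' : ∀ u, ∃ v ∈ Vp, ∃ y, S.Fp u = S.Fp v + D.dp y := by
    intro u
    have hu : S.Fp u ∈ (LinearMap.ker S.Np).map S.Fp := by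
      rw [S.map_ker_Np]
      exact ⟨u, rfl⟩
    obtain ⟨u', hu', hu'u⟩ := hu
    rw [← hVW_span] at hu'
    obtain ⟨v, hv, w, ⟨-, ⟨y, hy⟩⟩, rfl⟩ := Submodule.mem_sup.1 hu'
    exact ⟨v, hv, y, by rw [← hu'u, map_add, hy]⟩
  have sp : IsHodgeSplitting (D.pad np nm).dp (D.pad np nm).dm ((Vm.map S.Fm ⊔ Qp).prod ⊤)
      (Cp.prod ⊥) :=
    isHodgeSplitting_prod dpFm (fun q hq => hproj.Qp_le hq) hproj.Ep_mem
      (fun q hq => hproj.Ep_apply_of_mem hq) hproj.Ep_dm hproj.Ep_Fm hVm hVm' hproj.cycle_plus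
      hCp hCp'
  have sm : IsHodgeSplitting (D.pad np nm).dm (D.pad np nm).dp ((Vp.map S.Fp ⊔ Qm).prod ⊤)
      (Cm.prod ⊥) :=
    isHodgeSplitting_prod dmFp (fun q hq => hproj.Qm_le hq) hproj.Em_mem
      (fun q hq => hproj.Em_apply_of_mem hq) hproj.Em_dp hproj.Em_Fp hVp hVp' hproj.cycle_minus
      hCm hCm'
  obtain ⟨T, hT, hT1, hT2, hT3⟩ := sp.exists_isAdapted sm
    (fun y => LinearMap.congr_fun (D.pad np nm).dp_dm y)
    (fun y => LinearMap.congr_fun (D.pad np nm).dm_dp y) L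
  -- values of `T`
  have Tc : ∀ c ∈ Cp, T (c, 0) = (D.dp c, 0) := fun c hc => hT1 (c, 0) ⟨hc, rfl⟩
  have Td : ∀ c ∈ Cm, T (D.dm c, 0) = (c, 0) := fun c hc => hT2 (c, 0) ⟨hc, rfl⟩
  -- On harmonic vectors `T` is determined by `L`: both `T x` and `y` are harmonic, and a class has
  -- only one harmonic representative.
  have Th : ∀ x (hx : x ∈ (Vm.map S.Fm ⊔ Qp).prod ⊤) y (hy : y ∈ (Vp.map S.Fp ⊔ Qm).prod ⊤),
      L (homologyMk _ _ x (sp.harmonic x hx)) = homologyMk _ _ y (sm.harmonic y hy) →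
      T x = y := by
    intro x hx y hy hxy
    have h1 := hT.homology x (sp.harmonic x hx) (sm.harmonic _ (hT3 x hx))
    rw [hxy, homologyMk_eq_iff] at h1
    obtain ⟨z, hz⟩ := h1
    have h2 := sm.disjoint z (hz ▸ Submodule.sub_mem _ (hT3 x hx) hy)
    rw [h2] at hz
    exact sub_eq_zero.1 hz.symm
  have Tv : ∀ vm ∈ Vm, ∀ vp ∈ Vp, ∀ zp ∈ Zp,
      T (S.Fm vm, vp + zp) = (S.Fp vp, vm + S.Np zp) := fun vm hvm vp hvp zp hzp =>
    Th _ ⟨Submodule.mem_sup_left ⟨vm, hvm, rfl⟩, trivial⟩ _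
      ⟨Submodule.mem_sup_left ⟨vp, hvp, rfl⟩, trivial⟩ (hL vp hvp zp hzp vm hvm)
  -- the shears
  let gp : (Fin np → F) →ₗ[F] Xp := LinearMap.fst F Xp (Fin np → F) ∘ₗ
    (T.symm : _ →ₗ[F] (Xp × (Fin np → F))) ∘ₗ LinearMap.inl F Xm (Fin nm → F) ∘ₗ S.Fp
  let gm : (Fin nm → F) →ₗ[F] Xm := LinearMap.fst F Xm (Fin nm → F) ∘ₗ
    (T : _ →ₗ[F] (Xm × (Fin nm → F))) ∘ₗ LinearMap.inl F Xp (Fin np → F) ∘ₗ S.Fm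
  have gp_v : ∀ v ∈ Vp, gp v = 0 := by
    intro v hv
    have h := Tv 0 Vm.zero_mem v hv 0 Zp.zero_mem
    rw [map_zero, map_zero, add_zero, add_zero] at h
    change (T.symm (S.Fp v, 0)).1 = 0
    rw [← h, LinearEquiv.symm_apply_apply]
  have gp_z : ∀ z ∈ Zp, gp z = 0 := by
    intro z hz
    have h : S.Fp z = 0 := hZp hz
    change (T.symm (S.Fp z, 0)).1 = 0
    rw [h, Prod.mk_zero_zero, map_zero]
    rfl
  have gp_w : ∀ w ∈ S.Wp, gp w ∈ Cp ∧ D.dp (gp w) = S.Fp w := by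
    rintro w ⟨-, x, hx⟩
    obtain ⟨c, hc, hxc⟩ := hCp' x
    have h : gp w = c := by
      change (T.symm (S.Fp w, 0)).1 = c
      rw [← hx, hxc, ← Tc c hc, LinearEquiv.symm_apply_apply]
    rw [h]
    exact ⟨hc, by rw [← hxc, hx]⟩
  have gm_v : ∀ v ∈ Vm, gm v = 0 := by
    intro v hv
    have h := Tv v hv 0 Vp.zero_mem 0 Zp.zero_mem
    rw [map_zero, map_zero, add_zero, add_zero] at h
    change (T (S.Fm v, 0)).1 = 0
    rw [h]
  have gm_z : ∀ z, gm (S.Np z) = 0 := by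
    intro z
    change (T (S.Fm (S.Np z), 0)).1 = 0
    rw [FmNp, Prod.mk_zero_zero, map_zero]
    rfl
  have gm_w : ∀ w ∈ S.Wm, gm w ∈ Cm ∧ D.dm (gm w) = S.Fm w := by
    rintro w ⟨x, hx⟩
    obtain ⟨c, hc, hxc⟩ := hCm' x
    have h : gm w = c := by
      change (T (S.Fm w, 0)).1 = c
      rw [← hx, hxc, Td c hc]
    rw [h]
    exact ⟨hc, by rw [← hxc, hx]⟩
  -- Condition 4 enters here. The cycle `(q - gp w, w)` of the perturbed complex has class `M [y,
  -- u]` for some `(y, u)`; as `E₊` kills `gp w`, applying `φ₊` gives `L [q, w] = [E₋ y, (1 - Ω₋)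
  -- u]`.
  have Tq : ∀ q ∈ Qp, ∀ w ∈ S.Wp, ∃ q' ∈ Qm, ∃ w' ∈ S.Wm, Om w' = 0 ∧ T (q, w) = (q', w') := by
    intro q hq w hw
    have hqw : S.hat.dp (q - gp w, w) = 0 := by
      have h1 : D.dp q = 0 := hproj.Qp_le hq
      have h2 : S.Np w = 0 := hw.1
      rw [hat_dp_apply]
      simp [h1, h2, (gp_w w hw).2]
    obtain ⟨x₀, hx₀⟩ := M.surjective (homologyMk S.hat.dp S.hat.dm (q - gp w, w) hqw)
    obtain ⟨⟨y, u⟩, hy, rfl⟩ := homologyMk_surjective _ _ x₀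
    have h3 := hM (homologyMk S.hat.dm S.hat.dp (y, u) hy)
    have huW : u ∈ S.Wm := by
      have h4 : D.dm y + S.Fm u = 0 := congrArg Prod.fst hy
      exact ⟨-y, by rw [map_neg, neg_eq_of_add_eq_zero_right h4]⟩
    have hwW : u - Om u ∈ S.Wm :=
      S.Wm.sub_mem huW ⟨0, by rw [map_zero, hproj.Fm_Om]⟩
    refine ⟨Em y, hproj.Em_mem y, u - Om u, hwW, ?_, ?_⟩
    · have h4 : Om (Om u) = Om u := LinearMap.congr_fun hproj.Om_idem u
      rw [map_sub, h4, sub_self]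
    · have mx : ((q, w) : Xp × (Fin np → F)) ∈ (Vm.map S.Fm ⊔ Qp).prod ⊤ :=
        ⟨Submodule.mem_sup_right hq, trivial⟩
      have my : ((Em y, u - Om u) : Xm × (Fin nm → F)) ∈ (Vp.map S.Fp ⊔ Qm).prod ⊤ :=
        ⟨Submodule.mem_sup_right (hproj.Em_mem y), trivial⟩
      refine Th _ mx _ my ?_
      rw [← LinearEquiv.eq_symm_apply]
      rw [hx₀, phiMinus_homologyMk hproj (y, u) hy (sm.harmonic _ my)] at h3
      rw [← h3]
      change homologyMk _ _ (q, w) _ = homologyMk _ _ (Ep (q - gp w), w) _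
      congr 2
      have h5 : Ep (gp w) = 0 := hCpE (gp_w w hw).1
      rw [map_sub, h5, sub_zero, hproj.Ep_apply_of_mem hq]
  -- The first shear turns a cycle `(x, l)` of the perturbed complex into a cycle `x + gp l` of
  -- `d₊`; the second makes the analogous correction in the target.
  let R : (Xp × (Fin np → F)) ≃ₗ[F] (Xm × (Fin nm → F)) :=
    ((shear gp).trans T).trans (shear (-gm))
  have hR : ∀ x l y u, T (x + gp l, l) = (y, u) → R (x, l) = (y - gm u, u) := by
    intro x l y u h
    change shear (-gm) (T (shear gp (x, l))) = _
    have h0 : shear gp (x, l) = (x + gp l, l) := shear_apply gp x l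
    rw [h0, h, shear_apply, LinearMap.neg_apply, sub_eq_add_neg]
  obtain ⟨hdet, hfin⟩ := detClassDet_shear_conj gp (-gm) T (R := R) rfl
  refine ⟨T, R, hT, ⟨?_, ?_, ?_⟩, hdet, hfin⟩
  · rintro ⟨y, u⟩
    obtain ⟨v, hv, y', hy'⟩ := hVm' u
    obtain ⟨c, hc, hyc⟩ := hCm' (y + y')
    -- Every boundary comes from some `(c, v)` with `c ∈ Cm` and `v ∈ V₋`, where `T` is explicit and
    -- `gm` vanishes on `v`.
    have h1 : S.hat.dm (y, u) = (D.dm c + S.Fm v, 0) := by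
      refine Prod.ext ?_ rfl
      change D.dm y + S.Fm u = D.dm c + S.Fm v
      rw [hy', ← hyc, map_add]
      abel
    have h2 : T (D.dm c + S.Fm v + gp 0, 0) = (c, v) := by
      have e1 := Tv v hv 0 Vp.zero_mem 0 Zp.zero_mem
      have e2 := congrArg₂ (· + ·) (Td c hc) e1
      simpa [← map_add] using e2
    have h3 := hR _ _ _ _ h2
    rw [h1, h3, gm_v v hv, sub_zero]
    rfl
  · rintro ⟨x, l⟩
    have hl : l ∈ Vp ⊔ S.Wp ⊔ Zp := by
      rw [hVWZ.sup_eq_top]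
      trivial
    obtain ⟨_, hvw, z, hz, rfl⟩ := Submodule.mem_sup.1 hl
    obtain ⟨v, hv, w, hw, rfl⟩ := Submodule.mem_sup.1 hvw
    obtain ⟨c, hc, hxc⟩ := hCp' (x + gp w)
    have hwN : S.Np w = 0 := hw.1
    have hzF : S.Fp z = 0 := hZp hz
    -- The `W₊` component is absorbed into `c` through `gp w`, leaving the boundary of `(c, v + z)`,
    -- on which both shears are trivial.
    have h1 : S.hat.dp (x, v + w + z) = (D.dp c + S.Fp v, S.Np z) := by
      rw [hat_dp_apply]
      refine Prod.ext ?_ ?_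
      · simp only [map_add, hzF, ← hxc, (gp_w w hw).2]
        abel
      · simp [hwN, NpVp v hv]
    have h2 : T (c + gp (v + z), v + z) = (D.dp c + S.Fp v, S.Np z) := by
      have e1 := Tv 0 Vm.zero_mem v hv z hz
      have e2 := congrArg₂ (· + ·) (Tc c hc) e1
      have h0 : gp (v + z) = 0 := by rw [map_add, gp_v v hv, gp_z z hz, add_zero]
      rw [h0, add_zero]
      simpa [← map_add] using e2
    have h3 := hR _ _ _ _ h2
    rw [gm_z, sub_zero] at h3
    rw [h1, ← h3, LinearEquiv.symm_apply_apply, h3, hat_dp_apply]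
    refine Prod.ext ?_ ?_
    · simp [hzF]
    · simp [NpVp v hv]
  · rintro ⟨x, l⟩ hx hRx
    have hx1 : D.dp x + S.Fp l = 0 := congrArg Prod.fst hx
    have hx2 : S.Np l = 0 := congrArg Prod.snd hx
    have hlW : l ∈ S.Wp :=
      ⟨hx2, -x, by rw [map_neg, neg_eq_of_add_eq_zero_right hx1]⟩
    obtain ⟨y₀, u, hxu⟩ := hproj.cycle_plus (x + gp l) (by rw [map_add, (gp_w l hlW).2, hx1])
    obtain ⟨v, hv, y', hy'⟩ := hVm' u
    obtain ⟨c, hc, hyc⟩ := hCm' (y₀ + y')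
    obtain ⟨q', hq', w', hw', hOm, hTq⟩ := Tq (Ep (x + gp l)) (hproj.Ep_mem _) l hlW
    have hxq : x + gp l = Ep (x + gp l) + D.dm c + S.Fm v := by
      rw [← hyc, map_add D.dm]
      conv_lhs => rw [hxu, hy']
      abel
    have h1 : T (x + gp l, l) = (q' + c, w' + v) := by
      have e1 := Tv v hv 0 Vp.zero_mem 0 Zp.zero_mem
      have e2 := congrArg₂ (· + ·) (congrArg₂ (· + ·) hTq (Td c hc)) e1
      rw [hxq]
      simpa [← map_add] using e2
    have h2 := hR _ _ _ _ h1
    -- The hypothesis that `R (x, l)` is a cycle: the `w'` contribution cancels against `d₋ (gm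
    -- w')`. Disjointness then gives `v = 0` and `c = 0`, so the sheared vector is harmonic.
    have h3 : D.dm c + S.Fm v = 0 := by
      rw [h2] at hRx
      have h4 : D.dm (q' + c - gm (w' + v)) + S.Fm (w' + v) = 0 := congrArg Prod.fst hRx
      have h5 : D.dm q' = 0 := hproj.Qm_le hq'
      have h0 : gm (w' + v) = gm w' := by rw [map_add, gm_v v hv, add_zero]
      rw [h0, map_sub, map_add, map_add, h5, (gm_w w' hw').2, zero_add] at h4
      rw [← h4]
      abel
    have hv0 : v = 0 := hVm v hv (-c) (by
      rw [map_neg, neg_eq_of_add_eq_zero_right h3])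
    have hc0 : c = 0 := by
      rw [hv0, map_zero, add_zero] at h3
      exact hCm c hc h3
    subst hv0 hc0
    have h6 : R (x, l) = (q' - gm w', w') := by
      rw [h2, add_zero, add_zero]
    have h7 : Ep x = Ep (x + gp l) := by
      have h8 : Ep (gp l) = 0 := hCpE (gp_w l hlW).1
      rw [map_add, h8, add_zero]
    rw [LinearEquiv.eq_symm_apply]
    apply phiPlus_injective hproj
    rw [hM]
    have mx : ((Ep (x + gp l), l) : Xp × (Fin np → F)) ∈ (Vm.map S.Fm ⊔ Qp).prod ⊤ :=
      ⟨Submodule.mem_sup_right (hproj.Ep_mem _), trivial⟩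
    have my : ((q', w') : Xm × (Fin nm → F)) ∈ (Vp.map S.Fp ⊔ Qm).prod ⊤ :=
      ⟨Submodule.mem_sup_right hq', trivial⟩
    have h9 := hT.homology _ (sp.harmonic _ mx) (by rw [hTq]; exact sm.harmonic _ my)
    rw [LinearEquiv.symm_apply_eq]
    have e1 : phiPlus hproj (homologyMk S.hat.dp S.hat.dm (x, l) hx) =
        homologyMk (D.pad np nm).dp (D.pad np nm).dm (Ep (x + gp l), l) (sp.harmonic _ mx) := by
      change homologyMk _ _ (Ep x, l) _ = _
      congr 2
    have e2 : phiMinus hproj (homologyMk S.hat.dm S.hat.dp (R (x, l)) hRx) =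
        homologyMk (D.pad np nm).dm (D.pad np nm).dp (T (Ep (x + gp l), l))
          (by rw [hTq]; exact sm.harmonic _ my) := by
      change homologyMk _ _ (Em (R (x, l)).1, (R (x, l)).2 - Om (R (x, l)).2) _ = _
      congr 1
      have h10 : Em (gm w') = 0 := hCmE (gm_w w' hw').1
      rw [hTq, h6, map_sub, h10, sub_zero, hproj.Em_apply_of_mem hq', hOm, sub_zero]
    rw [e1, e2]
    exact h9

end Z2Complex.PertMaps

/-! ### Existence for operators. -/

section Existence

variable {F : Type*} [Field F] {V W : Type*} [AddCommGroup V] [Module F V]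
  [AddCommGroup W] [Module F W]

theorem isPseudoInverse_of_symm {A : V →ₗ[F] W} {S : V ≃ₗ[F] W}
    (hS : ∀ x, A (S.symm (A x)) = A x) :
    IsPseudoInverse A ((S.symm : W →ₗ[F] V) ∘ₗ A ∘ₗ (S.symm : W →ₗ[F] V)) :=
  ⟨LinearMap.ext fun x => by simp [hS], LinearMap.ext fun x => by simp [hS]⟩

theorem kerToCokerOf_bijective {A : V →ₗ[F] W} {S : V ≃ₗ[F] W}
    (hS : ∀ x, A (S.symm (A x)) = A x) : Function.Bijective (kerToCokerOf A S) := by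
  constructor
  · rw [← LinearMap.ker_eq_bot, LinearMap.ker_eq_bot']
    rintro ⟨k, hk⟩ h0
    obtain ⟨x, hx⟩ := (Submodule.Quotient.mk_eq_zero _).1 h0
    have hk' : A k = 0 := hk
    have hx' : A x = S k := hx
    have h1 := hS x
    rw [hx', LinearEquiv.symm_apply_apply, hk'] at h1
    exact Subtype.ext (S.map_eq_zero_iff.1 h1.symm)
  · intro z
    obtain ⟨y, rfl⟩ := Submodule.mkQ_surjective _ z
    refine ⟨⟨S.symm y - S.symm (A (S.symm y)), ?_⟩,
      (Submodule.Quotient.eq _).2 ⟨-S.symm y, ?_⟩⟩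
    · rw [LinearMap.mem_ker, map_sub, hS, sub_self]
    · simp

theorem isInvertibleExtension_kerProj {A : V →ₗ[F] W} {S : V ≃ₗ[F] W}
    (hS : ∀ x, A (S.symm (A x)) = A x) :
    IsInvertibleExtension A S (isPseudoInverse_of_symm hS).kerProj := by
  refine ⟨(isPseudoInverse_of_symm hS).kerProj_ker, fun x => ?_⟩
  rw [IsPseudoInverse.kerProj_apply_coe]
  simp [hS]

theorem mem_detLine_of_eq_bot {p : Submodule F V} (h : p = ⊥) (s : DetLine F p) :
    ∃ c : F, (s : ExteriorAlgebra F p) = algebraMap F _ c := by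
  subst h
  obtain ⟨s, hs⟩ := s
  unfold DetLine at hs
  rw [finrank_bot] at hs
  change s ∈ LinearMap.range (ExteriorAlgebra.ι F) ^ 0 at hs
  rw [pow_zero] at hs
  obtain ⟨c, hc⟩ := Submodule.mem_one.1 hs
  exact ⟨c, hc.symm⟩

theorem finrank_tmul_dual {Λ Λ' : Type*} [AddCommGroup Λ] [Module F Λ] [AddCommGroup Λ']
    [Module F Λ'] (h : Module.finrank F Λ = 1) (h' : Module.finrank F Λ' = 1) :
    Module.finrank F (Λ ⊗[F] Module.Dual F Λ') = 1 := by
  rw [Module.finrank_tensorProduct, Subspace.dual_finrank_eq, h, h']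

theorem exists_ne_zero_of_finrank_eq_one {Λ : Type*} [AddCommGroup Λ] [Module F Λ]
    (h : Module.finrank F Λ = 1) : ∃ x : Λ, x ≠ 0 := by
  have : Nontrivial Λ := Module.nontrivial_of_finrank_pos (R := F) (by omega)
  exact exists_ne 0

/-- Take `L` and `M` to be restrictions of `S` and `R⁻¹`, and `N = 0`; then `Σ = R⁻¹ S` has
determinant one. Source and target are lines, so an isomorphism matching one pair of nonzero vectors
exists; since `s ⊗ (S s)^*` does not depend on `s`, it satisfies the formula for all vectors. -/
theorem exists_isOpPertIso {A B : V →ₗ[F] W} {S R : V ≃ₗ[F] W}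
    (hS : ∀ x, A (S.symm (A x)) = A x) (hR : ∀ x, B (R.symm (B x)) = B x)
    (fA : IsFredholmOp A) (fB : IsFredholmOp B) (hAB : HasFiniteRank (A - B))
    (hdet : detClassDet ((R.symm : W →ₗ[F] V) ∘ₗ (S : V →ₗ[F] W)) = 1) :
    ∃ P : OpDet A ≃ₗ[F] OpDet B, IsOpPertIso A B P := by
  obtain ⟨fkA, fcA⟩ := id fA
  obtain ⟨fkB, fcB⟩ := id fB
  let hA' := isPseudoInverse_of_symm hS
  let hB' := isPseudoInverse_of_symm hR
  let eA := LinearEquiv.ofBijective _ (kerToCokerOf_bijective hS)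
  let eB := LinearEquiv.ofBijective _ (kerToCokerOf_bijective hR)
  let eB' := LinearEquiv.ofBijective _ hB'.kerToCoker_bijective
  have iB := bijective_of_index_zero hB' eB.finrank_eq
  have lA : Module.finrank F (DetLine F (LinearMap.ker A)) = 1 := finrank_detLine
  have lB : Module.finrank F (DetLine F (LinearMap.ker B)) = 1 := finrank_detLine
  have lA' : Module.finrank F (DetLine F (Coker A)) = 1 := finrank_detLine
  have lB' : Module.finrank F (DetLine F (Coker B)) = 1 := finrank_detLine
  obtain ⟨s', hs'⟩ := exists_ne_zero_of_finrank_eq_one lA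
  obtain ⟨u', hu'⟩ := exists_ne_zero_of_finrank_eq_one lB
  obtain ⟨φ', hφ'⟩ := exists_dual_apply_eq_one (F := F) ((detEquiv eA).map_ne_zero_iff.2 hs')
  obtain ⟨ψ', hψ'⟩ := exists_dual_apply_eq_one (F := F) ((detEquiv eB).map_ne_zero_iff.2 hu')
  have hφ0 : φ' ≠ 0 := by
    rintro rfl
    simp at hφ'
  have hψ0 : ψ' ≠ 0 := by
    rintro rfl
    simp at hψ'
  obtain ⟨P, hP⟩ := exists_equiv_apply_eq (F := F) (finrank_tmul_dual lA lA')
    (finrank_tmul_dual lB lB') (tmul_ne_zero_of_dual (F := F) hs' hφ0)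
    (tmul_ne_zero_of_dual (F := F) hu' hψ0)
  let L : LinearMap.ker A →ₗ[F] W := (S : V →ₗ[F] W) ∘ₗ (LinearMap.ker A).subtype
  let M : LinearMap.ker ((R.symm : W →ₗ[F] V) ∘ₗ B ∘ₗ (R.symm : W →ₗ[F] V)) →ₗ[F] V :=
    (R.symm : W →ₗ[F] V) ∘ₗ Submodule.subtype _
  have hM : ∀ k, B (M k) = 0 := fun k => R.symm.map_eq_zero_iff.1 k.2
  let M₀ := M.codRestrict (LinearMap.ker B) hM
  have hM₀ : kerToCoker B ((R.symm : W →ₗ[F] V) ∘ₗ B ∘ₗ (R.symm : W →ₗ[F] V)) ∘ₗ M₀ =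
      (LinearMap.range ((R.symm : W →ₗ[F] V) ∘ₗ B ∘ₗ (R.symm : W →ₗ[F] V))).mkQ ∘ₗ M := rfl
  have hLinj : LinearMap.ker L = ⊥ :=
    LinearMap.ker_eq_bot.2 (S.injective.comp Subtype.val_injective)
  have eqS : A + L ∘ₗ hA'.kerProj = S := by
    ext x
    exact ((isInvertibleExtension_kerProj hS).apply x).symm
  have eqR : ((R.symm : W →ₗ[F] V) ∘ₗ B ∘ₗ (R.symm : W →ₗ[F] V)) + M ∘ₗ hB'.symm.kerProj =
      R.symm := by
    ext y
    change R.symm (B (R.symm y)) + R.symm (y - B (R.symm (B (R.symm y)))) = R.symm y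
    rw [hR, map_sub]
    abel
  refine ⟨P, fA, fB, hAB, _, _, hA', hB', Or.inr ⟨L, M, 0, ?_⟩⟩
  refine ⟨?_, ?_, ?_, ?_, ?_, ?_⟩
  · unfold opIndex
    rw [eA.finrank_eq, sub_self]
  · exact (kerToCokerOf_bijective hS).2
  · rw [← hM₀]
    exact hB'.kerToCoker_bijective.1.comp fun x y hxy =>
      Subtype.ext (R.symm.injective (congrArg Subtype.val hxy))
  · constructor
    · intro x y _
      have hx := (Submodule.mem_bot F).1 (hLinj.le x.2)
      have hy := (Submodule.mem_bot F).1 (hLinj.le y.2)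
      exact Subtype.ext (hx.trans hy.symm)
    · intro z
      obtain ⟨y, rfl⟩ := Submodule.mkQ_surjective _ z
      refine ⟨0, ?_⟩
      rw [map_zero, eq_comm, Submodule.mkQ_apply, Submodule.Quotient.mk_eq_zero]
      have h := LinearMap.congr_fun eqR (R y)
      have h1 : y = R.symm (R y) := by simp
      rw [h1]
      change _ = R.symm (R y) at h
      rw [← h]
      exact Submodule.add_mem _ (Submodule.mem_sup_right ⟨_, rfl⟩)
        (Submodule.mem_sup_left ⟨_, rfl⟩)
  · exact ⟨⊤, by rw [hLinj]; exact isCompl_bot_top, by rw [LinearMap.ker_zero]⟩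
  · intro s₀ s₁ t s a u b φ ψ hs ha hu hb hφ hψ
    rw [LinearMap.zero_comp, add_zero, eqS, eqR, hdet, inv_one, one_smul]
    -- `Ker L` is zero, so `s₀` is a scalar, and it multiplies both `s` and `u`. It may be zero, so
    -- the remaining vectors `s₂`, `u₂` are compared first.
    obtain ⟨c, hc⟩ := mem_detLine_of_eq_bot hLinj s₀
    have hk0 : Module.finrank F (LinearMap.ker (0 : LinearMap.ker A →ₗ[F] V)) =
        Module.finrank F (LinearMap.ker A) := by
      rw [LinearMap.ker_zero, finrank_top]
    let s₂ : DetLine F (LinearMap.ker A) :=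
      ⟨_, exteriorAlgebra_map_mem_detLine (Submodule.subtype _) hk0 s₁.2⟩
    let u₂ : DetLine F (LinearMap.ker B) := ⟨_, exteriorAlgebra_map_mem_detLine M₀ iB.1 t.2⟩
    have es : s = c • s₂ := by
      apply Subtype.ext
      rw [hs, hc, AlgHom.commutes, ← Algebra.smul_def]
      rfl
    have eu : u = c • u₂ := by
      apply (detEquiv eB').injective
      apply Subtype.ext
      change ExteriorAlgebra.map (kerToCoker B _) (u : ExteriorAlgebra F (LinearMap.ker B)) =
        ExteriorAlgebra.map (kerToCoker B _) (c • ExteriorAlgebra.map M₀ _)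
      rw [hu, hc, AlgHom.commutes, ← Algebra.smul_def, map_smul, exteriorAlgebra_map_map, hM₀]
    have ea : detMap eA s₂ = a := by
      apply Subtype.ext
      rw [ha, coe_detMap, exteriorAlgebra_map_map]
      rfl
    have eb : detMap eB u₂ = b := by
      apply Subtype.ext
      rw [hb, coe_detMap, exteriorAlgebra_map_map]
      congr 2
      ext k
      change (LinearMap.range B).mkQ (R (R.symm k)) = (LinearMap.range B).mkQ k
      rw [LinearEquiv.apply_symm_apply]
    have h1 : s₂ ⊗ₜ[F] φ = s' ⊗ₜ[F] φ' :=
      tmul_dualVector_eq lA lA' (detMap eA) (by rw [ea]; exact hφ) hφ'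
    have h2 : u₂ ⊗ₜ[F] ψ = u' ⊗ₜ[F] ψ' :=
      tmul_dualVector_eq lB lB' (detMap eB) (by rw [eb]; exact hψ) hψ'
    rw [es, eu, ← TensorProduct.smul_tmul', ← TensorProduct.smul_tmul', map_smul, h1, h2, hP]

end Existence

/-! ### Perturbation isomorphisms of complexes. -/

theorem homologyMap_injective {F : Type*} [Field F] {X Y Z X₁ Y₁ Z₁ : Type*}
    [AddCommGroup X] [Module F X] [AddCommGroup Y] [Module F Y] [AddCommGroup Z] [Module F Z]
    [AddCommGroup X₁] [Module F X₁] [AddCommGroup Y₁] [Module F Y₁] [AddCommGroup Z₁] [Module F Z₁]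
    {f : X →ₗ[F] Y} {g : Z →ₗ[F] X} {f₁ : X₁ →ₗ[F] Y₁} {g₁ : Z₁ →ₗ[F] X₁} {φ : X →ₗ[F] X₁}
    (hcyc : ∀ x, f x = 0 → f₁ (φ x) = 0) (hbd : ∀ z, φ (g z) ∈ LinearMap.range g₁)
    (h : ∀ x, φ x ∈ LinearMap.range g₁ → x ∈ LinearMap.range g) :
    Function.Injective (homologyMap f g f₁ g₁ φ hcyc hbd) := by
  rw [← LinearMap.ker_eq_bot, LinearMap.ker_eq_bot']
  intro q hq
  obtain ⟨⟨x, hx⟩, rfl⟩ := Submodule.Quotient.mk_surjective _ q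
  obtain ⟨z, hz⟩ := (Submodule.Quotient.eq _ (x := φ.restrict hcyc ⟨x, hx⟩) (y := 0)).1 hq
  exact (Submodule.Quotient.mk_eq_zero _).2 (h x ⟨z, hz.trans (sub_zero _)⟩)

theorem map_detMap_tmul {F : Type*} [Field F] {X Y Z W : Type*}
    [AddCommGroup X] [Module F X] [AddCommGroup Y] [Module F Y] [AddCommGroup Z] [Module F Z]
    [AddCommGroup W] [Module F W] (e : X ≃ₗ[F] Y) (c : Z ≃ₗ[F] W) (a : DetLine F Y)
    (χ : Module.Dual F (DetLine F Z)) :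
    TensorProduct.map (detMap e) (detMap c).dualMap
      (detMap e.symm a ⊗ₜ[F] (χ ∘ₗ detMap c.symm)) = a ⊗ₜ[F] χ := by
  have h : (detMap c).dualMap (χ ∘ₗ detMap c.symm) = χ := by
    refine LinearMap.ext fun x => ?_
    rw [LinearMap.dualMap_apply, LinearMap.comp_apply, detMap_detMap, LinearEquiv.self_trans_symm,
      detMap_refl]
  rw [TensorProduct.map_tmul, detMap_detMap, LinearEquiv.symm_trans_self, detMap_refl, h]

namespace Z2Complex

variable {F : Type*} [Field F] {X Y : Type*} [AddCommGroup X] [Module F X]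
  [AddCommGroup Y] [Module F Y] {D E : Z2Complex F X Y}

theorem dm_dp_apply (D : Z2Complex F X Y) (x : X) : D.dm (D.dp x) = 0 :=
  LinearMap.congr_fun D.dm_dp x

theorem dp_dm_apply (D : Z2Complex F X Y) (y : Y) : D.dp (D.dm y) = 0 :=
  LinearMap.congr_fun D.dp_dm y

/-- The complex with differentials `S⁻¹ d₊ S⁻¹` and `S d₋ S`; it consists of pseudo-inverses when
`S` is adapted to `D`. -/
def inverseOf (D : Z2Complex F X Y) (S : X ≃ₗ[F] Y) : Z2Complex F Y X where
  dp := (S.symm : Y →ₗ[F] X) ∘ₗ D.dp ∘ₗ (S.symm : Y →ₗ[F] X)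
  dm := (S : X →ₗ[F] Y) ∘ₗ D.dm ∘ₗ (S : X →ₗ[F] Y)
  dm_dp := by
    ext x
    simp [D.dm_dp_apply]
  dp_dm := by
    ext x
    simp [D.dp_dm_apply]

theorem inverseOf_dp_apply (D : Z2Complex F X Y) (S : X ≃ₗ[F] Y) (y : Y) :
    (D.inverseOf S).dp y = S.symm (D.dp (S.symm y)) := rfl

theorem inverseOf_dm_apply (D : Z2Complex F X Y) (S : X ≃ₗ[F] Y) (x : X) :
    (D.inverseOf S).dm x = S (D.dm (S x)) := rfl

theorem isPinv_inverseOf {l : D.HPlus ≃ₗ[F] D.HMinus} {S : X ≃ₗ[F] Y}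
    (hS : IsAdapted D.dp D.dm l S) (fD : D.IsFredholm) : D.IsPinv (D.inverseOf S) := by
  obtain ⟨fp, fm⟩ := fD
  refine ⟨⟨?_, ?_⟩, ⟨?_, ?_⟩, ⟨?_, ?_⟩⟩
  · ext x
    simp [inverseOf_dp_apply, hS.symm_left]
  · ext x
    simp [inverseOf_dp_apply, hS.symm_left]
  · ext x
    simp [inverseOf_dm_apply, hS.apply_right]
  · ext x
    simp [inverseOf_dm_apply, hS.apply_right]
  -- `S` carries the kernel of `d₊` and the image of `d₋` onto those of the inverse complex, so
  -- `S⁻¹` embeds its homology in that of `D`.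
  · refine FiniteDimensional.of_injective (homologyMap (D.inverseOf S).dp (D.inverseOf S).dm
      D.dp D.dm (S.symm : Y →ₗ[F] X) ?_ ?_) (homologyMap_injective _ _ ?_)
    · intro y hy
      exact S.symm.map_eq_zero_iff.1 hy
    · intro z
      exact ⟨S z, by simp [inverseOf_dm_apply]⟩
    · rintro y ⟨z, hz⟩
      refine ⟨S.symm z, ?_⟩
      rw [inverseOf_dm_apply, S.apply_symm_apply, hz]
      simp
  · refine FiniteDimensional.of_injective (homologyMap (D.inverseOf S).dm (D.inverseOf S).dp
      D.dm D.dp (S : X →ₗ[F] Y) ?_ ?_) (homologyMap_injective _ _ ?_)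
    · intro y hy
      exact S.map_eq_zero_iff.1 hy
    · intro z
      exact ⟨S.symm z, by simp [inverseOf_dp_apply]⟩
    · rintro y ⟨z, hz⟩
      refine ⟨S z, ?_⟩
      rw [inverseOf_dp_apply, S.symm_apply_apply, hz]
      simp

/-- In `(d₊ + S d₋ S) S⁻¹ (d₊ + S d₋ S)` the cross terms contain `d₊ d₋` or `d₋ d₊`, and the other
two reduce by adaptedness. -/
theorem sigmaPlus_inverseOf_symm {l : D.HPlus ≃ₗ[F] D.HMinus} {S : X ≃ₗ[F] Y}
    (hS : IsAdapted D.dp D.dm l S) (x : X) :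
    D.sigmaPlus (D.inverseOf S) (S.symm (D.sigmaPlus (D.inverseOf S) x)) =
      D.sigmaPlus (D.inverseOf S) x := by
  simp [inverseOf_dm_apply, hS.symm_left, hS.apply_right, D.dp_dm_apply, D.dm_dp_apply]

theorem isFredholmOp_sigmaPlus {D' : Z2Complex F Y X} (h : D.IsPinv D') (fD : D.IsFredholm) :
    IsFredholmOp (D.sigmaPlus D') := by
  obtain ⟨fp, fm⟩ := fD
  exact ⟨(kerSigmaEquiv h).symm.finiteDimensional, (cokerSigmaEquiv h).finiteDimensional⟩

/-- The map `opDetToDeterminant` as an isomorphism. -/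
noncomputable def opDetEquivDeterminant {D' : Z2Complex F Y X} (h : D.IsPinv D') :
    OpDet (D.sigmaPlus D') ≃ₗ[F] D.Determinant :=
  TensorProduct.congr (detEquiv (kerSigmaEquiv h)) (detEquiv (cokerSigmaEquiv h)).dualMap

theorem opDetEquivDeterminant_apply {D' : Z2Complex F Y X} (h : D.IsPinv D')
    (z : OpDet (D.sigmaPlus D')) : opDetEquivDeterminant h z = opDetToDeterminant h z := rfl

/-- Adapted isomorphisms whose quotient has determinant one give a perturbation isomorphism. -/
theorem exists_isPertIso {l : D.HPlus ≃ₗ[F] D.HMinus} {m : E.HPlus ≃ₗ[F] E.HMinus}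
    {S R : X ≃ₗ[F] Y} (hS : IsAdapted D.dp D.dm l S) (hR : IsAdapted E.dp E.dm m R)
    (fD : D.IsFredholm) (fE : E.IsFredholm) (hp : HasFiniteRank (D.dp - E.dp))
    (hm : HasFiniteRank (D.dm - E.dm))
    (hSR : HasFiniteRank ((S : X →ₗ[F] Y) - (R : X →ₗ[F] Y)))
    (hdet : detClassDet ((R.symm : Y →ₗ[F] X) ∘ₗ (S : X →ₗ[F] Y)) = 1) :
    ∃ P, IsPertIso D E P := by
  have hD := isPinv_inverseOf hS fD
  have hE := isPinv_inverseOf hR fE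
  have hRS := hasFiniteRank_symm_sub_symm hSR
  have hp' : HasFiniteRank ((D.inverseOf S).dp - (E.inverseOf R).dp) :=
    (hRS.comp_sub_comp hp).comp_sub_comp hRS
  have hm' : HasFiniteRank ((D.inverseOf S).dm - (E.inverseOf R).dm) :=
    (hSR.comp_sub_comp hm).comp_sub_comp hSR
  have hσ : HasFiniteRank (D.sigmaPlus (D.inverseOf S) - E.sigmaPlus (E.inverseOf R)) := by
    rw [add_sub_add_comm]
    exact hp.add hm'
  obtain ⟨P₀, hP₀⟩ := exists_isOpPertIso (sigmaPlus_inverseOf_symm hS) (sigmaPlus_inverseOf_symm hR)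
    (isFredholmOp_sigmaPlus hD fD) (isFredholmOp_sigmaPlus hE fE) hσ hdet
  refine ⟨(opDetEquivDeterminant hD).symm.trans (P₀.trans (opDetEquivDeterminant hE)), fD, fE, hp,
    hm, _, _, hD, hE, P₀, hp', hm', hP₀, fun z => ?_⟩
  rw [← opDetEquivDeterminant_apply, ← opDetEquivDeterminant_apply]
  simp

/-- `1 - d₋ d₋^†` sends cycles to harmonic cycles and `d₊^† d₊` picks a noncycle representative.
Every pseudo-inverse complex thus enters the setting of adapted isomorphisms. -/
theorem isHodgeSplitting_of_isPinv {D' : Z2Complex F Y X} (h : D.IsPinv D') :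
    IsHodgeSplitting D.dp D.dm (LinearMap.ker D.dp ⊓ LinearMap.ker D'.dm)
      (LinearMap.range D'.dp) := by
  have h1 : ∀ x, D.dp (D'.dp (D.dp x)) = D.dp x := LinearMap.congr_fun h.plus.left
  have h2 : ∀ y, D'.dp (D.dp (D'.dp y)) = D'.dp y := LinearMap.congr_fun h.plus.right
  have h3 : ∀ y, D.dm (D'.dm (D.dm y)) = D.dm y := LinearMap.congr_fun h.minus.left
  have h4 : ∀ x, D'.dm (D.dm (D'.dm x)) = D'.dm x := LinearMap.congr_fun h.minus.right
  refine ⟨fun x hx => hx.1, fun y hy => ?_, fun x hx => ?_, ?_, fun x => ?_⟩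
  · have h5 : D'.dm (D.dm y) = 0 := hy.2
    rw [← h3, h5, map_zero]
  · refine ⟨x - D.dm (D'.dm x), ⟨?_, ?_⟩, D'.dm x, by abel⟩
    · change D.dp (x - D.dm (D'.dm x)) = 0
      rw [map_sub, hx, D.dp_dm_apply, sub_zero]
    · change D'.dm (x - D.dm (D'.dm x)) = 0
      rw [map_sub, h4, sub_self]
  · rintro _ ⟨y, rfl⟩ hy
    rw [← h2, hy, map_zero]
  · exact ⟨D'.dp (D.dp x), ⟨_, rfl⟩, (h1 x).symm⟩

/-- The complex `X₋ → X₊ → X₋` with the same differentials. -/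
def shifted (D : Z2Complex F X Y) : Z2Complex F Y X := ⟨D.dm, D.dp, D.dp_dm, D.dm_dp⟩

theorem IsPinv.shifted {D' : Z2Complex F Y X} (h : D.IsPinv D') : D.shifted.IsPinv D'.shifted :=
  ⟨h.minus, h.plus, h.fredholm.symm⟩

/-- A pseudo-inverse of a complex determines an adapted isomorphism, which is an invertible
extension of the operator `d₊ + d₋^†`. -/
theorem IsPinv.exists_isAdapted {D' : Z2Complex F Y X} (h : D.IsPinv D')
    (l : D.HPlus ≃ₗ[F] D.HMinus) :
    ∃ (S : X ≃ₗ[F] Y) (p : X →ₗ[F] LinearMap.ker (D.sigmaPlus D')), IsAdapted D.dp D.dm l S ∧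
      IsInvertibleExtension (D.sigmaPlus D') S p ∧
      kerToCokerOf (D.sigmaPlus D') S =
        (((kerSigmaEquiv h).trans l).trans (cokerSigmaEquiv h) : _ →ₗ[F] _) := by
  have h1 : ∀ x, D.dp (D'.dp (D.dp x)) = D.dp x := LinearMap.congr_fun h.plus.left
  have h4 : ∀ x, D'.dm (D.dm (D'.dm x)) = D'.dm x := LinearMap.congr_fun h.minus.right
  obtain ⟨S, hS, hS1, hS2, hS3⟩ := (isHodgeSplitting_of_isPinv h).exists_isAdapted
    (isHodgeSplitting_of_isPinv h.shifted) D.dp_dm_apply D.dm_dp_apply l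
  have hmem : ∀ x, (LinearMap.id - D.dm ∘ₗ D'.dm - D'.dp ∘ₗ D.dp : X →ₗ[F] X) x ∈
      LinearMap.ker (D.sigmaPlus D') := by
    intro x
    refine (ker_sigmaPlus_iff h _).2 ⟨?_, ?_⟩
    · simp [h1, D.dp_dm_apply]
    · simp [h4, D'.dm_dp_apply]
  -- The harmonic projection `1 - d₋ d₋^† - d₊^† d₊`. On the complementary part `S` equals `d₊ +
  -- d₋^†`, as an invertible extension must.
  refine ⟨S, LinearMap.codRestrict _ _ hmem, hS, ⟨fun k => ?_, fun x => ?_⟩, ?_⟩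
  · obtain ⟨h5, h6⟩ := (ker_sigmaPlus_iff h k).1 k.2
    apply Subtype.ext
    simp [h5, h6]
  · rw [LinearMap.codRestrict_apply]
    have h5 : S (D.dm (D'.dm x)) = D'.dm x := hS2 _ ⟨x, rfl⟩
    have h6 : S (D'.dp (D.dp x)) = D.dp x := by rw [hS1 _ ⟨_, rfl⟩, h1]
    simp only [LinearMap.sub_apply, LinearMap.id_apply, LinearMap.comp_apply, LinearMap.add_apply,
      map_sub, h5, h6]
    abel
  · ext k
    obtain ⟨h5, h6⟩ := (ker_sigmaPlus_iff h k).1 k.2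
    have h7 : D.dm (S k) = 0 := (hS3 k ⟨h5, h6⟩).1
    exact congrArg (cokerSigmaEquiv h) (hS.homology k h5 h7)

theorem opDetToDeterminant_tmul {D' : Z2Complex F Y X} (h : D.IsPinv D')
    (a : DetLine F D.HPlus) (χ : Module.Dual F (DetLine F D.HMinus)) :
    opDetToDeterminant h (detMap (kerSigmaEquiv h).symm a ⊗ₜ[F]
      (χ ∘ₗ detMap (cokerSigmaEquiv h).symm)) = a ⊗ₜ[F] χ :=
  map_detMap_tmul _ _ a χ

set_option maxHeartbeats 1600000 in
/-- A perturbation isomorphism is computed by any pair of adapted isomorphisms whose quotient has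
determinant one. -/
theorem IsPertIso.apply_tmul {P : D.Determinant ≃ₗ[F] E.Determinant} (hP : IsPertIso D E P)
    {l : D.HPlus ≃ₗ[F] D.HMinus} {m : E.HMinus ≃ₗ[F] E.HPlus}
    {S R : X ≃ₗ[F] Y} (hS : IsAdapted D.dp D.dm l S) (hR : IsAdapted E.dp E.dm m.symm R)
    (hSR : HasFiniteRank ((S : X →ₗ[F] Y) - (R : X →ₗ[F] Y)))
    (hdet : detClassDet ((R.symm : Y →ₗ[F] X) ∘ₗ (S : X →ₗ[F] Y)) = 1)
    (s : DetLine F D.HPlus) (t : DetLine F E.HMinus) (φ : Module.Dual F (DetLine F D.HMinus))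
    (ψ : Module.Dual F (DetLine F E.HMinus)) (hφ : IsDualVector φ (detMap l s))
    (hψ : IsDualVector ψ t) : P (s ⊗ₜ[F] φ) = detMap m t ⊗ₜ[F] ψ := by
  obtain ⟨fD, fE, hp, hm, D', E', hD, hE, P₀, -, -, hP₀, hPP₀⟩ := hP
  obtain ⟨S₁, p₁, hS₁, iS₁, kS₁⟩ := hD.exists_isAdapted l
  obtain ⟨R₁, q₁, hR₁, iR₁, kR₁⟩ := hE.exists_isAdapted m.symm
  obtain ⟨S₀, R₀, p₀, q₀, iS₀, iR₀, hc⟩ := hP₀.exists_isDeterminantComparison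
    (((kerSigmaEquiv hD).trans l).trans (cokerSigmaEquiv hD)).finrank_eq
    (((kerSigmaEquiv hE).trans m.symm).trans (cokerSigmaEquiv hE)).finrank_eq
  have := hP₀.1.1
  have := hP₀.2.1.1
  -- The extensions coming from the arbitrary perturbation triple are traded for adapted ones; these
  -- are then compared with the given pair, of determinant one.
  have hc₁ := hc.change hP₀.2.2.1 iS₀ iS₁ iR₀ iR₁
  have hd : detClassDet ((R₁.symm : Y →ₗ[F] X) ∘ₗ (S₁ : X →ₗ[F] Y)) = 1 := by
    rw [← hdet]
    exact hS.detClassDet_eq D.dp_dm_apply D.dm_dp_apply E.dp_dm_apply E.dm_dp_apply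
      (hasFiniteRank_sub_comm hp) (hasFiniteRank_sub_comm hm) hS₁ hR hR₁
      (hasFiniteRank_sub_comm hSR)
      (hasFiniteRank_sub_comm (iS₁.sub_hasFiniteRank hP₀.2.2.1 iR₁))
  -- The vectors are pulled back to `Ker σ₊` and `Coker σ₊`; there `S₁` and `R₁` induce `l` and
  -- `m⁻¹`, so the vectors paired are `s` with `l s` and `m t` with `t`.
  have key := hc₁ (detMap (kerSigmaEquiv hD).symm s) (detMap (cokerSigmaEquiv hD) (detMap l s))
    (detMap (kerSigmaEquiv hE).symm (detMap m t)) (detMap (cokerSigmaEquiv hE) t)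
    (φ ∘ₗ detMap (cokerSigmaEquiv hD).symm) (ψ ∘ₗ detMap (cokerSigmaEquiv hE).symm)
    (by
      have h : (kerSigmaEquiv hD).symm.trans (((kerSigmaEquiv hD).trans l).trans
          (cokerSigmaEquiv hD)) = l.trans (cokerSigmaEquiv hD) := LinearEquiv.ext fun x => by simp
      rw [kS₁, ← coe_detMap, detMap_detMap, detMap_detMap, h])
    (by
      have h : m.trans ((kerSigmaEquiv hE).symm.trans (((kerSigmaEquiv hE).trans m.symm).trans
          (cokerSigmaEquiv hE))) = cokerSigmaEquiv hE := LinearEquiv.ext fun x => by simp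
      rw [kR₁, ← coe_detMap, detMap_detMap, detMap_detMap, h])
    (by
      unfold IsDualVector
      rw [LinearMap.comp_apply, detMap_detMap, LinearEquiv.self_trans_symm, detMap_refl]
      exact hφ)
    (by
      unfold IsDualVector
      rw [LinearMap.comp_apply, detMap_detMap, LinearEquiv.self_trans_symm, detMap_refl]
      exact hψ)
  rw [hd, inv_one, one_smul] at key
  rw [← opDetToDeterminant_tmul hD s φ, hPP₀, key, opDetToDeterminant_tmul hE]

theorem isFredholm_pad {Xp Xm : Type*} [AddCommGroup Xp] [Module F Xp] [AddCommGroup Xm]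
    [Module F Xm] {D : Z2Complex F Xp Xm} (fD : D.IsFredholm) (np nm : ℕ) :
    (D.pad np nm).IsFredholm := by
  obtain ⟨fp, fm⟩ := fD
  constructor
  · let i := homologyMap D.dp D.dm (D.pad np nm).dp (D.pad np nm).dm
      (LinearMap.inl F Xp (Fin np → F)) (fun x hx => Prod.ext hx rfl)
      (fun z => ⟨(z, 0), rfl⟩)
    let j : (Fin np → F) →ₗ[F] (D.pad np nm).HPlus :=
      Submodule.mkQ _ ∘ₗ (LinearMap.inr F Xp (Fin np → F)).codRestrict
        (LinearMap.ker (D.pad np nm).dp) (fun x => Prod.ext (map_zero D.dp) rfl)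
    refine FiniteDimensional.of_surjective (i.coprod j) fun q => ?_
    obtain ⟨⟨x, u⟩, hx, rfl⟩ := homologyMk_surjective _ _ q
    have hx' : D.dp x = 0 := congrArg Prod.fst hx
    refine ⟨(homologyMk D.dp D.dm x hx', u), ?_⟩
    refine (Submodule.Quotient.eq _).2 ⟨0, ?_⟩
    rw [map_zero]
    change (0 : Xp × (Fin np → F)) = (x, 0) + (0, u) - (x, u)
    simp
  · let i := homologyMap D.dm D.dp (D.pad np nm).dm (D.pad np nm).dp
      (LinearMap.inl F Xm (Fin nm → F)) (fun x hx => Prod.ext hx rfl)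
      (fun z => ⟨(z, 0), rfl⟩)
    let j : (Fin nm → F) →ₗ[F] (D.pad np nm).HMinus :=
      Submodule.mkQ _ ∘ₗ (LinearMap.inr F Xm (Fin nm → F)).codRestrict
        (LinearMap.ker (D.pad np nm).dm) (fun x => Prod.ext (map_zero D.dm) rfl)
    refine FiniteDimensional.of_surjective (i.coprod j) fun q => ?_
    obtain ⟨⟨x, u⟩, hx, rfl⟩ := homologyMk_surjective _ _ q
    have hx' : D.dm x = 0 := congrArg Prod.fst hx
    refine ⟨(homologyMk D.dm D.dp x hx', u), ?_⟩
    refine (Submodule.Quotient.eq _).2 ⟨0, ?_⟩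
    rw [map_zero]
    change (0 : Xm × (Fin nm → F)) = (x, 0) + (0, u) - (x, u)
    simp

end Z2Complex

/-! ### The proposition. -/

set_option maxHeartbeats 1600000 in
theorem proposition4p2 {F : Type*} [Field F] {Xp Xm : Type*} [AddCommGroup Xp] [Module F Xp]
    [AddCommGroup Xm] [Module F Xm]
    (D : Z2Complex F Xp Xm) (hD : D.IsFredholm)
    (np nm : ℕ) (hind : D.index = (nm : ℤ) - (np : ℤ))
    (S : D.PertMaps np nm)
    (L : (D.pad np nm).HPlus ≃ₗ[F] (D.pad np nm).HMinus)
    (M : S.hat.HMinus ≃ₗ[F] S.hat.HPlus)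
    (Vp Zp : Submodule F (Fin np → F)) (Vm : Submodule F (Fin nm → F))
    (Qp : Submodule F Xp) (Qm : Submodule F Xm)
    (Ep : Xp →ₗ[F] Xp) (Em : Xm →ₗ[F] Xm) (Om : (Fin nm → F) →ₗ[F] (Fin nm → F))
    (hZp : Zp ≤ LinearMap.ker S.Fp)
    (hVW_disj : Disjoint Vp S.Wp) (hVW_span : Vp ⊔ S.Wp = LinearMap.ker S.Np)
    (hVWZ : IsCompl (Vp ⊔ S.Wp) Zp) (hVWm : IsCompl Vm S.Wm)
    (hproj : S.IsProjData Qp Qm Ep Em Om)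
    (hL : ∀ vp ∈ Vp, ∀ zp ∈ Zp, ∀ vm ∈ Vm,
      L (S.classPlus vm (vp + zp)) = S.classMinus vp (vm + S.Np zp))
    (hM : ∀ x : S.hat.HMinus,
      Z2Complex.PertMaps.phiPlus hproj (M x) = L.symm (Z2Complex.PertMaps.phiMinus hproj x)) :
    (∃ P, Z2Complex.IsPertIso (D.pad np nm) S.hat P) ∧
    ∀ P, Z2Complex.IsPertIso (D.pad np nm) S.hat P →
      ∀ (s_p : DetLine F (D.pad np nm).HPlus) (s_m : DetLine F S.hat.HMinus)
        (φ : Module.Dual F (DetLine F (D.pad np nm).HMinus))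
        (ψ : Module.Dual F (DetLine F S.hat.HMinus)),
        IsDualVector φ (detMap L s_p) → IsDualVector ψ s_m →
        P (s_p ⊗ₜ[F] φ) = detMap M s_m ⊗ₜ[F] ψ := by

  have fpad := Z2Complex.isFredholm_pad hD np nm
  -- `φ₊` embeds `H₊` of the perturbed complex in a finite dimensional space, and `M` transfers
  -- finiteness to `H₋`.
  have fhat : S.hat.IsFredholm := by
    have := fpad.1
    have hp : FiniteDimensional F S.hat.HPlus :=
      FiniteDimensional.of_injective _ (Z2Complex.PertMaps.phiPlus_injective hproj)
    exact ⟨hp, M.symm.finiteDimensional⟩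
  obtain ⟨T, R, hT, hR, hdet, hTR⟩ := Z2Complex.PertMaps.exists_adapted_pair L M Vp Zp Vm hZp
    hVW_disj hVW_span hVWZ hVWm hproj hL hM
  exact ⟨Z2Complex.exists_isPertIso hT hR fpad fhat Z2Complex.PertMaps.hasFiniteRank_pad_dp_sub
    Z2Complex.PertMaps.hasFiniteRank_pad_dm_sub hTR hdet,
    fun P hP => hP.apply_tmul hT hR hTR hdet⟩
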